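/- **Setting.** A tabular vector-valued Markov game (VMG) $\mathcal G=(\mathcal S,\mathcal A,\mathcal B,H,\mathbb P,\mathbf r)$ has finite state space $|\mathcal S|\le S$, finite action sets $|\mathcal A|\le A$ (min-player) and $|\mathcal B|\le B$ (max-player), horizon $H$, a fixed initial state $s_1$, unknown transition probabilities $\mathbb P_h(\cdot\mid s,a,b)$ and unknown mean returns $\mathbf r_h(s,a,b)$ in the closed Euclidean unit ball of $\mathbb R^d$, $d\ge1$. In an episode the two players take actions $a_h,b_h$ in state $s_h$, for $h=1,\dots,H$; given the past, $s_{h+1}\sim\mathbb P_h(\cdot\mid s_h,a_h,b_h)$, and a random return vector with conditional mean $\mathbf r_h(s_h,a_h,b_h)$ is generated, which lies in the unit ball almost surely. For $\|\theta\|\le 1$ and Markov policies $\mu=(\mu_h:\mathcal S\to\Delta(\mathcal A))$, $\nu=(\nu_h:\mathcal S\to\Delta(\mathcal B))$, let $V_h^{\mu,\nu}(s;\theta)$ be the value function of the scalar game $\mathcal G_\theta$ with rewards $\langle\theta,\mathbf r_h\rangle$, and let $V_h^{\mu,\dagger}=\max_{\nu'}V_h^{\mu,\nu'}$, $V_h^{\dagger,\nu}=\min_{\mu'}V_h^{\mu',\nu}$.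 **Algorithm (VI-Zero, $K$ episodes, bonus $\beta_t$).** Let $N^k_h(s,a,b)$ and $N^k_h(s,a,b,s')$ count the visits and transitions in step $h$ of the episodes before episode $k$, and let $\widehat{\mathbb P}^k_h$, $\widehat{\mathbf r}^k_h$ be the corresponding empirical frequencies and empirical means of the sampled returns. Set $\widetilde V^k_{H+1}=0$ and, for $h=H,\dots,1$, $$\widetilde Q^k_h(s,a,b)=\begin{cases}\min\{[\widehat{\mathbb P}^k_h\widetilde V^k_{h+1}](s,a,b)+\beta_{N^k_h(s,a,b)},\,H\} & \text{if } N^k_h(s,a,b)>0,\\ H & \text{otherwise,}\end{cases}\qquad \widetilde V^k_h(s)=\max_{a,b}\widetilde Q^k_h(s,a,b).$$ In episode $k$ both players follow the joint policy $\pi^k_h(s)\in\arg\max_{a,b}\widetilde Q^k_h(s,a,b)$ (ties broken by any fixed rule); no return is used. Let $\mathrm{out}\in\arg\min_{1\le k\le K}\widetilde V^k_1(s_1)$. In the planning phase the sampled returns are revealed, and for a query $\theta$ the output $(\mu_\theta,\nu_\theta)$ is an output of Nash value iteration, or any other Nash equilibrium (for all steps and states), for the empirical game $\widehat{\mathcal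 G}^{\mathrm{out}}_\theta$ with transitions $\widehat{\mathbb P}^{\mathrm{out}}$ and rewards $\langle\theta,\widehat{\mathbf r}^{\mathrm{out}}\rangle$; at triples without a visit the transition probabilities, and the returns in the unit ball, of the empirical game may be chosen arbitrarily. **Theorem.** There are absolute constants $c_\beta,c_K>0$ such that for all positive integers $d,H,S,A,B$ and all $\varepsilon\in(0,H]$, $\delta\in(0,1]$ the following holds. Put $$\iota=\log\frac{dSABKH}{\delta},\qquad \beta_t=c_\beta\Big(\sqrt{\frac{\min\{d,S\}H^2\iota}{t}}+\frac{H^2S\iota}{t}\Big),\qquad \iota'=\log\frac{dSABH}{\min\{\varepsilon,1\}\,\delta}.$$ If $$K\ \ge\ c_K\Big(\frac{\min\{d,S\}H^4SAB\,\iota'}{\varepsilon^2}+\frac{H^3S^2AB\,(\iota')^2}{\varepsilon}\Big),$$ then for every such VMG, with probability at least $1-\delta$, simultaneously for all $\|\theta\|\le 1$, the planning phase has an output and every output $(\mu_\theta,\nu_\theta)$ satisfies $$V_1^{\mu_\theta,\dagger}(s_1;\theta)-V_1^{\dagger,\nu_\theta}(s_1;\theta)\le\varepsilon .$$ Hence the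 algorithm is a reward-free algorithm for tabular VMGs: some number of episodes $m_{\mathrm{RFE}}(\varepsilon,\delta)\le\big\lceil c_K\big(\min\{d,S\}H^4SAB\,\iota'/\varepsilon^2+H^3S^2AB\,(\iota')^2/\varepsilon\big)\big\rceil$, not depending on the game, suffices. -/

import Mathlib

open MeasureTheory

universe u v w z

/-- A Markov policy of one player over `H` steps: a mixed action for every step and state. -/
abbrev Policy (H : ℕ) (𝒮 𝒜 : Type*) [Fintype 𝒜] : Type _ :=
  Fin H → 𝒮 → stdSimplex ℝ 𝒜

/-- A tabular vector-valued Markov game with `H` steps and `d`-dimensional returns. Step `h` of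
the text, `1 ≤ h ≤ H`, is the element `h - 1` of `Fin H`. The first action belongs to the
min-player, the second one to the max-player; `ret` is the mean return. -/
structure VMG (d H : ℕ) (𝒮 𝒜 ℬ : Type*) [Fintype 𝒮] where
  trans : Fin H → 𝒮 → 𝒜 → ℬ → stdSimplex ℝ 𝒮
  ret : Fin H → 𝒮 → 𝒜 → ℬ → EuclideanSpace ℝ (Fin d)
  norm_ret_le : ∀ h s a b, ‖ret h s a b‖ ≤ 1

/-- The expected payoff of a matrix game under mixed actions `x` (min-player), `y` (max-player). -/
noncomputable def matrixPayoff {𝒜 ℬ : Type*} [Fintype 𝒜] [Fintype ℬ]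
    (M : 𝒜 → ℬ → ℝ) (x : stdSimplex ℝ 𝒜) (y : stdSimplex ℝ ℬ) : ℝ :=
  ∑ a, ∑ b, x.1 a * y.1 b * M a b

/-- `(x, y)` is a Nash equilibrium of the zero-sum matrix game `M`, rows minimizing. -/
def IsMatrixNash {𝒜 ℬ : Type*} [Fintype 𝒜] [Fintype ℬ]
    (M : 𝒜 → ℬ → ℝ) (x : stdSimplex ℝ 𝒜) (y : stdSimplex ℝ ℬ) : Prop :=
  (∀ x', matrixPayoff M x y ≤ matrixPayoff M x' y) ∧
  (∀ y', matrixPayoff M x y' ≤ matrixPayoff M x y)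

namespace VMG

variable {d H : ℕ} {𝒮 𝒜 ℬ : Type*} [Fintype 𝒮] [Fintype 𝒜] [Fintype ℬ]

/-- One step of look-ahead in the game scalarized by `θ`: the expected immediate scalar return
plus the expectation of `V` at the next state. -/
noncomputable def lookahead (G : VMG d H 𝒮 𝒜 ℬ) (θ : EuclideanSpace ℝ (Fin d)) (h : Fin H)
    (V : 𝒮 → ℝ) (s : 𝒮) (a : 𝒜) (b : ℬ) : ℝ :=
  inner ℝ θ (G.ret h s a b) + ∑ s', (G.trans h s a b).1 s' * V s'

/-- The value function of `(μ, ν)` in the game scalarized by `θ`: the expected sum of the scalar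
returns from step `h` on, started at `s`, evaluated backwards from the value `0` after the last
step. The index runs over the `H` steps and the end of the episode. -/
noncomputable def value (G : VMG d H 𝒮 𝒜 ℬ) (θ : EuclideanSpace ℝ (Fin d))
    (μ : Policy H 𝒮 𝒜) (ν : Policy H 𝒮 ℬ) : Fin (H + 1) → 𝒮 → ℝ :=
  Fin.reverseInduction (motive := fun _ => 𝒮 → ℝ) (fun _ => 0)
    (fun h V s => matrixPayoff (G.lookahead θ h V s) (μ h s) (ν h s))

/-- The Q-value function of `(μ, ν)` in the game scalarized by `θ`. -/
noncomputable def qValue (G : VMG d H 𝒮 𝒜 ℬ) (θ : EuclideanSpace ℝ (Fin d))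
    (μ : Policy H 𝒮 𝒜) (ν : Policy H 𝒮 ℬ) (h : Fin H) : 𝒮 → 𝒜 → ℬ → ℝ :=
  G.lookahead θ h (G.value θ μ ν h.succ)

/-- The value of `μ` against a best response of the max-player. The supremum is over a nonempty
set (if there is an action) of numbers in `[-H ‖θ‖, H ‖θ‖]`. -/
noncomputable def valueVsBestMax (G : VMG d H 𝒮 𝒜 ℬ) (θ : EuclideanSpace ℝ (Fin d))
    (μ : Policy H 𝒮 𝒜) (h : Fin (H + 1)) (s : 𝒮) : ℝ :=
  ⨆ ν : Policy H 𝒮 ℬ, G.value θ μ ν h s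

/-- The value of `ν` against a best response of the min-player. -/
noncomputable def valueVsBestMin (G : VMG d H 𝒮 𝒜 ℬ) (θ : EuclideanSpace ℝ (Fin d))
    (ν : Policy H 𝒮 ℬ) (h : Fin (H + 1)) (s : 𝒮) : ℝ :=
  ⨅ μ : Policy H 𝒮 𝒜, G.value θ μ ν h s

/-- The duality gap of `(μ, ν)` at the initial state in the game scalarized by `θ`. -/
noncomputable def dualityGap (G : VMG d H 𝒮 𝒜 ℬ) (s₁ : 𝒮) (θ : EuclideanSpace ℝ (Fin d))
    (μ : Policy H 𝒮 𝒜) (ν : Policy H 𝒮 ℬ) : ℝ :=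
  G.valueVsBestMax θ μ 0 s₁ - G.valueVsBestMin θ ν 0 s₁

/-- Nash equilibrium of the game scalarized by `θ`: from no step and no state on can a player gain
by changing the own policy. -/
def IsNash (G : VMG d H 𝒮 𝒜 ℬ) (θ : EuclideanSpace ℝ (Fin d))
    (μ : Policy H 𝒮 𝒜) (ν : Policy H 𝒮 ℬ) : Prop :=
  ∀ h s, (∀ μ', G.value θ μ ν h s ≤ G.value θ μ' ν h s) ∧
    (∀ ν', G.value θ μ ν' h s ≤ G.value θ μ ν h s)

/-- `(μ, ν)` is a possible output of Nash value iteration on the game scalarized by `θ`: going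
backwards from `h = H`, with `Q_h = r_h + P_h V_{h+1}`, the pair `(μ_h(s), ν_h(s))` is some Nash
equilibrium of the matrix game `Q_h(s, ·, ·)`, and `V_h(s)` is the payoff under this pair.
As the `V_h` computed like this is the value function of `(μ, ν)`, it is written so. -/
def IsNashVIOutput (G : VMG d H 𝒮 𝒜 ℬ) (θ : EuclideanSpace ℝ (Fin d))
    (μ : Policy H 𝒮 𝒜) (ν : Policy H 𝒮 ℬ) : Prop :=
  ∀ h s, IsMatrixNash (G.qValue θ μ ν h s) (μ h s) (ν h s)

end VMG

/-- What is observed in one episode of exploration: the states `s_1, …, s_{H+1}` and the joint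
actions of the `H` steps, but no returns. -/
structure Episode (H : ℕ) (𝒮 𝒜 ℬ : Type*) where
  state : Fin (H + 1) → 𝒮
  act : Fin H → 𝒜 × ℬ

/-- An algorithm with an exploration phase of `K` episodes, in which it controls both players.
Before each episode, `explore` chooses a (deterministic) joint policy from the states and actions
of the past episodes, without the returns. After the last episode the sampled returns
are revealed too, and `plan` is the set of its possible outputs for the query `θ`. -/
structure ExplorePlan (K d H : ℕ) (𝒮 𝒜 ℬ : Type*) [Fintype 𝒜] [Fintype ℬ] where
  explore : (k : ℕ) → (Fin k → Episode H 𝒮 𝒜 ℬ) → Fin H → 𝒮 → 𝒜 × ℬ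
  plan : (Fin K → Episode H 𝒮 𝒜 ℬ) → (Fin K → Fin H → EuclideanSpace ℝ (Fin d)) →
    EuclideanSpace ℝ (Fin d) → Set (Policy H 𝒮 𝒜 × Policy H 𝒮 ℬ)

/-- The exploration phase of `alg` on the game `G`, as a random process on `(Ω, P)`: episode `k`
starts at `s₁`, the joint action of step `h` is the one prescribed by the policy chosen before the
episode, and, given all that happened until the action of step `h` is taken, the next state is
distributed according to `G.trans` and the sampled return, which lies in the unit ball, has mean
`G.ret`. `ℱ (k * (H + 1) + h)` is the information up to the state of step `h` in episode `k`. -/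
structure ExplorationRun {K d H : ℕ} {𝒮 𝒜 ℬ : Type*} [Fintype 𝒮] [Fintype 𝒜] [Fintype ℬ]
    (alg : ExplorePlan K d H 𝒮 𝒜 ℬ) (G : VMG d H 𝒮 𝒜 ℬ) (s₁ : 𝒮)
    {Ω : Type*} [m : MeasurableSpace Ω] (P : Measure Ω) where
  episode : Fin K → Ω → Episode H 𝒮 𝒜 ℬ
  ret : Fin K → Fin H → Ω → EuclideanSpace ℝ (Fin d)
  ℱ : Filtration ℕ m
  state_zero : ∀ k ω, (episode k ω).state 0 = s₁
  act_eq : ∀ (k : Fin K) (h : Fin H) (ω : Ω), (episode k ω).act h =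
    alg.explore k (fun i => episode (Fin.castLE k.isLt.le i) ω) h
      ((episode k ω).state h.castSucc)
  measurable_state : ∀ (k : Fin K) (h : Fin (H + 1)) (s : 𝒮),
    MeasurableSet[ℱ (k * (H + 1) + h)] {ω | (episode k ω).state h = s}
  condExp_state : ∀ (k : Fin K) (h : Fin H) (s' : 𝒮),
    P[Set.indicator {ω | (episode k ω).state h.succ = s'} (fun _ => (1 : ℝ)) |
        ℱ (k * (H + 1) + h)] =ᵐ[P]
      fun ω => (G.trans h ((episode k ω).state h.castSucc)
        ((episode k ω).act h).1 ((episode k ω).act h).2).1 s'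
  measurable_ret : ∀ (k : Fin K) (h : Fin H),
    StronglyMeasurable[ℱ (k * (H + 1) + h + 1)] (ret k h)
  norm_ret_le : ∀ k h, ∀ᵐ ω ∂P, ‖ret k h ω‖ ≤ 1
  condExp_ret : ∀ (k : Fin K) (h : Fin H),
    P[ret k h | ℱ (k * (H + 1) + h)] =ᵐ[P]
      fun ω => G.ret h ((episode k ω).state h.castSucc)
        ((episode k ω).act h).1 ((episode k ω).act h).2

/-- The guarantee of a reward-free algorithm with accuracy `ε` and confidence `1 - δ`, reached after
the `K` episodes of `alg`: for every game and every run of the exploration phase, outside an event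
of probability at most `δ`, for all `θ` in the unit ball the planning phase has an output and
every output has duality gap at most `ε`. -/
def ExplorePlan.IsRewardFree {K d H : ℕ} {𝒮 : Type u} {𝒜 : Type v} {ℬ : Type w}
    [Fintype 𝒮] [Fintype 𝒜] [Fintype ℬ]
    (alg : ExplorePlan K d H 𝒮 𝒜 ℬ) (s₁ : 𝒮) (ε δ : ℝ) : Prop :=
  ∀ (G : VMG d H 𝒮 𝒜 ℬ) (Ω : Type z) [MeasurableSpace Ω] (P : Measure Ω)
    [IsProbabilityMeasure P] (R : ExplorationRun alg G s₁ P),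
    P {ω | ¬ ∀ θ : EuclideanSpace ℝ (Fin d), ‖θ‖ ≤ 1 →
        (alg.plan (fun k => R.episode k ω) (fun k h => R.ret k h ω) θ).Nonempty ∧
        ∀ μ ν, (μ, ν) ∈ alg.plan (fun k => R.episode k ω) (fun k h => R.ret k h ω) θ →
          G.dualityGap s₁ θ μ ν ≤ ε} ≤ ENNReal.ofReal δ

namespace VIZero

variable {k d H : ℕ} {𝒮 𝒜 ℬ : Type*}

open Classical in
/-- The set of episodes among the given ones that visit `(s, a, b)` in step `h`. -/
noncomputable def visitSet (D : Fin k → Episode H 𝒮 𝒜 ℬ) (h : Fin H) (s : 𝒮) (a : 𝒜) (b : ℬ) :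
    Finset (Fin k) :=
  {i | (D i).state h.castSucc = s ∧ (D i).act h = (a, b)}

/-- The counter `N_h(s, a, b)`. -/
noncomputable def visits (D : Fin k → Episode H 𝒮 𝒜 ℬ) (h : Fin H) (s : 𝒮) (a : 𝒜) (b : ℬ) : ℕ :=
  (visitSet D h s a b).card

open Classical in
/-- The counter `N_h(s, a, b, s')`. -/
noncomputable def visitsTo (D : Fin k → Episode H 𝒮 𝒜 ℬ) (h : Fin H) (s : 𝒮) (a : 𝒜) (b : ℬ)
    (s' : 𝒮) : ℕ :=
  ((visitSet D h s a b).filter fun i => (D i).state h.succ = s').card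

/-- The empirical transition probability, used only where `visits` is positive. -/
noncomputable def empTrans (D : Fin k → Episode H 𝒮 𝒜 ℬ) (h : Fin H) (s : 𝒮) (a : 𝒜) (b : ℬ)
    (s' : 𝒮) : ℝ :=
  (visitsTo D h s a b s' : ℝ) / visits D h s a b

/-- The empirical mean of the sampled returns, used only where `visits` is positive. -/
noncomputable def empRet (D : Fin k → Episode H 𝒮 𝒜 ℬ)
    (r : Fin k → Fin H → EuclideanSpace ℝ (Fin d)) (h : Fin H) (s : 𝒮) (a : 𝒜) (b : ℬ) :
    EuclideanSpace ℝ (Fin d) :=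
  (visits D h s a b : ℝ)⁻¹ • ∑ i ∈ visitSet D h s a b, r i h

section

variable [Fintype 𝒮]

/-- The update of the uncertainty function `Q̃_h` from `Ṽ_{h+1} = V`, with bonus `β`. -/
noncomputable def qUpdate (β : ℕ → ℝ) (D : Fin k → Episode H 𝒮 𝒜 ℬ) (h : Fin H) (V : 𝒮 → ℝ)
    (s : 𝒮) (p : 𝒜 × ℬ) : ℝ :=
  if visits D h s p.1 p.2 = 0 then (H : ℝ)
  else min (∑ s', empTrans D h s p.1 p.2 s' * V s' + β (visits D h s p.1 p.2)) (H : ℝ)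

variable [Fintype 𝒜] [Fintype ℬ] [Nonempty 𝒜] [Nonempty ℬ]

/-- The function `Ṽ` at the beginning of the episode that follows the data `D`. -/
noncomputable def vTilde (β : ℕ → ℝ) (D : Fin k → Episode H 𝒮 𝒜 ℬ) : Fin (H + 1) → 𝒮 → ℝ :=
  Fin.reverseInduction (motive := fun _ => 𝒮 → ℝ) (fun _ => 0)
    (fun h V s => Finset.univ.sup' Finset.univ_nonempty (qUpdate β D h V s))

/-- The function `Q̃` at the beginning of the episode that follows the data `D`. -/
noncomputable def qTilde (β : ℕ → ℝ) (D : Fin k → Episode H 𝒮 𝒜 ℬ) (h : Fin H) (s : 𝒮) :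
    𝒜 × ℬ → ℝ :=
  qUpdate β D h (vTilde β D h.succ) s

/-- `Ghat` is an empirical game for the data `D`, `r`: it has the empirical transitions and mean
returns wherever there is a visit, and anything elsewhere. -/
def IsEmpiricalGame (D : Fin k → Episode H 𝒮 𝒜 ℬ) (r : Fin k → Fin H → EuclideanSpace ℝ (Fin d))
    (Ghat : VMG d H 𝒮 𝒜 ℬ) : Prop :=
  ∀ h s a b, visits D h s a b ≠ 0 →
    (Ghat.trans h s a b).1 = empTrans D h s a b ∧ Ghat.ret h s a b = empRet D r h s a b

/-- VI-Zero with bonus `β` over joint actions. In the exploration phase, ties in the argmax are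
broken by `sel`. The planning phase takes a `k` with `Ṽ^k_1(s₁)` least and a game
`Ghat` that is empirical for the data before episode `k`, and returns the output of Nash value
iteration, or any other Nash equilibrium, for `Ghat` scalarized by `θ`. -/
noncomputable def algorithm (K : ℕ) (β : ℕ → ℝ) (s₁ : 𝒮)
    (sel : ℕ → Fin H → 𝒮 → (𝒜 × ℬ → ℝ) → 𝒜 × ℬ) : ExplorePlan K d H 𝒮 𝒜 ℬ where
  explore k D h s := sel k h s (qTilde β D h s)
  plan D r θ := {π | ∃ k : Fin K,
    (∀ j : Fin K, vTilde β (fun i : Fin k => D (Fin.castLE k.isLt.le i)) 0 s₁ ≤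
      vTilde β (fun i : Fin j => D (Fin.castLE j.isLt.le i)) 0 s₁) ∧
    ∃ Ghat : VMG d H 𝒮 𝒜 ℬ,
      IsEmpiricalGame (fun i : Fin k => D (Fin.castLE k.isLt.le i))
        (fun i : Fin k => r (Fin.castLE k.isLt.le i)) Ghat ∧
      (Ghat.IsNashVIOutput θ π.1 π.2 ∨ Ghat.IsNash θ π.1 π.2)}

end

/-- The bonus `β_t`, with `ι = log (d S A B K H / δ)`. -/
noncomputable def bonus (c : ℝ) (d H S A B K : ℕ) (δ : ℝ) (t : ℕ) : ℝ :=
  c * (√(min (d : ℝ) S * H ^ 2 * Real.log (d * S * A * B * K * H / δ) / t) +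
    H ^ 2 * S * Real.log (d * S * A * B * K * H / δ) / t)

/-- The logarithmic factor `log (d S A B H / (min(ε, 1) δ))` of the sample complexity. -/
noncomputable def logFactor (d H S A B : ℕ) (ε δ : ℝ) : ℝ :=
  Real.log (d * S * A * B * H / (min ε 1 * δ))

/-- The sample complexity `min(d, S) H⁴ S A B ι / ε² + H³ S² A B ι² / ε`. -/
noncomputable def rate (d H S A B : ℕ) (ε δ : ℝ) : ℝ :=
  min (d : ℝ) S * H ^ 4 * S * A * B * logFactor d H S A B ε δ / ε ^ 2 +
    H ^ 3 * S ^ 2 * A * B * logFactor d H S A B ε δ ^ 2 / ε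

/-- For all games with at most `S` states, `A` and `B` actions, horizon `H` and `d`-dimensional
returns, and for every tie-breaking rule, VI-Zero with `K` episodes and bonus
`β_t` with constant `cβ`, followed by planning, has the reward-free guarantee. -/
def Succeeds (cβ : ℝ) (d H S A B K : ℕ) (ε δ : ℝ) : Prop :=
  ∀ (𝒮 : Type u) (𝒜 : Type v) (ℬ : Type w) [Fintype 𝒮] [Fintype 𝒜] [Fintype ℬ]
    [Nonempty 𝒜] [Nonempty ℬ],
    Fintype.card 𝒮 ≤ S → Fintype.card 𝒜 ≤ A → Fintype.card ℬ ≤ B →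
    ∀ (s₁ : 𝒮) (sel : ℕ → Fin H → 𝒮 → (𝒜 × ℬ → ℝ) → 𝒜 × ℬ),
      (∀ k h s (f : 𝒜 × ℬ → ℝ) p, f p ≤ f (sel k h s f)) →
      ExplorePlan.IsRewardFree.{u, v, w, z}
        (algorithm (d := d) K (bonus cβ d H S A B K δ) s₁ sel) s₁ ε δ

end VIZero

/-!
The uncertainty `Ṽ` that VI-Zero maximizes dominates the estimation error of its empirical model,
for all queries at once.

Fix a query `θ`. The transition probabilities are estimated in two senses: the expectation of the
true Nash values at the next step is accurate to about `√(min {d, S} H² ι / t)`, by a union bound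
over a grid of about `(3dK)ᵈ` queries or by the `ℓ¹`-error of the empirical distribution, and each
single probability is accurate up to a relative error `1 / H` and a term of order `H ι / t`. For
the returns a concentration bound in Hilbert space serves all `θ` simultaneously. Backward
induction turns these bounds into `2 Ṽ` for the Nash values, because solving a matrix game is
monotone and commutes with the addition of constants. The same is true of the best response to a
fixed mixed action, so the values of the best responses are compared in the same way. They are not
covered by the union bound, but they agree with the Nash values in the empirical game, and the
relative error costs only a factor `1 + 1 / H` in each step, that is `e` altogether. Hence the
duality gap is at most `18 Ṽ` at the initial state.

It remains to see that `Ṽ` is small in some episode. Both players act greedily with respect to the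
uncertainty, so that `Ṽ` at a visited state is at most a bonus plus the uncertainty at the next
visited state, up to factors close to `1 + 1 / H` and a martingale. The sum of `Ṽ` over the
episodes is therefore of the order of the sum of the bonuses at the visited triples, which the
pigeonhole principle bounds, and the minimum is at most the average.
-/

section MatrixGame

section StdSimplex

variable {α : Type*} [Fintype α] (p : stdSimplex ℝ α) {f : α → ℝ} {c : ℝ}

theorem stdSimplex_sum_mul_le (hf : ∀ a, f a ≤ c) : ∑ a, p.1 a * f a ≤ c :=
  calc ∑ a, p.1 a * f a ≤ ∑ a, p.1 a * c :=
        Finset.sum_le_sum fun a _ => mul_le_mul_of_nonneg_left (hf a) (p.2.1 a)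
    _ = c := by rw [← Finset.sum_mul, p.2.2, one_mul]

theorem le_stdSimplex_sum_mul (hf : ∀ a, c ≤ f a) : c ≤ ∑ a, p.1 a * f a :=
  calc c = ∑ a, p.1 a * c := by rw [← Finset.sum_mul, p.2.2, one_mul]
    _ ≤ ∑ a, p.1 a * f a :=
        Finset.sum_le_sum fun a _ => mul_le_mul_of_nonneg_left (hf a) (p.2.1 a)

theorem abs_stdSimplex_sum_mul_le (hf : ∀ a, |f a| ≤ c) : |∑ a, p.1 a * f a| ≤ c :=
  abs_le.2 ⟨le_stdSimplex_sum_mul p fun a => (abs_le.1 (hf a)).1,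
    stdSimplex_sum_mul_le p fun a => (abs_le.1 (hf a)).2⟩

theorem stdSimplex_sum_mul_le_add {g : α → ℝ} (h : ∀ a, f a ≤ g a + c) :
    ∑ a, p.1 a * f a ≤ ∑ a, p.1 a * g a + c := by
  have hdiff : ∑ a, p.1 a * (f a - g a) ≤ c :=
    stdSimplex_sum_mul_le p fun a => by linarith [h a]
  simp only [mul_sub, Finset.sum_sub_distrib] at hdiff
  linarith

theorem abs_stdSimplex_sum_mul_le_sum_mul {g : α → ℝ} (h : ∀ a, |f a| ≤ g a) :
    |∑ a, p.1 a * f a| ≤ ∑ a, p.1 a * g a := by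
  refine (Finset.abs_sum_le_sum_abs _ _).trans (Finset.sum_le_sum fun a _ => ?_)
  rw [abs_mul, abs_of_nonneg (p.2.1 a)]
  exact mul_le_mul_of_nonneg_left (h a) (p.2.1 a)

end StdSimplex

/-- A real functional of matrices that is monotone and commutes with the addition of constants
(`le_add` combines both, as `e` may be negative) and vanishes at the zero matrix. The minimax value
of a matrix game and the payoffs of best responses have these properties, which are all that the
comparison of two games needs. -/
structure IsTopical {𝒜 ℬ : Type*} (Φ : (𝒜 → ℬ → ℝ) → ℝ) : Prop where
  le_add : ∀ (M M' : 𝒜 → ℬ → ℝ) (e : ℝ), (∀ a b, M a b ≤ M' a b + e) → Φ M ≤ Φ M' + e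
  zero : Φ 0 = 0

theorem IsTopical.abs_sub_le {𝒜 ℬ : Type*} {Φ : (𝒜 → ℬ → ℝ) → ℝ} (hΦ : IsTopical Φ)
    {M M' : 𝒜 → ℬ → ℝ} {e : ℝ} (h : ∀ a b, |M a b - M' a b| ≤ e) : |Φ M - Φ M'| ≤ e := by
  have hle := hΦ.le_add M M' e fun a b => by linarith [(abs_le.1 (h a b)).2]
  have hge := hΦ.le_add M' M e fun a b => by linarith [(abs_le.1 (h a b)).1]
  exact abs_le.2 ⟨by linarith, by linarith⟩

variable {𝒜 ℬ : Type*} [Fintype 𝒜] [Fintype ℬ]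

theorem matrixPayoff_eq_sum_left (M : 𝒜 → ℬ → ℝ) (x : stdSimplex ℝ 𝒜) (y : stdSimplex ℝ ℬ) :
    matrixPayoff M x y = ∑ a, x.1 a * ∑ b, y.1 b * M a b := by
  simp only [matrixPayoff, Finset.mul_sum, mul_assoc]

theorem matrixPayoff_eq_sum_right (M : 𝒜 → ℬ → ℝ) (x : stdSimplex ℝ 𝒜) (y : stdSimplex ℝ ℬ) :
    matrixPayoff M x y = ∑ b, y.1 b * ∑ a, x.1 a * M a b := by
  rw [matrixPayoff, Finset.sum_comm]
  simp only [Finset.mul_sum, mul_assoc, mul_left_comm]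

theorem isTopical_matrixPayoff (x : stdSimplex ℝ 𝒜) (y : stdSimplex ℝ ℬ) :
    IsTopical fun M => matrixPayoff M x y where
  le_add M M' e h := by
    simp only [matrixPayoff_eq_sum_left]
    exact stdSimplex_sum_mul_le_add x fun a => stdSimplex_sum_mul_le_add y (h a)
  zero := by simp [matrixPayoff]

theorem exists_isMatrixNash [Nonempty 𝒜] [Nonempty ℬ] (M : 𝒜 → ℬ → ℝ) :
    ∃ x y, IsMatrixNash M x y := by
  classical
  let f : (𝒜 → ℝ) → (ℬ → ℝ) → ℝ := fun x y => ∑ a, ∑ b, x a * y b * M a b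
  have linear_left : ∀ y, IsLinearMap ℝ (fun x => f x y) := fun y =>
    ⟨fun x x' => by simp only [f, Pi.add_apply, add_mul, Finset.sum_add_distrib],
     fun c x => by simp only [f, Pi.smul_apply, smul_eq_mul, Finset.mul_sum, mul_assoc]⟩
  have linear_right : ∀ x, IsLinearMap ℝ (fun y => f x y) := fun x =>
    ⟨fun y y' => by simp only [f, Pi.add_apply, add_mul, mul_add, Finset.sum_add_distrib],
     fun c y => by
      simp only [f, Pi.smul_apply, smul_eq_mul, Finset.mul_sum, mul_assoc, mul_left_comm c]⟩
  have cont_left : ∀ y, Continuous (fun x => f x y) := fun y => by fun_prop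
  have cont_right : ∀ x, Continuous (fun y => f x y) := fun x => by fun_prop
  obtain ⟨x, hx, y, hy, hsaddle⟩ := Sion.exists_isSaddlePointOn (f := f)
    ⟨_, single_mem_stdSimplex ℝ (Classical.arbitrary 𝒜)⟩
    (convex_stdSimplex ℝ 𝒜) (isCompact_stdSimplex ℝ 𝒜)
    (fun y _ => (cont_left y).lowerSemicontinuous.lowerSemicontinuousOn _)
    (fun y _ => (((linear_left y).mk' _).convexOn (convex_stdSimplex ℝ 𝒜)).quasiconvexOn)
    (convex_stdSimplex ℝ ℬ) ⟨_, single_mem_stdSimplex ℝ (Classical.arbitrary ℬ)⟩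
    (isCompact_stdSimplex ℝ ℬ)
    (fun x _ => (cont_right x).upperSemicontinuous.upperSemicontinuousOn _)
    (fun x _ => (((linear_right x).mk' _).concaveOn (convex_stdSimplex ℝ ℬ)).quasiconcaveOn)
  exact ⟨⟨x, hx⟩, ⟨y, hy⟩, fun x' => hsaddle x'.1 x'.2 y hy, fun y' => hsaddle x hx y'.1 y'.2⟩

/-- The minimax value of a matrix game, as the payoff of some Nash equilibrium; all of them have
the same payoff by `IsMatrixNash.matrixValue_eq`. -/
noncomputable def matrixValue [Nonempty 𝒜] [Nonempty ℬ] (M : 𝒜 → ℬ → ℝ) : ℝ :=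
  matrixPayoff M (exists_isMatrixNash M).choose (exists_isMatrixNash M).choose_spec.choose

theorem IsMatrixNash.payoff_le_add {M M' : 𝒜 → ℬ → ℝ} {x x' : stdSimplex ℝ 𝒜}
    {y y' : stdSimplex ℝ ℬ} (h : IsMatrixNash M x y) (h' : IsMatrixNash M' x' y') {e : ℝ}
    (he : ∀ a b, M a b ≤ M' a b + e) : matrixPayoff M x y ≤ matrixPayoff M' x' y' + e := by
  linarith [h.1 x', h'.2 y, (isTopical_matrixPayoff x' y).le_add M M' e he]

theorem IsMatrixNash.matrixValue_eq [Nonempty 𝒜] [Nonempty ℬ] {M : 𝒜 → ℬ → ℝ}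
    {x : stdSimplex ℝ 𝒜} {y : stdSimplex ℝ ℬ} (h : IsMatrixNash M x y) :
    matrixValue M = matrixPayoff M x y := by
  have hchosen := (exists_isMatrixNash M).choose_spec.choose_spec
  apply le_antisymm
  · exact (hchosen.payoff_le_add h (e := 0) (by simp)).trans_eq (add_zero _)
  · exact (h.payoff_le_add hchosen (e := 0) (by simp)).trans_eq (add_zero _)

theorem isTopical_matrixValue [Nonempty 𝒜] [Nonempty ℬ] :
    IsTopical (matrixValue (𝒜 := 𝒜) (ℬ := ℬ)) where
  le_add M M' _ he := (exists_isMatrixNash M).choose_spec.choose_spec.payoff_le_add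
    (exists_isMatrixNash M').choose_spec.choose_spec he
  zero := by simp [matrixValue, matrixPayoff]

/-- The payoff of the best response of the max-player to `x`. Pure responses suffice. -/
noncomputable def bestMax [Nonempty ℬ] (x : stdSimplex ℝ 𝒜) (M : 𝒜 → ℬ → ℝ) : ℝ :=
  Finset.univ.sup' Finset.univ_nonempty fun b => ∑ a, x.1 a * M a b

/-- The payoff of the best response of the min-player to `y`. Pure responses suffice. -/
noncomputable def bestMin [Nonempty 𝒜] (y : stdSimplex ℝ ℬ) (M : 𝒜 → ℬ → ℝ) : ℝ :=
  Finset.univ.inf' Finset.univ_nonempty fun a => ∑ b, y.1 b * M a b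

theorem matrixPayoff_le_bestMax [Nonempty ℬ] (x : stdSimplex ℝ 𝒜) (y : stdSimplex ℝ ℬ)
    (M : 𝒜 → ℬ → ℝ) : matrixPayoff M x y ≤ bestMax x M := by
  rw [matrixPayoff_eq_sum_right]
  exact stdSimplex_sum_mul_le y fun b =>
    Finset.le_sup' (fun b => ∑ a, x.1 a * M a b) (Finset.mem_univ b)

theorem bestMin_le_matrixPayoff [Nonempty 𝒜] (x : stdSimplex ℝ 𝒜) (y : stdSimplex ℝ ℬ)
    (M : 𝒜 → ℬ → ℝ) : bestMin y M ≤ matrixPayoff M x y := by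
  rw [matrixPayoff_eq_sum_left]
  exact le_stdSimplex_sum_mul x fun a =>
    Finset.inf'_le (fun a => ∑ b, y.1 b * M a b) (Finset.mem_univ a)

theorem isTopical_bestMax [Nonempty ℬ] (x : stdSimplex ℝ 𝒜) :
    IsTopical (bestMax (ℬ := ℬ) x) where
  le_add M M' e he := Finset.sup'_le _ _ fun b _ =>
    (stdSimplex_sum_mul_le_add x fun a => he a b).trans <| add_le_add_left
      (Finset.le_sup' (fun b => ∑ a, x.1 a * M' a b) (Finset.mem_univ b)) e
  zero := by simp [bestMax]

theorem isTopical_bestMin [Nonempty 𝒜] (y : stdSimplex ℝ ℬ) :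
    IsTopical (bestMin (𝒜 := 𝒜) y) where
  le_add M M' e he := by
    rw [← sub_le_iff_le_add]
    refine Finset.le_inf' _ _ fun a _ => sub_le_iff_le_add.2 ?_
    exact (Finset.inf'_le (fun a => ∑ b, y.1 b * M a b) (Finset.mem_univ a)).trans
      (stdSimplex_sum_mul_le_add y (he a))
  zero := by simp [bestMin]

theorem IsMatrixNash.bestMax_eq [Nonempty ℬ] {M : 𝒜 → ℬ → ℝ} {x : stdSimplex ℝ 𝒜}
    {y : stdSimplex ℝ ℬ} (h : IsMatrixNash M x y) : bestMax x M = matrixPayoff M x y := by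
  classical
  refine le_antisymm (Finset.sup'_le _ _ fun b _ => ?_) (matrixPayoff_le_bestMax x y M)
  have hpure := h.2 ⟨Pi.single b 1, single_mem_stdSimplex ℝ b⟩
  rw [matrixPayoff_eq_sum_right] at hpure
  simpa [Pi.single_apply] using hpure

theorem IsMatrixNash.bestMin_eq [Nonempty 𝒜] {M : 𝒜 → ℬ → ℝ} {x : stdSimplex ℝ 𝒜}
    {y : stdSimplex ℝ ℬ} (h : IsMatrixNash M x y) : bestMin y M = matrixPayoff M x y := by
  classical
  refine le_antisymm (bestMin_le_matrixPayoff x y M) (Finset.le_inf' _ _ fun a _ => ?_)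
  have hpure := h.1 ⟨Pi.single a 1, single_mem_stdSimplex ℝ a⟩
  rw [matrixPayoff_eq_sum_left _ ⟨Pi.single a 1, _⟩] at hpure
  simpa [Pi.single_apply] using hpure

end MatrixGame

namespace VMG

section DynProg

variable {d H : ℕ} {𝒮 𝒜 ℬ : Type*} [Fintype 𝒮]

theorem lookahead_le_add (G : VMG d H 𝒮 𝒜 ℬ) (θ : EuclideanSpace ℝ (Fin d)) (h : Fin H)
    {V V' : 𝒮 → ℝ} {c : ℝ} (hV : ∀ s, V s ≤ V' s + c) (s : 𝒮) (a : 𝒜) (b : ℬ) :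
    G.lookahead θ h V s a b ≤ G.lookahead θ h V' s a b + c := by
  rw [lookahead, lookahead, add_assoc]
  exact add_le_add_right (stdSimplex_sum_mul_le_add _ hV) _

theorem abs_inner_ret_le (G : VMG d H 𝒮 𝒜 ℬ) (θ : EuclideanSpace ℝ (Fin d)) (h : Fin H) (s : 𝒮)
    (a : 𝒜) (b : ℬ) : |inner ℝ θ (G.ret h s a b)| ≤ ‖θ‖ :=
  (abs_real_inner_le_norm _ _).trans
    (mul_le_of_le_one_right (norm_nonneg _) (G.norm_ret_le h s a b))

/-- Dynamic programming that evaluates the matrix of look-aheads at step `h` and state `s` by the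
functional `Φ h s`. Nash value iteration and the best-response recursions are the instances. -/
noncomputable def dynProg (G : VMG d H 𝒮 𝒜 ℬ) (θ : EuclideanSpace ℝ (Fin d))
    (Φ : Fin H → 𝒮 → (𝒜 → ℬ → ℝ) → ℝ) : Fin (H + 1) → 𝒮 → ℝ :=
  Fin.reverseInduction (motive := fun _ => 𝒮 → ℝ) (fun _ => 0)
    (fun h V s => Φ h s (G.lookahead θ h V s))

variable (G : VMG d H 𝒮 𝒜 ℬ) (θ : EuclideanSpace ℝ (Fin d)) (Φ : Fin H → 𝒮 → (𝒜 → ℬ → ℝ) → ℝ)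

@[simp]
theorem dynProg_last (s : 𝒮) : G.dynProg θ Φ (Fin.last H) s = 0 := by
  simp [dynProg]

theorem dynProg_castSucc (h : Fin H) (s : 𝒮) :
    G.dynProg θ Φ h.castSucc s = Φ h s (G.lookahead θ h (G.dynProg θ Φ h.succ) s) := by
  simp [dynProg]

variable {Φ}

theorem abs_dynProg_sub_le (θ' : EuclideanSpace ℝ (Fin d)) (hΦ : ∀ h s, IsTopical (Φ h s))
    (h : Fin (H + 1)) (s : 𝒮) :
    |G.dynProg θ Φ h s - G.dynProg θ' Φ h s| ≤ (H - h : ℝ) * ‖θ - θ'‖ := by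
  induction h using Fin.reverseInduction generalizing s with
  | last => simp
  | cast h ih =>
    rw [dynProg_castSucc, dynProg_castSucc]
    refine (hΦ h s).abs_sub_le fun a b => ?_
    have hsplit : G.lookahead θ h (G.dynProg θ Φ h.succ) s a b -
        G.lookahead θ' h (G.dynProg θ' Φ h.succ) s a b = inner ℝ (θ - θ') (G.ret h s a b) +
        ∑ s', (G.trans h s a b).1 s' * (G.dynProg θ Φ h.succ s' - G.dynProg θ' Φ h.succ s') := by
      simp only [lookahead, inner_sub_left, mul_sub, Finset.sum_sub_distrib]
      ring
    rw [hsplit]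
    refine (abs_add_le _ _).trans ((add_le_add (G.abs_inner_ret_le _ h s a b)
      (abs_stdSimplex_sum_mul_le (G.trans h s a b) ih)).trans (le_of_eq ?_))
    simp only [Fin.val_succ, Fin.val_castSucc]
    push_cast
    ring

theorem dynProg_zero (hΦ : ∀ h s, IsTopical (Φ h s)) (h : Fin (H + 1)) (s : 𝒮) :
    G.dynProg 0 Φ h s = 0 := by
  induction h using Fin.reverseInduction generalizing s with
  | last => simp
  | cast h ih =>
    have hlook : G.lookahead 0 h 0 s = 0 := by
      ext a b
      simp [lookahead]
    rw [dynProg_castSucc, show G.dynProg 0 Φ h.succ = 0 from funext ih, hlook, (hΦ h s).zero]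

theorem abs_dynProg_le (hΦ : ∀ h s, IsTopical (Φ h s)) (h : Fin (H + 1)) (s : 𝒮) :
    |G.dynProg θ Φ h s| ≤ (H - h : ℝ) * ‖θ‖ := by
  simpa [dynProg_zero G hΦ] using G.abs_dynProg_sub_le θ 0 hΦ h s

variable {θ}

theorem abs_dynProg_le_horizon (hΦ : ∀ h s, IsTopical (Φ h s)) (hθ : ‖θ‖ ≤ 1) (h : Fin (H + 1))
    (s : 𝒮) : |G.dynProg θ Φ h s| ≤ H := by
  have hh : ((h : ℕ) : ℝ) ≤ H := by exact_mod_cast h.is_le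
  calc |G.dynProg θ Φ h s| ≤ (H - h : ℝ) * ‖θ‖ := G.abs_dynProg_le θ hΦ h s
    _ ≤ H - h := mul_le_of_le_one_right (sub_nonneg.2 hh) hθ
    _ ≤ H := sub_le_self _ (Nat.cast_nonneg _)

theorem abs_lookahead_dynProg_le (hΦ : ∀ h s, IsTopical (Φ h s)) (hθ : ‖θ‖ ≤ 1) (h : Fin H)
    (s : 𝒮) (a : 𝒜) (b : ℬ) : |G.lookahead θ h (G.dynProg θ Φ h.succ) s a b| ≤ H := by
  have hnext := abs_stdSimplex_sum_mul_le (G.trans h s a b) (G.abs_dynProg_le θ hΦ h.succ)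
  have hh : ((h.succ : ℕ) : ℝ) ≤ H := by exact_mod_cast h.succ.is_le
  have h1 : (1 : ℝ) ≤ (h.succ : ℕ) := by simp
  calc |G.lookahead θ h (G.dynProg θ Φ h.succ) s a b|
      ≤ ‖θ‖ + (H - (h.succ : ℕ)) * ‖θ‖ :=
        (abs_add_le _ _).trans (add_le_add (G.abs_inner_ret_le θ h s a b) hnext)
    _ = (H - (h.succ : ℕ) + 1) * ‖θ‖ := by ring
    _ ≤ H - (h.succ : ℕ) + 1 := mul_le_of_le_one_right (by linarith) hθ
    _ ≤ H := by linarith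

end DynProg

section Value

variable {d H : ℕ} {𝒮 𝒜 ℬ : Type*} [Fintype 𝒮] [Fintype 𝒜] [Fintype ℬ]
  (G : VMG d H 𝒮 𝒜 ℬ) (θ : EuclideanSpace ℝ (Fin d))

@[simp]
theorem value_last (μ : Policy H 𝒮 𝒜) (ν : Policy H 𝒮 ℬ) (s : 𝒮) :
    G.value θ μ ν (Fin.last H) s = 0 := by
  simp [value]

theorem value_castSucc (μ : Policy H 𝒮 𝒜) (ν : Policy H 𝒮 ℬ) (h : Fin H) (s : 𝒮) :
    G.value θ μ ν h.castSucc s = matrixPayoff (G.qValue θ μ ν h s) (μ h s) (ν h s) := by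
  simp [value, qValue]

theorem value_congr {μ μ' : Policy H 𝒮 𝒜} {ν ν' : Policy H 𝒮 ℬ} (h : Fin (H + 1))
    (hμ : ∀ i : Fin H, h ≤ i.castSucc → μ i = μ' i)
    (hν : ∀ i : Fin H, h ≤ i.castSucc → ν i = ν' i) : G.value θ μ ν h = G.value θ μ' ν' h := by
  induction h using Fin.reverseInduction with
  | last => ext s; simp
  | cast h ih =>
    ext s
    have hlater : ∀ i : Fin H, h.succ ≤ i.castSucc → h.castSucc ≤ i.castSucc := fun i hi =>
      Fin.castSucc_lt_succ.le.trans hi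
    rw [value_castSucc, value_castSucc, qValue, qValue,
      ih (fun i hi => hμ i (hlater i hi)) (fun i hi => hν i (hlater i hi)), hμ h le_rfl,
      hν h le_rfl]

theorem qValue_congr {μ μ' : Policy H 𝒮 𝒜} {ν ν' : Policy H 𝒮 ℬ} (h : Fin H)
    (hμ : ∀ i, h < i → μ i = μ' i) (hν : ∀ i, h < i → ν i = ν' i) :
    G.qValue θ μ ν h = G.qValue θ μ' ν' h := by
  rw [qValue, qValue, G.value_congr θ h.succ (fun i hi => hμ i (Fin.succ_le_castSucc_iff.1 hi))
    (fun i hi => hν i (Fin.succ_le_castSucc_iff.1 hi))]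

variable {G θ} in
theorem IsNash.isNashVIOutput {μ : Policy H 𝒮 𝒜} {ν : Policy H 𝒮 ℬ} (hN : G.IsNash θ μ ν) :
    G.IsNashVIOutput θ μ ν := by
  classical
  intro h s
  constructor
  · intro x
    let μ' := Function.update μ h (Function.update (μ h) s x)
    have hq : G.qValue θ μ' ν h = G.qValue θ μ ν h := G.qValue_congr θ h
      (fun i hi => Function.update_of_ne hi.ne' _ _) (fun _ _ => rfl)
    have hdev := (hN h.castSucc s).1 μ'
    rw [value_castSucc, value_castSucc, hq] at hdev
    simpa [μ'] using hdev
  · intro y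
    let ν' := Function.update ν h (Function.update (ν h) s y)
    have hq : G.qValue θ μ ν' h = G.qValue θ μ ν h := G.qValue_congr θ h
      (fun _ _ => rfl) (fun i hi => Function.update_of_ne hi.ne' _ _)
    have hdev := (hN h.castSucc s).2 ν'
    rw [value_castSucc, value_castSucc, hq] at hdev
    simpa [ν'] using hdev

variable {G θ} in
theorem dynProg_eq_value {μ : Policy H 𝒮 𝒜} {ν : Policy H 𝒮 ℬ}
    {Φ : Fin H → 𝒮 → (𝒜 → ℬ → ℝ) → ℝ}
    (hΦ : ∀ h s, Φ h s (G.lookahead θ h (G.dynProg θ Φ h.succ) s) =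
      matrixPayoff (G.lookahead θ h (G.dynProg θ Φ h.succ) s) (μ h s) (ν h s)) :
    G.dynProg θ Φ = G.value θ μ ν := by
  ext h s
  induction h using Fin.reverseInduction generalizing s with
  | last => simp
  | cast h ih => rw [value_castSucc, dynProg_castSucc, hΦ, qValue, funext ih]

variable {G θ} in
theorem IsNashVIOutput.dynProg_eq_value {μ : Policy H 𝒮 𝒜} {ν : Policy H 𝒮 ℬ}
    (hN : G.IsNashVIOutput θ μ ν) {Φ : Fin H → 𝒮 → (𝒜 → ℬ → ℝ) → ℝ}
    (hΦ : ∀ h s M, IsMatrixNash M (μ h s) (ν h s) → Φ h s M = matrixPayoff M (μ h s) (ν h s)) :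
    G.dynProg θ Φ = G.value θ μ ν := by
  ext h s
  induction h using Fin.reverseInduction generalizing s with
  | last => simp
  | cast h ih =>
    rw [value_castSucc, dynProg_castSucc, ← hΦ h s _ (hN h s), qValue, funext ih]

/-- The common value function of all Nash equilibria, computed by Nash value iteration. -/
noncomputable def nashValue [Nonempty 𝒜] [Nonempty ℬ] : Fin (H + 1) → 𝒮 → ℝ :=
  G.dynProg θ fun _ _ => matrixValue

theorem exists_isNashVIOutput [Nonempty 𝒜] [Nonempty ℬ] : ∃ μ ν, G.IsNashVIOutput θ μ ν := by
  choose μ ν hμν using fun (h : Fin H) s =>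
    exists_isMatrixNash (G.lookahead θ h (G.nashValue θ h.succ) s)
  refine ⟨μ, ν, fun h s => ?_⟩
  have hval : G.nashValue θ = G.value θ μ ν :=
    dynProg_eq_value fun h s => (hμν h s).matrixValue_eq
  rw [qValue, ← hval]
  exact hμν h s

theorem value_le_dynProg_bestMax [Nonempty ℬ] (μ : Policy H 𝒮 𝒜) (ν : Policy H 𝒮 ℬ)
    (h : Fin (H + 1)) (s : 𝒮) :
    G.value θ μ ν h s ≤ G.dynProg θ (fun h s => bestMax (μ h s)) h s := by
  induction h using Fin.reverseInduction generalizing s with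
  | last => simp
  | cast h ih =>
    rw [value_castSucc, dynProg_castSucc]
    refine (matrixPayoff_le_bestMax _ _ _).trans ?_
    simpa [qValue] using (isTopical_bestMax (ℬ := ℬ) (μ h s)).le_add _ _ 0
      (G.lookahead_le_add θ h (by simpa using ih) s)

theorem dynProg_bestMin_le_value [Nonempty 𝒜] (μ : Policy H 𝒮 𝒜) (ν : Policy H 𝒮 ℬ)
    (h : Fin (H + 1)) (s : 𝒮) :
    G.dynProg θ (fun h s => bestMin (ν h s)) h s ≤ G.value θ μ ν h s := by
  induction h using Fin.reverseInduction generalizing s with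
  | last => simp
  | cast h ih =>
    rw [value_castSucc, dynProg_castSucc]
    refine le_trans ?_ (bestMin_le_matrixPayoff _ (ν h s) _)
    simpa [qValue] using (isTopical_bestMin (𝒜 := 𝒜) (ν h s)).le_add _ _ 0
      (G.lookahead_le_add θ h (by simpa using ih) s)

variable {θ}

theorem valueVsBestMax_le_dynProg [Nonempty ℬ] (μ : Policy H 𝒮 𝒜) (h : Fin (H + 1)) (s : 𝒮) :
    G.valueVsBestMax θ μ h s ≤ G.dynProg θ (fun h s => bestMax (ℬ := ℬ) (μ h s)) h s :=
  ciSup_le fun ν => G.value_le_dynProg_bestMax θ μ ν h s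

theorem dynProg_le_valueVsBestMin [Nonempty 𝒜] (ν : Policy H 𝒮 ℬ) (h : Fin (H + 1)) (s : 𝒮) :
    G.dynProg θ (fun h s => bestMin (𝒜 := 𝒜) (ν h s)) h s ≤ G.valueVsBestMin θ ν h s :=
  le_ciInf fun μ => G.dynProg_bestMin_le_value θ μ ν h s

end Value

section ModelError

theorem le_mul_of_min_le {u x y c q : ℝ} (hc : 0 ≤ c) (hx : u ≤ c * x) (hy : u ≤ c * y)
    (h : min x y ≤ q) : u ≤ c * q := by
  refine le_trans ?_ (mul_le_mul_of_nonneg_left h hc)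
  rw [mul_min_of_nonneg _ _ hc]
  exact le_min hx hy

theorem one_add_inv_pow_le_exp (n : ℕ) : (1 + 1 / (n : ℝ)) ^ n ≤ Real.exp 1 := by
  rcases Nat.eq_zero_or_pos n with rfl | hn
  · simp
  · calc (1 + 1 / (n : ℝ)) ^ n ≤ Real.exp (1 / n) ^ n :=
        pow_le_pow_left₀ (by positivity) (by linarith [Real.add_one_le_exp (1 / (n : ℝ))]) n
      _ = Real.exp 1 := by
        rw [← Real.exp_nat_mul]
        congr 1
        field_simp

theorem abs_sum_sub_mul_le_of_relative_error {α : Type*} [Fintype α] {p q f g : α → ℝ}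
    {c e M : ℝ} (hq : ∀ x, 0 ≤ q x) (hc : 0 ≤ c) (he : 0 ≤ e)
    (hpq : ∀ x, |p x - q x| ≤ c * q x + e) (hfg : ∀ x, |f x| ≤ g x) (hfM : ∀ x, |f x| ≤ M) :
    |∑ x, (p x - q x) * f x| ≤ c * ∑ x, q x * g x + Fintype.card α * e * M := by
  have hconst : Fintype.card α * e * M = ∑ _x : α, e * M := by simp [mul_assoc]
  rw [hconst, Finset.mul_sum, ← Finset.sum_add_distrib]
  refine (Finset.abs_sum_le_sum_abs _ _).trans (Finset.sum_le_sum fun x _ => ?_)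
  rw [abs_mul]
  calc |p x - q x| * |f x| ≤ (c * q x + e) * |f x| :=
        mul_le_mul_of_nonneg_right (hpq x) (abs_nonneg _)
    _ = c * q x * |f x| + e * |f x| := add_mul _ _ _
    _ ≤ c * q x * g x + e * M := add_le_add
        (mul_le_mul_of_nonneg_left (hfg x) (mul_nonneg hc (hq x)))
        (mul_le_mul_of_nonneg_left (hfM x) he)
    _ = c * (q x * g x) + e * M := by ring

variable {d H : ℕ} {𝒮 𝒜 ℬ : Type*} [Fintype 𝒮]

/-- `w` dominates the estimation error of the model `Ghat` of the game `G`: at each triple, either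
`w` has the trivial value `H`, or it exceeds a look-ahead under `Ghat` plus bonuses for the mean
return (`β₁`), for the expectation of the values `V` at the next state (`β₂`), and for the
expectation of arbitrary functions with values in `[-2H, 2H]`, through a bound on the single
transition probabilities with the relative part `1 / H` and the absolute part `e`. -/
def IsErrorBound (G Ghat : VMG d H 𝒮 𝒜 ℬ) (V w : Fin (H + 1) → 𝒮 → ℝ) : Prop :=
  ∀ h s a b, (H : ℝ) ≤ w h.castSucc s ∨ ∃ β₁ β₂ e : ℝ, 0 ≤ e ∧
    ‖G.ret h s a b - Ghat.ret h s a b‖ ≤ β₁ ∧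
    |∑ x, ((G.trans h s a b).1 x - (Ghat.trans h s a b).1 x) * V h.succ x| ≤ β₂ ∧
    (∀ x, |(G.trans h s a b).1 x - (Ghat.trans h s a b).1 x| ≤
      1 / H * (Ghat.trans h s a b).1 x + e) ∧
    min (∑ x, (Ghat.trans h s a b).1 x * w h.succ x + (β₁ + β₂ + Fintype.card 𝒮 * e * (2 * H)))
      (H : ℝ) ≤ w h.castSucc s

variable {G Ghat : VMG d H 𝒮 𝒜 ℬ} {θ : EuclideanSpace ℝ (Fin d)} {V w : Fin (H + 1) → 𝒮 → ℝ}
  {Φ : Fin H → 𝒮 → (𝒜 → ℬ → ℝ) → ℝ}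

theorem abs_lookahead_sub_lookahead_le (hθ : ‖θ‖ ≤ 1) (h : Fin H) (U V V' : 𝒮 → ℝ) (s : 𝒮)
    (a : 𝒜) (b : ℬ) :
    |G.lookahead θ h V s a b - Ghat.lookahead θ h V' s a b| ≤
      ‖G.ret h s a b - Ghat.ret h s a b‖ +
      |∑ x, ((G.trans h s a b).1 x - (Ghat.trans h s a b).1 x) * U x| +
      |∑ x, ((G.trans h s a b).1 x - (Ghat.trans h s a b).1 x) * (V x - U x)| +
      |∑ x, (Ghat.trans h s a b).1 x * (V x - V' x)| := by
  have hsplit : G.lookahead θ h V s a b - Ghat.lookahead θ h V' s a b =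
      inner ℝ θ (G.ret h s a b - Ghat.ret h s a b) +
      ∑ x, ((G.trans h s a b).1 x - (Ghat.trans h s a b).1 x) * U x +
      ∑ x, ((G.trans h s a b).1 x - (Ghat.trans h s a b).1 x) * (V x - U x) +
      ∑ x, (Ghat.trans h s a b).1 x * (V x - V' x) := by
    simp only [lookahead, inner_sub_right, mul_sub, sub_mul, Finset.sum_sub_distrib]
    ring
  rw [hsplit]
  refine (abs_add_le _ _).trans (add_le_add_left ((abs_add_three _ _ _).trans ?_) _)
  gcongr
  exact (abs_real_inner_le_norm _ _).trans (mul_le_of_le_one_left (norm_nonneg _) hθ)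

theorem abs_lookahead_dynProg_sub_le (hΦ : ∀ h s, IsTopical (Φ h s)) (hθ : ‖θ‖ ≤ 1) (h : Fin H)
    (s : 𝒮) (a : 𝒜) (b : ℬ) :
    |G.lookahead θ h (G.dynProg θ Φ h.succ) s a b -
      Ghat.lookahead θ h (Ghat.dynProg θ Φ h.succ) s a b| ≤ 2 * H :=
  (abs_sub _ _).trans (by linarith [G.abs_lookahead_dynProg_le hΦ hθ h s a b,
    Ghat.abs_lookahead_dynProg_le hΦ hθ h s a b])

theorem IsErrorBound.abs_dynProg_sub_dynProg_le (hΦ : ∀ h s, IsTopical (Φ h s)) (hθ : ‖θ‖ ≤ 1)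
    (hw : IsErrorBound G Ghat (G.dynProg θ Φ) w) (hw0 : ∀ h s, 0 ≤ w h s)
    (h : Fin (H + 1)) (s : 𝒮) :
    |G.dynProg θ Φ h s - Ghat.dynProg θ Φ h s| ≤ 2 * w h s := by
  induction h using Fin.reverseInduction generalizing s with
  | last => simpa using hw0 _ s
  | cast h ih =>
    rw [dynProg_castSucc, dynProg_castSucc]
    refine (hΦ h s).abs_sub_le fun a b => ?_
    have trivial_bound := abs_lookahead_dynProg_sub_le (G := G) (Ghat := Ghat) hΦ hθ h s a b
    rcases hw h s a b with hH | ⟨β₁, β₂, e, he, hret, hvalue, -, hmin⟩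
    · exact trivial_bound.trans (mul_le_mul_of_nonneg_left hH zero_le_two)
    · refine le_mul_of_min_le zero_le_two ?_ trivial_bound hmin
      have hlook := abs_lookahead_sub_lookahead_le (G := G) (Ghat := Ghat) hθ h
        (G.dynProg θ Φ h.succ) (G.dynProg θ Φ h.succ) (Ghat.dynProg θ Φ h.succ) s a b
      have hnext := abs_stdSimplex_sum_mul_le_sum_mul (Ghat.trans h s a b) ih
      simp only [mul_left_comm _ (2 : ℝ), ← Finset.mul_sum] at hnext
      simp only [sub_self, mul_zero, Finset.sum_const_zero, abs_zero, add_zero] at hlook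
      have hret0 := (norm_nonneg _).trans hret
      have hvalue0 := (abs_nonneg _).trans hvalue
      have he0 : 0 ≤ Fintype.card 𝒮 * e * (2 * H) := by positivity
      linarith

/-- For other functionals than the one which `V` belongs to, the error of the transition
probabilities acts on a difference of values that has to be absorbed by `w` itself. The relative
error `1 / H` makes this cost a factor `1 + 1 / H` in each step. -/
theorem IsErrorBound.abs_lookahead_sub_le_of_reference (hΦ : ∀ h s, IsTopical (Φ h s))
    (hθ : ‖θ‖ ≤ 1) (hw : IsErrorBound G Ghat V w) (hV : ∀ h s, |V h s| ≤ H)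
    (hVw : ∀ h s, |V h s - Ghat.dynProg θ Φ h s| ≤ 2 * w h s) {q : ℝ} (hq : 1 ≤ q) {h : Fin H}
    (hnext : ∀ x, |G.dynProg θ Φ h.succ x - Ghat.dynProg θ Φ h.succ x| ≤
      (4 * q - 2) * w h.succ x) (s : 𝒮) (a : 𝒜) (b : ℬ) :
    |G.lookahead θ h (G.dynProg θ Φ h.succ) s a b -
      Ghat.lookahead θ h (Ghat.dynProg θ Φ h.succ) s a b| ≤
      (4 * ((1 + 1 / (H : ℝ)) * q) - 2) * w h.castSucc s := by
  set c : ℝ := 4 * ((1 + 1 / (H : ℝ)) * q) - 2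
  have hc_eq : c = (4 * q - 2) + 1 / H * (4 * q) := by ring
  have hc : 2 ≤ c := by
    have : 0 ≤ 1 / (H : ℝ) * (4 * q) := by positivity
    linarith
  have trivial_bound := (abs_lookahead_dynProg_sub_le (G := G) (Ghat := Ghat) hΦ hθ h s a b).trans
    (mul_le_mul_of_nonneg_right hc H.cast_nonneg)
  rcases hw h s a b with hH | ⟨β₁, β₂, e, he, hret, hvalue, htrans, hmin⟩
  · exact trivial_bound.trans (mul_le_mul_of_nonneg_left hH (by linarith))
  refine le_mul_of_min_le (by linarith) ?_ trivial_bound hmin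
  have hlook := abs_lookahead_sub_lookahead_le (G := G) (Ghat := Ghat) hθ h
    (V h.succ) (G.dynProg θ Φ h.succ) (Ghat.dynProg θ Φ h.succ) s a b
  have hmodel := abs_stdSimplex_sum_mul_le_sum_mul (Ghat.trans h s a b) hnext
  have hdiff : ∀ x, |G.dynProg θ Φ h.succ x - V h.succ x| ≤ 4 * q * w h.succ x := fun x => by
    have htri := abs_sub_le (G.dynProg θ Φ h.succ x) (Ghat.dynProg θ Φ h.succ x) (V h.succ x)
    linarith [hnext x, hVw h.succ x, abs_sub_comm (V h.succ x) (Ghat.dynProg θ Φ h.succ x)]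
  have hdiffH : ∀ x, |G.dynProg θ Φ h.succ x - V h.succ x| ≤ 2 * H := fun x =>
    (abs_sub _ _).trans (by linarith [G.abs_dynProg_le_horizon hΦ hθ h.succ x, hV h.succ x])
  have hcross := abs_sum_sub_mul_le_of_relative_error (Ghat.trans h s a b).2.1 (by positivity)
    he htrans hdiff hdiffH
  simp only [mul_left_comm _ (4 * q), mul_left_comm _ (4 * q - 2), ← Finset.mul_sum]
    at hmodel hcross
  have hbonus0 : 0 ≤ β₁ + β₂ + Fintype.card 𝒮 * e * (2 * H) := by
    have := (norm_nonneg _).trans hret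
    have := (abs_nonneg _).trans hvalue
    positivity
  have hbonus := le_mul_of_one_le_left hbonus0 (by linarith : (1 : ℝ) ≤ c)
  rw [mul_add, hc_eq, add_mul, ← hc_eq, mul_assoc (1 / (H : ℝ)), mul_left_comm]
  linarith

theorem IsErrorBound.abs_dynProg_sub_dynProg_le_of_reference (hΦ : ∀ h s, IsTopical (Φ h s))
    (hθ : ‖θ‖ ≤ 1) (hw : IsErrorBound G Ghat V w) (hw0 : ∀ h s, 0 ≤ w h s)
    (hV : ∀ h s, |V h s| ≤ H) (hVw : ∀ h s, |V h s - Ghat.dynProg θ Φ h s| ≤ 2 * w h s)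
    (h : Fin (H + 1)) (s : 𝒮) :
    |G.dynProg θ Φ h s - Ghat.dynProg θ Φ h s| ≤
      (4 * (1 + 1 / (H : ℝ)) ^ (H - (h : ℕ)) - 2) * w h s := by
  induction h using Fin.reverseInduction generalizing s with
  | last => simpa using mul_nonneg (by norm_num) (hw0 _ s)
  | cast h ih =>
    have hpow : (1 + 1 / (H : ℝ)) ^ (H - (h.castSucc : ℕ)) =
        (1 + 1 / (H : ℝ)) * (1 + 1 / (H : ℝ)) ^ (H - (h.succ : ℕ)) := by
      rw [← pow_succ', Fin.val_succ, Fin.val_castSucc]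
      congr 1
      omega
    rw [dynProg_castSucc, dynProg_castSucc, hpow]
    exact (hΦ h s).abs_sub_le
      (hw.abs_lookahead_sub_le_of_reference hΦ hθ hV hVw (one_le_pow₀ (by simp)) ih s)

theorem dualityGap_le_of_isNashVIOutput [Fintype 𝒜] [Fintype ℬ] [Nonempty 𝒜] [Nonempty ℬ]
    {s₁ : 𝒮} {μ : Policy H 𝒮 𝒜} {ν : Policy H 𝒮 ℬ} (hN : Ghat.IsNashVIOutput θ μ ν)
    (hθ : ‖θ‖ ≤ 1) (hw : IsErrorBound G Ghat (G.nashValue θ) w) (hw0 : ∀ h s, 0 ≤ w h s) :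
    G.dualityGap s₁ θ μ ν ≤ 18 * w 0 s₁ := by
  have hnash : ∀ h s, |G.nashValue θ h s - Ghat.value θ μ ν h s| ≤ 2 * w h s := fun h s => by
    rw [← hN.dynProg_eq_value fun _ _ _ hM => hM.matrixValue_eq]
    exact IsErrorBound.abs_dynProg_sub_dynProg_le (fun _ _ => isTopical_matrixValue) hθ hw hw0 h s
  have hresponse : ∀ Φ : Fin H → 𝒮 → (𝒜 → ℬ → ℝ) → ℝ, (∀ h s, IsTopical (Φ h s)) →
      (∀ h s M, IsMatrixNash M (μ h s) (ν h s) → Φ h s M = matrixPayoff M (μ h s) (ν h s)) →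
      |G.dynProg θ Φ 0 s₁ - Ghat.value θ μ ν 0 s₁| ≤ 9 * w 0 s₁ := fun Φ hΦ hΦN => by
    rw [← hN.dynProg_eq_value hΦN] at hnash ⊢
    have hpow : (1 + 1 / (H : ℝ)) ^ H ≤ 2.7182818286 :=
      (one_add_inv_pow_le_exp H).trans Real.exp_one_lt_d9.le
    exact (hw.abs_dynProg_sub_dynProg_le_of_reference hΦ hθ hw0 (G.abs_dynProg_le_horizon
      (fun _ _ => isTopical_matrixValue) hθ) hnash 0 s₁).trans
      (mul_le_mul_of_nonneg_right
        (by simp only [Fin.coe_ofNat_eq_mod, Nat.zero_mod, Nat.sub_zero]; linarith) (hw0 _ _))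
  have hmax := hresponse (fun h s => bestMax (μ h s)) (fun _ _ => isTopical_bestMax _)
    fun _ _ _ hM => hM.bestMax_eq
  have hmin := hresponse (fun h s => bestMin (ν h s)) (fun _ _ => isTopical_bestMin _)
    fun _ _ _ hM => hM.bestMin_eq
  rw [dualityGap]
  linarith [(abs_le.1 hmax).2, (abs_le.1 hmin).1, G.valueVsBestMax_le_dynProg (θ := θ) μ 0 s₁,
    G.dynProg_le_valueVsBestMin (θ := θ) ν 0 s₁]

end ModelError

end VMG

section Concentration

variable {Ω : Type*} {mΩ : MeasurableSpace Ω} {P : Measure Ω} [IsFiniteMeasure P]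

theorem integral_mul_condExp {m : MeasurableSpace Ω} (hm : m ≤ mΩ) {f g : Ω → ℝ}
    (hf : StronglyMeasurable[m] f) (hfg : Integrable (fun ω => f ω * g ω) P)
    (hg : Integrable g P) : ∫ ω, f ω * (P[g | m]) ω ∂P = ∫ ω, f ω * g ω ∂P :=
  (integral_congr_ae (condExp_mul_of_stronglyMeasurable_left hf hfg hg)).symm.trans
    (integral_condExp hm)

theorem integral_inner_eq_zero_of_condExp {E : Type*} [NormedAddCommGroup E]
    [InnerProductSpace ℝ E] [CompleteSpace E] {m : MeasurableSpace Ω} (hm : m ≤ mΩ) {f g : Ω → E}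
    (hf : StronglyMeasurable[m] f) (hfg : Integrable (fun ω => inner ℝ (f ω) (g ω)) P)
    (hg : Integrable g P) (hg0 : P[g | m] =ᵐ[P] 0) : ∫ ω, inner ℝ (f ω) (g ω) ∂P = 0 := by
  rw [← integral_condExp hm]
  refine integral_eq_zero_of_ae
    ((condExp_bilin_of_stronglyMeasurable_left (innerSL ℝ) hf hfg hg).trans ?_)
  filter_upwards [hg0] with ω hω
  rw [hω, Pi.zero_apply, map_zero, Pi.zero_apply]

theorem exp_mul_le_one_add {l x : ℝ} (hl : |l| ≤ 1) (hx : x ∈ Set.Icc 0 1) :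
    Real.exp (l * x) ≤ 1 + (l + l ^ 2) * x := by
  have hlx : |l * x| ≤ 1 := by
    rw [abs_mul, abs_of_nonneg hx.1]
    exact mul_le_one₀ hl hx.1 hx.2
  have hexp := (abs_le.1 (Real.abs_exp_sub_one_sub_id_le hlx)).2
  nlinarith [mul_nonneg (mul_nonneg (sq_nonneg l) hx.1) (sub_nonneg.2 hx.2)]

theorem integrable_exp_of_le {f : Ω → ℝ} (hf : StronglyMeasurable f) {b : ℝ}
    (hfb : ∀ ω, f ω ≤ b) : Integrable (fun ω => Real.exp (f ω)) P :=
  .of_bound (Real.continuous_exp.comp_stronglyMeasurable hf).aestronglyMeasurable (Real.exp b)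
    (ae_of_all _ fun ω => by
      rw [Real.norm_eq_abs, Real.abs_exp]
      exact Real.exp_le_exp.2 (hfb ω))

theorem exp_add_sub_le {l x : ℝ} (hl : |l| ≤ 1) (hx : x ∈ Set.Icc 0 1) (s y : ℝ) :
    Real.exp (s + (l * x - (l + l ^ 2) * y)) ≤
      Real.exp (s - (l + l ^ 2) * y) +
        (l + l ^ 2) * (Real.exp (s - (l + l ^ 2) * y) * x) := by
  calc Real.exp (s + (l * x - (l + l ^ 2) * y))
      = Real.exp (s - (l + l ^ 2) * y) * Real.exp (l * x) := by rw [← Real.exp_add]; ring_nf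
    _ ≤ Real.exp (s - (l + l ^ 2) * y) * (1 + (l + l ^ 2) * x) := by
        gcongr
        exact exp_mul_le_one_add hl hx
    _ = _ := by ring

theorem exp_sub_add_mul_le (s c y : ℝ) :
    Real.exp (s - c * y) + c * (Real.exp (s - c * y) * y) ≤ Real.exp s := by
  calc Real.exp (s - c * y) + c * (Real.exp (s - c * y) * y)
      = Real.exp (s - c * y) * (c * y + 1) := by ring
    _ ≤ Real.exp (s - c * y) * Real.exp (c * y) := by
        gcongr
        exact Real.add_one_le_exp _
    _ = Real.exp s := by rw [← Real.exp_add, sub_add_cancel]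

theorem integral_exp_add_le_integral_exp {m : MeasurableSpace Ω} (hm : m ≤ mΩ) {S X Y : Ω → ℝ}
    (hS : StronglyMeasurable[m] S) {b : ℝ} (hSb : ∀ ω, S ω ≤ b) (hX : StronglyMeasurable[mΩ] X)
    (hY : StronglyMeasurable[m] Y) (hX01 : ∀ ω, X ω ∈ Set.Icc 0 1) (hY01 : ∀ ω, Y ω ∈ Set.Icc 0 1)
    (hXY : P[X | m] =ᵐ[P] Y) {l : ℝ} (hl : |l| ≤ 1) :
    ∫ ω, Real.exp (S ω + (l * X ω - (l + l ^ 2) * Y ω)) ∂P ≤ ∫ ω, Real.exp (S ω) ∂P := by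
  set Z : Ω → ℝ := fun ω => Real.exp (S ω - (l + l ^ 2) * Y ω)
  have hexponent : StronglyMeasurable[m] fun ω => S ω - (l + l ^ 2) * Y ω :=
    hS.sub (hY.const_mul _)
  have hZm : StronglyMeasurable[m] Z := Real.continuous_exp.comp_stronglyMeasurable hexponent
  have hZ : Integrable Z P := integrable_exp_of_le (hexponent.mono hm) (b := b + 1) fun ω => by
    obtain ⟨hY0, hY1⟩ := hY01 ω
    nlinarith [hSb ω, mul_nonneg (sq_nonneg (l + 1 / 2)) hY0]
  have hZmul : ∀ {U : Ω → ℝ}, StronglyMeasurable[mΩ] U → (∀ ω, U ω ∈ Set.Icc 0 1) →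
      Integrable (fun ω => Z ω * U ω) P := fun hU hU01 =>
    hZ.mul_bdd hU.aestronglyMeasurable (c := 1) (ae_of_all _ fun ω => by
      rw [Real.norm_eq_abs, abs_of_nonneg (hU01 ω).1]
      exact (hU01 ω).2)
  have hZX := hZmul hX hX01
  have hZY := hZmul (hY.mono hm) hY01
  have hmean : ∫ ω, Z ω * X ω ∂P = ∫ ω, Z ω * Y ω ∂P := by
    rw [← integral_mul_condExp hm hZm hZX
      (.of_mem_Icc 0 1 hX.measurable.aemeasurable (ae_of_all _ hX01))]
    exact integral_congr_ae (hXY.mono fun ω hω => congrArg (Z ω * ·) hω)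
  calc ∫ ω, Real.exp (S ω + (l * X ω - (l + l ^ 2) * Y ω)) ∂P
      ≤ ∫ ω, (Z ω + (l + l ^ 2) * (Z ω * X ω)) ∂P :=
        integral_mono_of_nonneg (ae_of_all _ fun ω => (Real.exp_pos _).le)
          (hZ.add (hZX.const_mul _)) (ae_of_all _ fun ω => exp_add_sub_le hl (hX01 ω) _ _)
    _ = ∫ ω, (Z ω + (l + l ^ 2) * (Z ω * Y ω)) ∂P := by
        rw [integral_add hZ (hZX.const_mul _), integral_add hZ (hZY.const_mul _),
          integral_const_mul, integral_const_mul, hmean]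
    _ ≤ ∫ ω, Real.exp (S ω) ∂P :=
        integral_mono (hZ.add (hZY.const_mul _)) (integrable_exp_of_le (hS.mono hm) hSb)
          fun ω => exp_sub_add_mul_le _ _ _

theorem mul_sub_mul_le_of_mem_Icc {l x y : ℝ} (hx : x ∈ Set.Icc 0 1) (hy : y ∈ Set.Icc 0 1) :
    l * x - (l + l ^ 2) * y ≤ |l| + |l + l ^ 2| := by
  have hlx : l * x ≤ |l| :=
    (mul_le_mul_of_nonneg_right (le_abs_self l) hx.1).trans
      (mul_le_of_le_one_right (abs_nonneg l) hx.2)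
  have hly : -(l + l ^ 2) * y ≤ |l + l ^ 2| :=
    (mul_le_mul_of_nonneg_right (neg_le_abs _) hy.1).trans
      (mul_le_of_le_one_right (abs_nonneg _) hy.2)
  linarith

theorem sum_mul_sub_mul_le_of_mem_Icc {K : ℕ} {l : ℝ} {x y : Fin K → ℝ}
    (hx : ∀ i, x i ∈ Set.Icc 0 1) (hy : ∀ i, y i ∈ Set.Icc 0 1) :
    ∑ i, (l * x i - (l + l ^ 2) * y i) ≤ K * (|l| + |l + l ^ 2|) :=
  (Finset.sum_le_card_nsmul _ _ _ fun i _ =>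
    mul_sub_mul_le_of_mem_Icc (hx i) (hy i)).trans_eq (by
      rw [Finset.card_univ, Fintype.card_fin, nsmul_eq_mul])

theorem integral_exp_sum_le_one [IsProbabilityMeasure P] {K : ℕ} {m : Fin K → MeasurableSpace Ω}
    (hmono : Monotone m) (hm : ∀ i, m i ≤ mΩ) {X Y : Fin K → Ω → ℝ}
    (hXm : ∀ i j, i < j → StronglyMeasurable[m j] (X i)) (hX : ∀ i, StronglyMeasurable (X i))
    (hY : ∀ i, StronglyMeasurable[m i] (Y i)) (hX01 : ∀ i ω, X i ω ∈ Set.Icc 0 1)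
    (hY01 : ∀ i ω, Y i ω ∈ Set.Icc 0 1) (hXY : ∀ i, P[X i | m i] =ᵐ[P] Y i) {l : ℝ}
    (hl : |l| ≤ 1) : ∫ ω, Real.exp (∑ i, (l * X i ω - (l + l ^ 2) * Y i ω)) ∂P ≤ 1 := by
  induction K with
  | zero => simp
  | succ K ih =>
    simp only [Fin.sum_univ_castSucc]
    refine (integral_exp_add_le_integral_exp (hm (Fin.last K))
      (Finset.stronglyMeasurable_fun_sum _ fun i _ => ?_)
      (fun ω => sum_mul_sub_mul_le_of_mem_Icc (fun i => hX01 i.castSucc ω)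
        fun i => hY01 i.castSucc ω)
      (hX (Fin.last K)) (hY _) (hX01 _) (hY01 _) (hXY _) hl).trans
      (ih (m := fun i => m i.castSucc) (hmono.comp Fin.strictMono_castSucc.monotone)
        (fun i => hm _) (fun i j hij => hXm _ _ (Fin.castSucc_lt_castSucc_iff.2 hij))
        (fun i => hX _) (fun i => hY _) (fun i => hX01 _) (fun i => hY01 _) fun i => hXY _)
    exact ((hXm _ _ (Fin.castSucc_lt_last i)).const_mul l).sub
      (((hY _).mono (hmono (Fin.castSucc_lt_last i).le)).const_mul _)

theorem measure_lt_le_exp_neg {f : Ω → ℝ} {c : ℝ}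
    (hint : Integrable (fun ω => Real.exp (f ω)) P) (hc : ∫ ω, Real.exp (f ω) ∂P ≤ c) (L : ℝ) :
    P {ω | L < f ω} ≤ ENNReal.ofReal (c * Real.exp (-L)) := by
  rw [← ENNReal.ofReal_toReal (measure_ne_top P {ω | L < f ω})]
  refine ENNReal.ofReal_le_ofReal ?_
  calc P.real {ω | L < f ω} ≤ P.real {ω | L ≤ f ω} := measureReal_mono fun _ => le_of_lt (α := ℝ)
    _ ≤ Real.exp (-1 * L) * ProbabilityTheory.mgf f P 1 :=
        ProbabilityTheory.measure_ge_le_exp_mul_mgf L zero_le_one (by simpa only [one_mul])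
    _ ≤ c * Real.exp (-L) := by
        rw [ProbabilityTheory.mgf, mul_comm, neg_one_mul]
        simp only [one_mul]
        gcongr

theorem abs_sub_le_of_mul_sub_le {η s c L : ℝ} (hη : 0 < η) (hpos : η * s - (η + η ^ 2) * c ≤ L)
    (hneg : -η * s - (-η + (-η) ^ 2) * c ≤ L) : |s - c| ≤ η * c + L / η := by
  have hη' : η * (η * c + L / η) = η ^ 2 * c + L := by field_simp
  refine abs_le.2 ⟨le_of_mul_le_mul_left ?_ hη, le_of_mul_le_mul_left ?_ hη⟩ <;> linarith

/-- Unlike for Hoeffding's inequality, the deviation is relative to the compensator `∑ Y`; this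
is what later lets the error terms of order `1 / H` be absorbed. -/
theorem measure_abs_sum_sub_sum_gt_le [IsProbabilityMeasure P] {K : ℕ}
    {m : Fin K → MeasurableSpace Ω} (hmono : Monotone m) (hm : ∀ i, m i ≤ mΩ) {X Y : Fin K → Ω → ℝ}
    (hXm : ∀ i j, i < j → StronglyMeasurable[m j] (X i)) (hX : ∀ i, StronglyMeasurable (X i))
    (hY : ∀ i, StronglyMeasurable[m i] (Y i)) (hX01 : ∀ i ω, X i ω ∈ Set.Icc 0 1)
    (hY01 : ∀ i ω, Y i ω ∈ Set.Icc 0 1) (hXY : ∀ i, P[X i | m i] =ᵐ[P] Y i) {η : ℝ} (hη0 : 0 < η)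
    (hη1 : η ≤ 1) (L : ℝ) :
    P {ω | ¬ |∑ i, X i ω - ∑ i, Y i ω| ≤ η * ∑ i, Y i ω + L / η} ≤
      ENNReal.ofReal (2 * Real.exp (-L)) := by
  set f : ℝ → Ω → ℝ := fun l ω => ∑ i, (l * X i ω - (l + l ^ 2) * Y i ω) with hf
  have htail : ∀ l, |l| ≤ 1 → P {ω | L < f l ω} ≤ ENNReal.ofReal (1 * Real.exp (-L)) :=
    fun l hl => measure_lt_le_exp_neg
      (integrable_exp_of_le (Finset.stronglyMeasurable_fun_sum _ fun i _ =>
        ((hX i).const_mul l).sub (((hY i).mono (hm i)).const_mul _))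
        fun ω => sum_mul_sub_mul_le_of_mem_Icc (fun i => hX01 i ω) fun i => hY01 i ω)
      (integral_exp_sum_le_one hmono hm hXm hX hY hX01 hY01 hXY hl) L
  have habs : |η| ≤ 1 := by rwa [abs_of_pos hη0]
  have hsub : {ω | ¬ |∑ i, X i ω - ∑ i, Y i ω| ≤ η * ∑ i, Y i ω + L / η} ⊆
      {ω | L < f η ω} ∪ {ω | L < f (-η) ω} := by
    intro ω hω
    by_contra hcon
    simp only [Set.mem_union, Set.mem_ofPred_eq, not_or, not_lt, hf, Finset.sum_sub_distrib,
      ← Finset.mul_sum] at hcon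
    exact hω (abs_sub_le_of_mul_sub_le hη0 hcon.1 hcon.2)
  calc _ ≤ P ({ω | L < f η ω} ∪ {ω | L < f (-η) ω}) := measure_mono hsub
    _ ≤ ENNReal.ofReal (1 * Real.exp (-L)) + ENNReal.ofReal (1 * Real.exp (-L)) :=
      (measure_union_le _ _).trans (add_le_add (htail η habs) (htail (-η) (by rwa [abs_neg])))
    _ = ENNReal.ofReal (2 * Real.exp (-L)) := by
      rw [← ENNReal.ofReal_add (by positivity) (by positivity), ← add_mul, one_add_one_eq_two]

end Concentration

section HilbertConcentration

theorem convexOn_cosh_sqrt : ConvexOn ℝ (Set.Ici 0) fun t : ℝ => Real.cosh √t := by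
  have hseries : ∀ t : ℝ, 0 ≤ t →
      HasSum (fun n : ℕ => t ^ n / (2 * n).factorial) (Real.cosh √t) := by
    intro t ht
    convert Real.hasSum_cosh √t using 3 with n
    rw [pow_mul, Real.sq_sqrt ht]
  refine ⟨convex_Ici 0, fun x hx y hy a b ha hb hab => ?_⟩
  refine hasSum_le (fun n => ?_) (hseries _ (convex_Ici 0 hx hy ha hb hab))
    (((hseries x hx).mul_left a).add ((hseries y hy).mul_left b))
  rw [← mul_div_assoc, ← mul_div_assoc, ← add_div]
  exact div_le_div_of_nonneg_right ((convexOn_pow n).2 hx hy ha hb hab) (Nat.cast_nonneg _)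

section

variable {E : Type*} [NormedAddCommGroup E] [InnerProductSpace ℝ E]

/-- At `x ≠ 0` with `‖y‖ = a`, the number `‖x + y‖ ^ 2` is the convex combination of
`(‖x‖ + a) ^ 2` and `(‖x‖ - a) ^ 2` given by the cosine of the angle between `x` and `y`, so the
convexity of `cosh ∘ √` applies. -/
theorem cosh_norm_add_le (x : E) {y : E} {a : ℝ} (hy : ‖y‖ ≤ a) :
    Real.cosh ‖x + y‖ ≤ Real.cosh a * Real.cosh ‖x‖ +
      inner ℝ ((Real.sinh a / a * (Real.sinh ‖x‖ / ‖x‖)) • x) y := by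
  have ha : 0 ≤ a := (norm_nonneg y).trans hy
  rcases eq_or_ne x 0 with rfl | hx
  · simpa using Real.cosh_le_cosh.2 (abs_le_abs_of_nonneg (norm_nonneg y) hy)
  rcases ha.eq_or_lt with rfl | ha
  · simp [norm_le_zero_iff.1 hy]
  have hx0 : 0 < ‖x‖ := norm_pos_iff.2 hx
  set s : ℝ := inner ℝ x y / (a * ‖x‖) with hs
  have hinner : inner ℝ x y = s * (a * ‖x‖) := by rw [hs]; field_simp
  obtain ⟨hs1, hs2⟩ : -1 ≤ s ∧ s ≤ 1 := abs_le.1 <| by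
    rw [hs, abs_div, abs_of_pos (mul_pos ha hx0), div_le_one (mul_pos ha hx0), mul_comm]
    exact (abs_real_inner_le_norm x y).trans (mul_le_mul_of_nonneg_left hy hx0.le)
  have hnorm : ‖x + y‖ ≤ √((1 + s) / 2 * (‖x‖ + a) ^ 2 + (1 - s) / 2 * (‖x‖ - a) ^ 2) := by
    apply Real.le_sqrt_of_sq_le
    rw [norm_add_sq_real, hinner]
    nlinarith [norm_nonneg y]
  have hconvex := convexOn_cosh_sqrt.2 (Set.mem_Ici.2 (sq_nonneg (‖x‖ + a)))
    (Set.mem_Ici.2 (sq_nonneg (‖x‖ - a))) (show 0 ≤ (1 + s) / 2 by linarith)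
    (show 0 ≤ (1 - s) / 2 by linarith) (by ring)
  simp only [smul_eq_mul, Real.sqrt_sq_eq_abs, Real.cosh_abs] at hconvex
  calc Real.cosh ‖x + y‖ ≤ _ := Real.cosh_le_cosh.2 (abs_le_abs_of_nonneg (norm_nonneg _) hnorm)
    _ ≤ _ := hconvex
    _ = Real.cosh a * Real.cosh ‖x‖ + s * (Real.sinh a * Real.sinh ‖x‖) := by
        rw [Real.cosh_add, Real.cosh_sub]; ring
    _ = _ := by
        rw [real_inner_smul_left, hinner]
        field_simp

theorem abs_inner_sinh_smul_le (x : E) {y : E} {a : ℝ} (hy : ‖y‖ ≤ a) :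
    |inner ℝ ((Real.sinh a / a * (Real.sinh ‖x‖ / ‖x‖)) • x) y| ≤
      Real.sinh a * Real.sinh ‖x‖ := by
  have ha : 0 ≤ a := (norm_nonneg y).trans hy
  have hsinh : ∀ r : ℝ, 0 ≤ r → 0 ≤ Real.sinh r / r ∧ Real.sinh r / r * r = Real.sinh r :=
    fun r hr => ⟨div_nonneg (Real.sinh_nonneg_iff.2 hr) hr,
      div_mul_cancel_of_imp fun h => by rw [h, Real.sinh_zero]⟩
  obtain ⟨ha0, hadiv⟩ := hsinh a ha
  obtain ⟨hx0, hxdiv⟩ := hsinh ‖x‖ (norm_nonneg x)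
  rw [real_inner_smul_left, abs_mul, abs_of_nonneg (mul_nonneg ha0 hx0)]
  calc Real.sinh a / a * (Real.sinh ‖x‖ / ‖x‖) * |inner ℝ x y|
      ≤ Real.sinh a / a * (Real.sinh ‖x‖ / ‖x‖) * (‖x‖ * a) := by
        gcongr
        exact (abs_real_inner_le_norm x y).trans (mul_le_mul_of_nonneg_left hy (norm_nonneg x))
    _ = (Real.sinh a / a * a) * (Real.sinh ‖x‖ / ‖x‖ * ‖x‖) := by ring
    _ = Real.sinh a * Real.sinh ‖x‖ := by rw [hadiv, hxdiv]

theorem cosh_norm_add_mul_exp_le (x : E) {y : E} {a : ℝ} (hy : ‖y‖ ≤ a) (v : ℝ) :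
    Real.cosh ‖x + y‖ * Real.exp (-(v + a ^ 2 / 2)) ≤ Real.cosh ‖x‖ * Real.exp (-v) +
      inner ℝ ((Real.exp (-(v + a ^ 2 / 2)) * (Real.sinh a / a * (Real.sinh ‖x‖ / ‖x‖))) • x)
        y := by
  have hcosh : Real.cosh a * Real.exp (-(v + a ^ 2 / 2)) ≤ Real.exp (-v) := by
    calc Real.cosh a * Real.exp (-(v + a ^ 2 / 2))
        ≤ Real.exp (a ^ 2 / 2) * Real.exp (-(v + a ^ 2 / 2)) := by
          gcongr
          exact Real.cosh_le_exp_half_sq a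
      _ = Real.exp (-v) := by rw [← Real.exp_add]; ring_nf
  calc Real.cosh ‖x + y‖ * Real.exp (-(v + a ^ 2 / 2))
      ≤ (Real.cosh a * Real.cosh ‖x‖ + inner ℝ ((Real.sinh a / a * (Real.sinh ‖x‖ / ‖x‖)) • x) y) *
          Real.exp (-(v + a ^ 2 / 2)) := by
        gcongr
        exact cosh_norm_add_le x hy
    _ = Real.cosh ‖x‖ * (Real.cosh a * Real.exp (-(v + a ^ 2 / 2))) + inner ℝ ((Real.exp
          (-(v + a ^ 2 / 2)) * (Real.sinh a / a * (Real.sinh ‖x‖ / ‖x‖))) • x) y := by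
        rw [real_inner_smul_left, real_inner_smul_left]; ring
    _ ≤ _ := by gcongr

end

variable {Ω : Type*} {mΩ : MeasurableSpace Ω} {P : Measure Ω} {E : Type*} [NormedAddCommGroup E]

theorem ae_norm_sum_le {K : ℕ} {D : Fin K → Ω → E} {A : Fin K → Ω → ℝ} {c : ℝ}
    (hAc : ∀ i ω, A i ω ≤ c) (hDA : ∀ i, ∀ᵐ ω ∂P, ‖D i ω‖ ≤ A i ω) :
    ∀ᵐ ω ∂P, ‖∑ i, D i ω‖ ≤ K * c := by
  filter_upwards [ae_all_iff.2 hDA] with ω hω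
  refine (norm_sum_le_of_le _ fun i _ => (hω i).trans (hAc i ω)).trans_eq ?_
  rw [Finset.sum_const, Finset.card_univ, Fintype.card_fin, nsmul_eq_mul]

variable [IsFiniteMeasure P]

theorem integrable_cosh_norm_mul_exp_neg {M : Ω → E} {V : Ω → ℝ} (hM : StronglyMeasurable M)
    (hV : StronglyMeasurable V) {b : ℝ} (hMb : ∀ᵐ ω ∂P, ‖M ω‖ ≤ b) (hV0 : ∀ ω, 0 ≤ V ω) :
    Integrable (fun ω => Real.cosh ‖M ω‖ * Real.exp (-V ω)) P := by
  refine .of_bound ((Real.continuous_cosh.comp_stronglyMeasurable hM.norm).mul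
    (Real.continuous_exp.comp_stronglyMeasurable hV.neg)).aestronglyMeasurable (Real.cosh b) ?_
  filter_upwards [hMb] with ω hω
  rw [Real.norm_eq_abs, abs_mul, Real.abs_exp, abs_of_pos (Real.cosh_pos _)]
  exact (mul_le_of_le_one_right (Real.cosh_pos _).le
    (Real.exp_le_one_iff.2 (neg_nonpos.2 (hV0 ω)))).trans
    (Real.cosh_le_cosh.2 (abs_le_abs_of_nonneg (norm_nonneg _) hω))

variable [InnerProductSpace ℝ E] [CompleteSpace E]

theorem integral_cosh_norm_add_mul_exp_le {m : MeasurableSpace Ω} (hm : m ≤ mΩ) {M D : Ω → E}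
    {V A : Ω → ℝ} (hM : StronglyMeasurable[m] M) (hV : StronglyMeasurable[m] V)
    (hA : StronglyMeasurable[m] A) (hD : StronglyMeasurable[mΩ] D) {b c : ℝ}
    (hMb : ∀ᵐ ω ∂P, ‖M ω‖ ≤ b) (hV0 : ∀ ω, 0 ≤ V ω) (hAc : ∀ ω, A ω ≤ c)
    (hDA : ∀ᵐ ω ∂P, ‖D ω‖ ≤ A ω) (hD0 : P[D | m] =ᵐ[P] 0) :
    ∫ ω, Real.cosh ‖M ω + D ω‖ * Real.exp (-(V ω + A ω ^ 2 / 2)) ∂P ≤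
      ∫ ω, Real.cosh ‖M ω‖ * Real.exp (-V ω) ∂P := by
  set w : Ω → ℝ := fun ω => Real.exp (-(V ω + A ω ^ 2 / 2))
  set g : Ω → E := fun ω => (w ω * (Real.sinh (A ω) / A ω * (Real.sinh ‖M ω‖ / ‖M ω‖))) • M ω
  have hsinhm : Measurable fun r : ℝ => Real.sinh r / r := Real.measurable_sinh.div measurable_id
  have hg : StronglyMeasurable[m] g :=
    ((Real.continuous_exp.comp_stronglyMeasurable
      (hV.add ((hA.pow 2).div stronglyMeasurable_const)).neg).mul
      ((hsinhm.comp hA.measurable).stronglyMeasurable.mul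
        (hsinhm.comp hM.norm.measurable).stronglyMeasurable)).smul hM
  have hw0 : ∀ ω, 0 ≤ w ω := fun ω => (Real.exp_pos _).le
  have hw1 : ∀ ω, w ω ≤ 1 := fun ω => Real.exp_le_one_iff.2
    (neg_nonpos.2 (add_nonneg (hV0 ω) (div_nonneg (sq_nonneg _) two_pos.le)))
  have hgD : Integrable (fun ω => inner ℝ (g ω) (D ω)) P := by
    refine .of_bound ((hg.mono hm).inner hD).aestronglyMeasurable (Real.sinh c * Real.sinh b) ?_
    filter_upwards [hMb, hDA] with ω hωb hωA
    have hA0 : 0 ≤ Real.sinh (A ω) := Real.sinh_nonneg_iff.2 ((norm_nonneg _).trans hωA)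
    have hM0 : 0 ≤ Real.sinh ‖M ω‖ := Real.sinh_nonneg_iff.2 (norm_nonneg _)
    simp only [g, mul_smul (w ω), real_inner_smul_left (x := _ • M ω), norm_mul]
    rw [Real.norm_of_nonneg (hw0 ω), Real.norm_eq_abs]
    exact (mul_le_of_le_one_left (abs_nonneg _) (hw1 ω)).trans
      ((abs_inner_sinh_smul_le (M ω) hωA).trans (mul_le_mul (Real.sinh_le_sinh.2 (hAc ω))
        (Real.sinh_le_sinh.2 hωb) hM0 (hA0.trans (Real.sinh_le_sinh.2 (hAc ω)))))
  have hDint : Integrable D P :=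
    .of_bound hD.aestronglyMeasurable c (hDA.mono fun ω hω => hω.trans (hAc ω))
  have hMV := integrable_cosh_norm_mul_exp_neg (hM.mono hm) (hV.mono hm) hMb hV0
  calc _ ≤ ∫ ω, (Real.cosh ‖M ω‖ * Real.exp (-V ω) + inner ℝ (g ω) (D ω)) ∂P :=
        integral_mono_of_nonneg
          (ae_of_all _ fun ω => mul_nonneg (Real.cosh_pos _).le (Real.exp_pos _).le)
          (hMV.add hgD) (hDA.mono fun ω hω => cosh_norm_add_mul_exp_le (M ω) hω (V ω))
    _ = _ := by
        rw [integral_add hMV hgD, integral_inner_eq_zero_of_condExp hm hg hgD hDint hD0, add_zero]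

theorem integral_cosh_norm_sum_le_one [IsProbabilityMeasure P] {K : ℕ}
    {m : Fin K → MeasurableSpace Ω} (hmono : Monotone m) (hm : ∀ i, m i ≤ mΩ) {D : Fin K → Ω → E}
    {A : Fin K → Ω → ℝ} (hDm : ∀ i j, i < j → StronglyMeasurable[m j] (D i))
    (hD : ∀ i, StronglyMeasurable (D i)) (hA : ∀ i, StronglyMeasurable[m i] (A i)) {c : ℝ}
    (hAc : ∀ i ω, A i ω ≤ c) (hDA : ∀ i, ∀ᵐ ω ∂P, ‖D i ω‖ ≤ A i ω)
    (hD0 : ∀ i, P[D i | m i] =ᵐ[P] 0) :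
    ∫ ω, Real.cosh ‖∑ i, D i ω‖ * Real.exp (-∑ i, A i ω ^ 2 / 2) ∂P ≤ 1 := by
  induction K with
  | zero => simp
  | succ K ih =>
    simp only [Fin.sum_univ_castSucc]
    exact (integral_cosh_norm_add_mul_exp_le (hm (Fin.last K))
      (Finset.stronglyMeasurable_fun_sum _ fun i _ => hDm _ _ (Fin.castSucc_lt_last i))
      (Finset.stronglyMeasurable_fun_sum _ fun i _ => (((hA _).mono
        (hmono (Fin.castSucc_lt_last i).le)).pow 2).div stronglyMeasurable_const)
      (hA _) (hD (Fin.last K)) (ae_norm_sum_le (fun i => hAc i.castSucc) fun i => hDA i.castSucc)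
      (fun ω => Finset.sum_nonneg fun i _ => div_nonneg (sq_nonneg _) two_pos.le) (hAc _) (hDA _)
      (hD0 _)).trans
      (ih (m := fun i => m i.castSucc) (hmono.comp Fin.strictMono_castSucc.monotone)
        (fun i => hm _) (fun i j hij => hDm _ _ (Fin.castSucc_lt_castSucc_iff.2 hij))
        (fun i => hD _) (fun i => hA _) (fun i => hAc _) (fun i => hDA _) fun i => hD0 _)

/-- The bound does not involve the dimension of `E`: this is what keeps covering numbers of the
ball of queries out of the estimate for the returns. -/
theorem measure_norm_sum_gt_le [IsProbabilityMeasure P] {K : ℕ} {m : Fin K → MeasurableSpace Ω}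
    (hmono : Monotone m) (hm : ∀ i, m i ≤ mΩ) {D : Fin K → Ω → E} {A : Fin K → Ω → ℝ}
    (hDm : ∀ i j, i < j → StronglyMeasurable[m j] (D i)) (hD : ∀ i, StronglyMeasurable (D i))
    (hA : ∀ i, StronglyMeasurable[m i] (A i)) {c : ℝ} (hAc : ∀ i ω, A i ω ≤ c)
    (hDA : ∀ i, ∀ᵐ ω ∂P, ‖D i ω‖ ≤ A i ω) (hD0 : ∀ i, P[D i | m i] =ᵐ[P] 0) (L : ℝ) :
    P {ω | ¬ ‖∑ i, D i ω‖ ≤ ∑ i, A i ω ^ 2 / 2 + L} ≤ ENNReal.ofReal (2 * Real.exp (-L)) := by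
  have hSm : StronglyMeasurable fun ω => ∑ i, D i ω :=
    Finset.stronglyMeasurable_fun_sum _ fun i _ => hD i
  have hVm : StronglyMeasurable fun ω => ∑ i, A i ω ^ 2 / 2 :=
    Finset.stronglyMeasurable_fun_sum _ fun i _ =>
      (((hA i).mono (hm i)).pow 2).div stronglyMeasurable_const
  have hcosh := (integrable_cosh_norm_mul_exp_neg hSm hVm (ae_norm_sum_le hAc hDA)
    fun ω => Finset.sum_nonneg fun i _ => div_nonneg (sq_nonneg _) two_pos.le).const_mul 2
  have hexp_le : ∀ ω, Real.exp (‖∑ i, D i ω‖ - ∑ i, A i ω ^ 2 / 2) ≤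
      2 * (Real.cosh ‖∑ i, D i ω‖ * Real.exp (-∑ i, A i ω ^ 2 / 2)) := fun ω => by
    rw [sub_eq_add_neg, Real.exp_add, ← mul_assoc, Real.cosh_eq]
    gcongr
    linarith [Real.exp_pos (-‖∑ i, D i ω‖)]
  have hint : Integrable (fun ω => Real.exp (‖∑ i, D i ω‖ - ∑ i, A i ω ^ 2 / 2)) P :=
    hcosh.mono' (Real.continuous_exp.comp_stronglyMeasurable
      (hSm.norm.sub hVm)).aestronglyMeasurable (ae_of_all _ fun ω => by
        rw [Real.norm_eq_abs, Real.abs_exp]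
        exact hexp_le ω)
  have hmean : ∫ ω, Real.exp (‖∑ i, D i ω‖ - ∑ i, A i ω ^ 2 / 2) ∂P ≤ 2 := by
    refine (integral_mono hint hcosh hexp_le).trans ?_
    rw [integral_const_mul]
    linarith [integral_cosh_norm_sum_le_one hmono hm hDm hD hA hAc hDA hD0]
  refine (measure_mono fun ω hω => ?_).trans (measure_lt_le_exp_neg hint hmean L)
  simp only [Set.mem_ofPred_eq, not_le] at hω ⊢
  linarith

end HilbertConcentration

section Determined

variable {Ω : Type*} {α β : Type*} {m m' : MeasurableSpace Ω}

/-- The value of `f` is known, given the information `m`. For countable `α` this is measurability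
with respect to the discrete σ-algebra, so no σ-algebra on `α` has to be chosen. -/
def DeterminedBy (m : MeasurableSpace Ω) (f : Ω → α) : Prop :=
  ∀ a, MeasurableSet[m] (f ⁻¹' {a})

namespace DeterminedBy

theorem mono {f : Ω → α} (hf : DeterminedBy m f) (h : m ≤ m') : DeterminedBy m' f :=
  fun a => h _ (hf a)

theorem comp [Countable α] {f : Ω → α} (hf : DeterminedBy m f) (g : α → β) :
    DeterminedBy m fun ω => g (f ω) := by
  intro b
  rw [show (fun ω => g (f ω)) ⁻¹' {b} = ⋃ a ∈ g ⁻¹' {b}, f ⁻¹' {a} by ext; simp]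
  exact MeasurableSet.biUnion (Set.to_countable _) fun a _ => hf a

theorem prodMk {f : Ω → α} {g : Ω → β} (hf : DeterminedBy m f) (hg : DeterminedBy m g) :
    DeterminedBy m fun ω => (f ω, g ω) := by
  rintro ⟨a, b⟩
  rw [show (fun ω => (f ω, g ω)) ⁻¹' {(a, b)} = f ⁻¹' {a} ∩ g ⁻¹' {b} by ext; simp]
  exact (hf a).inter (hg b)

theorem pi {ι : Type*} [Countable ι] {f : ι → Ω → α} (hf : ∀ i, DeterminedBy m (f i)) :
    DeterminedBy m fun ω i => f i ω := by
  intro a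
  rw [show (fun ω i => f i ω) ⁻¹' {a} = ⋂ i, f i ⁻¹' {a i} by ext; simp [funext_iff]]
  exact MeasurableSet.iInter fun i => hf i (a i)

theorem stronglyMeasurable [Finite α] [TopologicalSpace β] {f : Ω → α} (hf : DeterminedBy m f)
    (g : α → β) : StronglyMeasurable[m] fun ω => g (f ω) :=
  let F : @SimpleFunc Ω m α := @SimpleFunc.mk Ω m α f hf (Set.toFinite _)
  (@SimpleFunc.map Ω α β m g F).stronglyMeasurable

end DeterminedBy

theorem condExp_apply_eq_sum [Fintype α] {mΩ : MeasurableSpace Ω} {P : Measure Ω}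
    [IsFiniteMeasure P] (hm : m ≤ mΩ) {X : Ω → α} (hX : DeterminedBy mΩ X) {q : α → Ω → ℝ}
    (hq : ∀ x, P[(X ⁻¹' {x}).indicator (fun _ => (1 : ℝ)) | m] =ᵐ[P] q x) {f : α → Ω → ℝ}
    (hf : ∀ x, StronglyMeasurable[m] (f x)) {c : ℝ} (hfc : ∀ x ω, ‖f x ω‖ ≤ c) :
    P[fun ω => f (X ω) ω | m] =ᵐ[P] fun ω => ∑ x, q x ω * f x ω := by
  classical
  set I : α → Ω → ℝ := fun x => (X ⁻¹' {x}).indicator fun _ => 1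
  have hI : ∀ x, Integrable (I x) P := fun x => (integrable_const 1).indicator (hX x)
  have hfI : (fun ω => f (X ω) ω) = ∑ x, f x * I x := by
    funext ω
    simp [I, Set.indicator_apply]
  have hpull : ∀ᵐ ω ∂P, ∀ x, (P[f x * I x | m]) ω = f x ω * (P[I x | m]) ω :=
    ae_all_iff.2 fun x => condExp_stronglyMeasurable_mul_of_bound hm (hf x) (hI x) c
      (ae_of_all _ (hfc x))
  rw [hfI]
  refine (condExp_finsetSum (fun x _ => (hI x).bdd_mul ((hf x).mono hm).aestronglyMeasurable
    (ae_of_all _ (hfc x))) _).trans ?_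
  filter_upwards [hpull, ae_all_iff.2 hq] with ω hpull hq
  rw [Finset.sum_apply]
  exact Finset.sum_congr rfl fun x _ =>
    (hpull x).trans ((congrArg (f x ω * ·) (hq x)).trans (mul_comm _ _))

end Determined

theorem measure_setOf_not_forall_le {Ω ι : Type*} {mΩ : MeasurableSpace Ω} (P : Measure Ω)
    [Fintype ι] {Q : ι → Ω → Prop} {c : ℝ} (hQ : ∀ i, P {ω | ¬ Q i ω} ≤ ENNReal.ofReal c) :
    P {ω | ¬ ∀ i, Q i ω} ≤ ENNReal.ofReal (Fintype.card ι * c) := by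
  simp only [not_forall, Set.ofPred_exists]
  refine (measure_iUnion_fintype_le _ _).trans ((Finset.sum_le_sum fun i _ => hQ i).trans_eq ?_)
  rw [Finset.sum_const, Finset.card_univ, nsmul_eq_mul, ENNReal.ofReal_mul (Nat.cast_nonneg _),
    ENNReal.ofReal_natCast]

theorem sum_abs_sub_le_two_of_mem_stdSimplex {α : Type*} [Fintype α] {p q : α → ℝ}
    (hp : p ∈ stdSimplex ℝ α) (hq : q ∈ stdSimplex ℝ α) : ∑ x, |p x - q x| ≤ 2 := by
  calc ∑ x, |p x - q x| ≤ ∑ x, (p x + q x) := Finset.sum_le_sum fun x _ =>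
        (abs_sub _ _).trans_eq (by rw [abs_of_nonneg (hp.1 x), abs_of_nonneg (hq.1 x)])
    _ = 2 := by rw [Finset.sum_add_distrib, hp.2, hq.2, one_add_one_eq_two]

instance Episode.instFinite {H : ℕ} {𝒮 𝒜 ℬ : Type*} [Finite 𝒮] [Finite 𝒜] [Finite ℬ] :
    Finite (Episode H 𝒮 𝒜 ℬ) :=
  Finite.of_injective (fun e : Episode H 𝒮 𝒜 ℬ => (e.state, e.act)) fun e e' h => by
    cases e; cases e'; simpa using h

/-- The expectation of `f` at the state that follows the triple `p` in step `h`. -/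
noncomputable def VMG.expNext {d H : ℕ} {𝒮 𝒜 ℬ : Type*} [Fintype 𝒮] (G : VMG d H 𝒮 𝒜 ℬ)
    (h : Fin H) (p : 𝒮 × 𝒜 × ℬ) (f : 𝒮 → ℝ) : ℝ :=
  ∑ x, (G.trans h p.1 p.2.1 p.2.2).1 x * f x

namespace VIZero

variable {k d H : ℕ} {𝒮 𝒜 ℬ : Type*}

theorem sum_visitSet_sub (D : Fin k → Episode H 𝒮 𝒜 ℬ)
    (r : Fin k → Fin H → EuclideanSpace ℝ (Fin d)) (h : Fin H) (s : 𝒮) (a : 𝒜) (b : ℬ)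
    (c : EuclideanSpace ℝ (Fin d)) :
    ∑ i ∈ visitSet D h s a b, (r i h - c) =
      (visits D h s a b : ℝ) • (empRet D r h s a b - c) := by
  rcases eq_or_ne (visits D h s a b) 0 with h0 | h0
  · rw [h0, Nat.cast_zero, zero_smul, Finset.card_eq_zero.1 h0, Finset.sum_empty]
  · rw [Finset.sum_sub_distrib, Finset.sum_const, smul_sub, empRet,
      smul_inv_smul₀ (Nat.cast_ne_zero.2 h0), ← Nat.cast_smul_eq_nsmul ℝ, visits]

variable [Fintype 𝒮]

theorem sum_visitSet_state_succ (D : Fin k → Episode H 𝒮 𝒜 ℬ) (h : Fin H) (s : 𝒮) (a : 𝒜) (b : ℬ)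
    (f : 𝒮 → ℝ) : ∑ i ∈ visitSet D h s a b, f ((D i).state h.succ) =
      visits D h s a b * ∑ x, empTrans D h s a b x * f x := by
  classical
  rcases eq_or_ne (visits D h s a b) 0 with h0 | h0
  · rw [h0, Nat.cast_zero, zero_mul, Finset.card_eq_zero.1 h0, Finset.sum_empty]
  rw [Finset.mul_sum, ← Finset.sum_fiberwise _ fun i => (D i).state h.succ]
  refine Finset.sum_congr rfl fun x _ => ?_
  rw [empTrans, ← mul_assoc, mul_div_cancel₀ _ (Nat.cast_ne_zero.2 h0), visitsTo, ← nsmul_eq_mul,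
    ← Finset.sum_const]
  refine Finset.sum_congr (by congr!) fun i hi => ?_
  rw [(Finset.mem_filter.1 hi).2]

theorem empTrans_mem_stdSimplex {D : Fin k → Episode H 𝒮 𝒜 ℬ} {h : Fin H} {s : 𝒮} {a : 𝒜} {b : ℬ}
    (hN : visits D h s a b ≠ 0) : empTrans D h s a b ∈ stdSimplex ℝ 𝒮 := by
  refine ⟨fun x => div_nonneg (Nat.cast_nonneg _) (Nat.cast_nonneg _), ?_⟩
  have hsum := sum_visitSet_state_succ D h s a b fun _ => 1
  simp only [Finset.sum_const, nsmul_eq_mul, mul_one] at hsum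
  exact mul_eq_left₀ (Nat.cast_ne_zero.2 hN) |>.1 hsum.symm

end VIZero

namespace ExplorationRun

variable {K d H : ℕ} {𝒮 𝒜 ℬ : Type*} [Fintype 𝒮] [Fintype 𝒜] [Fintype ℬ]
  {alg : ExplorePlan K d H 𝒮 𝒜 ℬ} {G : VMG d H 𝒮 𝒜 ℬ} {s₁ : 𝒮}
  {Ω : Type*} {mΩ : MeasurableSpace Ω} {P : Measure Ω}

/-- The episodes before episode `k`. -/
def past (R : ExplorationRun alg G s₁ P) (k : Fin K) (ω : Ω) : Fin k → Episode H 𝒮 𝒜 ℬ :=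
  fun i => R.episode (Fin.castLE k.isLt.le i) ω

/-- The state and the joint action of step `h` in episode `k`. -/
def triple (R : ExplorationRun alg G s₁ P) (k : Fin K) (h : Fin H) (ω : Ω) : 𝒮 × 𝒜 × ℬ :=
  ((R.episode k ω).state h.castSucc, (R.episode k ω).act h)

variable (R : ExplorationRun alg G s₁ P)

theorem determinedBy_state (k : Fin K) (h : Fin (H + 1)) :
    DeterminedBy (R.ℱ (k * (H + 1) + h)) fun ω => (R.episode k ω).state h :=
  R.measurable_state k h

theorem mul_add_le_mul_add_of_lt {i j : Fin K} (hij : i < j) (h : Fin H) :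
    (i : ℕ) * (H + 1) + H ≤ j * (H + 1) + h := by
  have : (i : ℕ) + 1 ≤ j := hij
  nlinarith

theorem determinedBy_episode (k : Fin K) :
    DeterminedBy (R.ℱ (k * (H + 1) + H)) (R.episode k) := by
  induction k using WellFoundedLT.induction with
  | ind k ih =>
    have hpast : DeterminedBy (R.ℱ (k * (H + 1) + H)) (R.past k) := DeterminedBy.pi fun i =>
      (ih (Fin.castLE k.isLt.le i) i.isLt).mono (R.ℱ.mono (by
        have : ((Fin.castLE k.isLt.le i : Fin K) : ℕ) ≤ k := i.isLt.le
        gcongr))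
    have hstate : DeterminedBy (R.ℱ (k * (H + 1) + H)) fun ω h => (R.episode k ω).state h :=
      DeterminedBy.pi fun h => (R.determinedBy_state k h).mono (R.ℱ.mono (by
        have := h.is_le
        omega))
    have hepisode : R.episode k = fun ω => ⟨(R.episode k ω).state, fun h =>
        alg.explore k (R.past k ω) h ((R.episode k ω).state h.castSucc)⟩ := by
      funext ω
      exact congrArg (Episode.mk _) (funext fun h => R.act_eq k h ω)
    rw [hepisode]
    exact (hpast.prodMk hstate).comp fun q : (Fin k → Episode H 𝒮 𝒜 ℬ) × (Fin (H + 1) → 𝒮) =>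
      (⟨q.2, fun h => alg.explore k q.1 h (q.2 h.castSucc)⟩ : Episode H 𝒮 𝒜 ℬ)

theorem determinedBy_past (k : Fin K) (h : Fin H) :
    DeterminedBy (R.ℱ (k * (H + 1) + h)) (R.past k) :=
  DeterminedBy.pi fun i => (R.determinedBy_episode (Fin.castLE k.isLt.le i)).mono
    (R.ℱ.mono (mul_add_le_mul_add_of_lt i.isLt h))

theorem determinedBy_past_triple (k : Fin K) (h : Fin H) :
    DeterminedBy (R.ℱ (k * (H + 1) + h)) fun ω => (R.past k ω, R.triple k h ω) := by
  have htriple : ∀ ω, R.triple k h ω = ((R.episode k ω).state h.castSucc,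
      alg.explore k (R.past k ω) h ((R.episode k ω).state h.castSucc)) := fun ω =>
    congrArg (Prod.mk _) (R.act_eq k h ω)
  simp only [htriple]
  exact ((R.determinedBy_past k h).prodMk (R.determinedBy_state k h.castSucc)).comp
    fun q => (q.1, q.2, alg.explore k q.1 h q.2)

theorem determinedBy_triple (k : Fin K) (h : Fin H) :
    DeterminedBy (R.ℱ (k * (H + 1) + h)) (R.triple k h) :=
  (R.determinedBy_past_triple k h).comp Prod.snd

theorem monotone_filtration_step {k : ℕ} (hk : k ≤ K) (h : Fin H) :
    Monotone fun i : Fin k => R.ℱ ((Fin.castLE hk i : Fin K) * (H + 1) + h) := fun i j hij =>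
  R.ℱ.mono (by
    have : (i : ℕ) ≤ j := hij
    simp only [Fin.val_castLE]
    gcongr)

theorem condExp_next [IsFiniteMeasure P] (k : Fin K) (h : Fin H)
    {g : (Fin k → Episode H 𝒮 𝒜 ℬ) × 𝒮 × 𝒜 × ℬ → 𝒮 → ℝ} (hg : ∀ q x, g q x ∈ Set.Icc 0 1) :
    P[fun ω => g (R.past k ω, R.triple k h ω) ((R.episode k ω).state h.succ) |
        R.ℱ (k * (H + 1) + h)] =ᵐ[P]
      fun ω => G.expNext h (R.triple k h ω) (g (R.past k ω, R.triple k h ω)) :=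
  condExp_apply_eq_sum (R.ℱ.le _) ((R.determinedBy_state k h.succ).mono (R.ℱ.le _))
    (R.condExp_state k h) (f := fun x ω => g (R.past k ω, R.triple k h ω) x)
    (fun x => (R.determinedBy_past_triple k h).stronglyMeasurable fun q => g q x) (c := 1)
    fun x ω => by
      rw [Real.norm_eq_abs, abs_of_nonneg (hg _ _).1]
      exact (hg _ _).2

open Classical in
theorem condExp_indicator_ret_sub [IsFiniteMeasure P] (k : Fin K) (h : Fin H)
    (p : 𝒮 × 𝒜 × ℬ) :
    P[(R.triple k h ⁻¹' {p}).indicator (fun ω => R.ret k h ω - G.ret h p.1 p.2.1 p.2.2) |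
      R.ℱ (k * (H + 1) + h)] =ᵐ[P] 0 := by
  have hint : Integrable (R.ret k h) P :=
    .of_bound ((R.measurable_ret k h).mono (R.ℱ.le _)).aestronglyMeasurable 1 (R.norm_ret_le k h)
  have hsub := condExp_sub hint (integrable_const (G.ret h p.1 p.2.1 p.2.2))
    (R.ℱ (k * (H + 1) + h))
  rw [condExp_const (R.ℱ.le _)] at hsub
  refine (condExp_indicator (hint.sub (integrable_const _)) (R.determinedBy_triple k h p)).trans ?_
  filter_upwards [hsub, R.condExp_ret k h] with ω hsub hret
  refine Set.indicator_apply_eq_zero.2 fun hω => ?_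
  have hω : R.triple k h ω = p := hω
  refine hsub.trans ?_
  rw [Pi.sub_apply, hret, ← hω]
  exact sub_self _

variable [IsProbabilityMeasure P]

theorem measure_abs_sum_next_sub_sum_expNext_gt_le (h : Fin H)
    {g : ∀ k : Fin K, (Fin k → Episode H 𝒮 𝒜 ℬ) × 𝒮 × 𝒜 × ℬ → 𝒮 → ℝ}
    (hg : ∀ k q x, g k q x ∈ Set.Icc 0 1) {X Y : Fin K → Ω → ℝ}
    (hX : ∀ k ω, X k ω = g k (R.past k ω, R.triple k h ω) ((R.episode k ω).state h.succ))
    (hY : ∀ k ω, Y k ω = G.expNext h (R.triple k h ω) (g k (R.past k ω, R.triple k h ω)))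
    {η : ℝ} (hη0 : 0 < η) (hη1 : η ≤ 1) (L : ℝ) {k : ℕ} (hk : k ≤ K) :
    P {ω | ¬ |∑ i : Fin k, X (Fin.castLE hk i) ω - ∑ i : Fin k, Y (Fin.castLE hk i) ω| ≤
      η * ∑ i : Fin k, Y (Fin.castLE hk i) ω + L / η} ≤ ENNReal.ofReal (2 * Real.exp (-L)) := by
  obtain rfl : X = _ := funext₂ hX
  obtain rfl : Y = _ := funext₂ hY
  have hXm : ∀ k : Fin K, StronglyMeasurable[R.ℱ (k * (H + 1) + H)]
      fun ω => g k (R.past k ω, R.triple k h ω) ((R.episode k ω).state h.succ) := fun k =>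
    (((R.determinedBy_past_triple k h).mono (R.ℱ.mono (by have := h.isLt; omega))).prodMk
      ((R.determinedBy_episode k).comp fun e => e.state h.succ)).stronglyMeasurable
        fun q => g k q.1 q.2
  exact measure_abs_sum_sub_sum_gt_le (R.monotone_filtration_step hk h) (fun i => R.ℱ.le _)
    (fun i j hij => (hXm _).mono (R.ℱ.mono
      (mul_add_le_mul_add_of_lt (j := Fin.castLE hk j) hij h)))
    (fun i => (hXm _).mono (R.ℱ.le _))
    (fun i => (R.determinedBy_past_triple _ h).stronglyMeasurable fun q =>
      G.expNext h q.2 (g _ q)) (fun i ω => hg _ _ _)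
    (fun i ω => ⟨le_stdSimplex_sum_mul _ fun x => (hg _ _ _).1,
      stdSimplex_sum_mul_le _ fun x => (hg _ _ _).2⟩)
    (fun i => R.condExp_next _ h (hg _)) hη0 hη1 L

open Classical in
theorem measure_norm_sum_ret_sub_gt_le (h : Fin H) (p : 𝒮 × 𝒜 × ℬ) {l : ℝ} (hl : 0 ≤ l) (L : ℝ)
    {k : ℕ} (hk : k ≤ K) :
    P {ω | ¬ ‖∑ i : Fin k, l • (if R.triple (Fin.castLE hk i) h ω = p then
        R.ret (Fin.castLE hk i) h ω - G.ret h p.1 p.2.1 p.2.2 else 0)‖ ≤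
      ∑ i : Fin k, (if R.triple (Fin.castLE hk i) h ω = p then l * 2 else 0) ^ 2 / 2 + L} ≤
      ENNReal.ofReal (2 * Real.exp (-L)) := by
  set D : Fin K → Ω → EuclideanSpace ℝ (Fin d) := fun i ω =>
    l • (if R.triple i h ω = p then R.ret i h ω - G.ret h p.1 p.2.1 p.2.2 else 0)
  have hD : ∀ i, D i = l • (R.triple i h ⁻¹' {p}).indicator
      (fun ω => R.ret i h ω - G.ret h p.1 p.2.1 p.2.2) := fun i => by
    funext ω
    simp [D, Set.indicator_apply]
  have hDm : ∀ i : Fin K, StronglyMeasurable[R.ℱ (i * (H + 1) + H)] (D i) := fun i => by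
    have hnext : (i * (H + 1) + h + 1 : ℕ) ≤ i * (H + 1) + H := by omega
    rw [hD]
    exact ((((R.measurable_ret i h).mono (R.ℱ.mono hnext)).sub
      stronglyMeasurable_const).indicator (R.ℱ.mono (by omega) _
        (R.determinedBy_triple i h p))).const_smul l
  refine measure_norm_sum_gt_le (R.monotone_filtration_step hk h) (fun i => R.ℱ.le _)
    (D := fun i => D (Fin.castLE hk i)) (c := l * 2)
    (fun i j hij => (hDm _).mono (R.ℱ.mono
      (mul_add_le_mul_add_of_lt (j := Fin.castLE hk j) hij h)))
    (fun i => (hDm _).mono (R.ℱ.le _))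
    (fun i => (R.determinedBy_triple _ h).stronglyMeasurable fun q => if q = p then l * 2 else 0)
    (fun i ω => by split_ifs <;> linarith) (fun i => ?_) (fun i => ?_) L
  · filter_upwards [R.norm_ret_le (Fin.castLE hk i) h] with ω hω
    rw [norm_smul, Real.norm_of_nonneg hl]
    split_ifs
    · exact mul_le_mul_of_nonneg_left ((norm_sub_le _ _).trans
        ((add_le_add hω (G.norm_ret_le _ _ _ _)).trans_eq one_add_one_eq_two)) hl
    · simp
  · rw [hD]
    filter_upwards [condExp_smul (μ := P) l ((R.triple (Fin.castLE hk i) h ⁻¹' {p}).indicator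
        fun ω => R.ret (Fin.castLE hk i) h ω - G.ret h p.1 p.2.1 p.2.2)
        (R.ℱ ((Fin.castLE hk i : Fin K) * (H + 1) + h)),
      R.condExp_indicator_ret_sub (Fin.castLE hk i) h p] with ω hsmul hzero
    rw [hsmul, Pi.smul_apply, hzero, Pi.zero_apply, smul_zero]

omit [IsProbabilityMeasure P]

/-- The episodes before episode `k` that visit the triple `p` in step `h`. -/
noncomputable def visitSet (k : Fin K) (h : Fin H) (p : 𝒮 × 𝒜 × ℬ) (ω : Ω) : Finset (Fin k) :=
  VIZero.visitSet (R.past k ω) h p.1 p.2.1 p.2.2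

/-- The number of visits to the triple `p` in step `h` before episode `k`. -/
noncomputable def count (k : Fin K) (h : Fin H) (p : 𝒮 × 𝒜 × ℬ) (ω : Ω) : ℕ :=
  VIZero.visits (R.past k ω) h p.1 p.2.1 p.2.2

/-- The empirical transition probabilities at the triple `p` before episode `k`. -/
noncomputable def empTrans (k : Fin K) (h : Fin H) (p : 𝒮 × 𝒜 × ℬ) (ω : Ω) : 𝒮 → ℝ :=
  VIZero.empTrans (R.past k ω) h p.1 p.2.1 p.2.2

/-- The empirical mean return at the triple `p` before episode `k`. -/
noncomputable def empRet (k : Fin K) (h : Fin H) (p : 𝒮 × 𝒜 × ℬ) (ω : Ω) :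
    EuclideanSpace ℝ (Fin d) :=
  VIZero.empRet (R.past k ω) (fun i h => R.ret (Fin.castLE k.isLt.le i) h ω) h p.1 p.2.1 p.2.2

theorem mem_visitSet {k : Fin K} {h : Fin H} {p : 𝒮 × 𝒜 × ℬ} {ω : Ω} {i : Fin k} :
    i ∈ R.visitSet k h p ω ↔ R.triple (Fin.castLE k.isLt.le i) h ω = p := by
  classical
  rw [visitSet, VIZero.visitSet, Finset.mem_filter]
  simp [triple, past, Prod.ext_iff]

theorem count_lt (k : Fin K) (h : Fin H) (p : 𝒮 × 𝒜 × ℬ) (ω : Ω) : R.count k h p ω < K :=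
  ((Finset.card_le_univ (R.visitSet k h p ω)).trans_eq (Fintype.card_fin k)).trans_lt k.isLt

open Classical in
theorem sum_ite_triple_eq {E : Type*} [AddCommMonoid E] (k : Fin K) (h : Fin H)
    (p : 𝒮 × 𝒜 × ℬ) (ω : Ω) (f : Fin k → E) :
    ∑ i : Fin k, (if R.triple (Fin.castLE k.isLt.le i) h ω = p then f i else 0) =
      ∑ i ∈ R.visitSet k h p ω, f i := by
  simp only [← Finset.sum_filter, ← mem_visitSet, Finset.filter_univ_mem]

variable [IsProbabilityMeasure P]

theorem measure_abs_empTrans_sub_gt_le (k : Fin K) (h : Fin H) (p : 𝒮 × 𝒜 × ℬ) {f : 𝒮 → ℝ}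
    (hf : ∀ x, f x ∈ Set.Icc 0 1) {η : ℝ} (hη0 : 0 < η) (hη1 : η ≤ 1) (L : ℝ) :
    P {ω | ¬ (R.count k h p ω ≠ 0 →
      |∑ x, R.empTrans k h p ω x * f x - G.expNext h p f| ≤
        η * G.expNext h p f + L / (η * R.count k h p ω))} ≤ ENNReal.ofReal (2 * Real.exp (-L)) := by
  classical
  have hsum := R.measure_abs_sum_next_sub_sum_expNext_gt_le h
    (g := fun _ q x => if q.2 = p then f x else 0)
    (X := fun k ω => if R.triple k h ω = p then f ((R.episode k ω).state h.succ) else 0)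
    (Y := fun k ω => if R.triple k h ω = p then G.expNext h p f else 0)
    (fun k q x => by split_ifs <;> simp [(hf x).1, (hf x).2]) (fun k ω => rfl)
    (fun k ω => by
      by_cases hω : R.triple k h ω = p
      · simp only [hω, if_true]
      · simp [hω, VMG.expNext]) hη0 hη1 L k.isLt.le
  refine (measure_mono fun ω hω => ?_).trans hsum
  refine fun hsum => hω fun h0 => ?_
  have hn : (0 : ℝ) < R.count k h p ω := by positivity
  have hnext : ∑ i ∈ R.visitSet k h p ω,
      f ((R.episode (Fin.castLE k.isLt.le i) ω).state h.succ) =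
      R.count k h p ω * ∑ x, R.empTrans k h p ω x * f x :=
    VIZero.sum_visitSet_state_succ (R.past k ω) h p.1 p.2.1 p.2.2 f
  have hconst : ∑ _i ∈ R.visitSet k h p ω, G.expNext h p f =
      R.count k h p ω * G.expNext h p f := by
    rw [Finset.sum_const, nsmul_eq_mul]
    rfl
  rw [R.sum_ite_triple_eq k h p ω
      (fun i => f ((R.episode (Fin.castLE k.isLt.le i) ω).state h.succ)),
    R.sum_ite_triple_eq k h p ω (fun _ => G.expNext h p f), hnext, hconst, ← mul_sub, abs_mul,
    Nat.abs_cast, ← le_div_iff₀' hn] at hsum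
  refine hsum.trans_eq ?_
  field_simp

theorem measure_norm_ret_sub_empRet_gt_le (k : Fin K) (h : Fin H) (p : 𝒮 × 𝒜 × ℬ) {l : ℝ}
    (hl : 0 < l) (L : ℝ) :
    P {ω | ¬ (R.count k h p ω ≠ 0 → ‖G.ret h p.1 p.2.1 p.2.2 - R.empRet k h p ω‖ ≤
      2 * l + L / (l * R.count k h p ω))} ≤ ENNReal.ofReal (2 * Real.exp (-L)) := by
  classical
  refine (measure_mono fun ω hω => ?_).trans
    (R.measure_norm_sum_ret_sub_gt_le h p hl.le L k.isLt.le)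
  refine fun hsum => hω fun h0 => ?_
  have hn : (0 : ℝ) < R.count k h p ω := by positivity
  have hret : ∑ i ∈ R.visitSet k h p ω,
      (R.ret (Fin.castLE k.isLt.le i) h ω - G.ret h p.1 p.2.1 p.2.2) =
      (R.count k h p ω : ℝ) • (R.empRet k h p ω - G.ret h p.1 p.2.1 p.2.2) :=
    VIZero.sum_visitSet_sub (R.past k ω) (fun i h => R.ret (Fin.castLE k.isLt.le i) h ω) h p.1 p.2.1
      p.2.2 _
  have hconst : ∑ _i ∈ R.visitSet k h p ω, (l * 2) ^ 2 / 2 =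
      R.count k h p ω * ((l * 2) ^ 2 / 2) := by
    rw [Finset.sum_const, nsmul_eq_mul]
    rfl
  simp only [ite_pow, ite_div, ne_eq, OfNat.ofNat_ne_zero, not_false_eq_true, zero_pow,
    zero_div] at hsum
  rw [← Finset.smul_sum, R.sum_ite_triple_eq k h p ω
      (fun i => R.ret (Fin.castLE k.isLt.le i) h ω - G.ret h p.1 p.2.1 p.2.2),
    R.sum_ite_triple_eq k h p ω (fun _ => (l * 2) ^ 2 / 2), hret, hconst, smul_smul, norm_smul,
    Real.norm_of_nonneg (mul_pos hl hn).le, norm_sub_rev, ← le_div_iff₀' (mul_pos hl hn)] at hsum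
  refine hsum.trans_eq ?_
  field_simp

omit [IsProbabilityMeasure P] in
theorem measure_not_of_count_le (k : Fin K) (h : Fin H) (p : 𝒮 × 𝒜 × ℬ) {Q : ℕ → Ω → Prop} {c : ℝ}
    (hQ : ∀ n, P {ω | ¬ (R.count k h p ω = n → Q n ω)} ≤ ENNReal.ofReal c) :
    P {ω | ¬ Q (R.count k h p ω) ω} ≤ ENNReal.ofReal (K * c) := by
  have hunion := measure_setOf_not_forall_le P fun n : Fin K => hQ n
  rw [Fintype.card_fin] at hunion
  refine (measure_mono fun ω hω => ?_).trans hunion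
  exact fun hall => hω (hall ⟨_, R.count_lt k h p ω⟩ rfl)

theorem measure_abs_empTrans_sub_gt_sqrt_le (k : Fin K) (h : Fin H) (p : 𝒮 × 𝒜 × ℬ) {f : 𝒮 → ℝ}
    (hf : ∀ x, f x ∈ Set.Icc 0 1) {M : ℝ} (hM : 0 < M) (L : ℝ) :
    P {ω | ¬ (R.count k h p ω ≠ 0 → M ≤ R.count k h p ω →
      |∑ x, R.empTrans k h p ω x * f x - G.expNext h p f| ≤
        √(M / R.count k h p ω) * (G.expNext h p f + L / M))} ≤
      ENNReal.ofReal (K * (2 * Real.exp (-L))) := by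
  refine R.measure_not_of_count_le k h p (Q := fun n ω => n ≠ 0 → M ≤ n →
    |∑ x, R.empTrans k h p ω x * f x - G.expNext h p f| ≤
      √(M / n) * (G.expNext h p f + L / M)) fun n => ?_
  rcases le_or_gt M n with hMn | hMn
  · have hn : (0 : ℝ) < n := hM.trans_le hMn
    have hη : 0 < √(M / n) := Real.sqrt_pos.2 (by positivity)
    refine (measure_mono fun ω hω => ?_).trans (R.measure_abs_empTrans_sub_gt_le k h p hf hη
      (Real.sqrt_le_one.2 ((div_le_one hn).2 hMn)) L)
    refine fun hdev => hω fun hcount hn0 _ => ?_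
    rw [hcount] at hdev
    refine (hdev hn0).trans_eq ?_
    have hsq : M = √(M / n) * √(M / n) * n := by
      rw [Real.mul_self_sqrt (by positivity)]
      field_simp
    have hdiv : L / (√(M / n) * n) = √(M / n) * (L / M) := by
      rw [div_eq_iff (by positivity)]
      linear_combination (L / M) * hsq - mul_div_cancel₀ L hM.ne'
    rw [hdiv]
    ring
  · simp [hMn.not_ge]

theorem measure_norm_ret_sub_empRet_gt_sqrt_le (k : Fin K) (h : Fin H) (p : 𝒮 × 𝒜 × ℬ) {L : ℝ}
    (hL : 0 < L) :
    P {ω | ¬ (R.count k h p ω ≠ 0 → ‖G.ret h p.1 p.2.1 p.2.2 - R.empRet k h p ω‖ ≤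
      3 * √(L / R.count k h p ω))} ≤ ENNReal.ofReal (K * (2 * Real.exp (-L))) := by
  refine R.measure_not_of_count_le k h p (Q := fun n ω => n ≠ 0 →
    ‖G.ret h p.1 p.2.1 p.2.2 - R.empRet k h p ω‖ ≤ 3 * √(L / n)) fun n => ?_
  rcases eq_or_ne n 0 with rfl | hn0
  · simp
  have hl : 0 < √(L / n) := Real.sqrt_pos.2 (by positivity)
  refine (measure_mono fun ω hω => ?_).trans (R.measure_norm_ret_sub_empRet_gt_le k h p hl L)
  refine fun hdev => hω fun hcount hn0 => ?_
  rw [hcount] at hdev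
  refine (hdev hn0).trans_eq ?_
  have hdiv : L / (√(L / n) * n) = √(L / n) := by
    rw [div_eq_iff (by positivity), ← mul_assoc, Real.mul_self_sqrt (by positivity)]
    field_simp
  rw [hdiv]
  ring

/-- The event on which the empirical quantities are close to the true ones, and the sums of the
functions `W` at the next state to the sums of their conditional expectations. `F` is a finite
family of functions whose empirical expectations are controlled at level `L'`; the other controls
are at level `L`, and `S` is a bound on the number of states. -/
structure Good {ι : Type*} (F : ι → Fin H → 𝒮 → ℝ) (S : ℕ) (L L' : ℝ)
    (W : ∀ k : Fin K, (Fin k → Episode H 𝒮 𝒜 ℬ) → Fin H → 𝒮 → ℝ) (ω : Ω) : Prop where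
  trans : ∀ k h p x, R.count k h p ω ≠ 0 →
    |R.empTrans k h p ω x - (G.trans h p.1 p.2.1 p.2.2).1 x| ≤
      1 / (2 * H) * (G.trans h p.1 p.2.1 p.2.2).1 x + 2 * H * L / R.count k h p ω
  trans_l1 : ∀ k h p, R.count k h p ω ≠ 0 →
    ∑ x, |R.empTrans k h p ω x - (G.trans h p.1 p.2.1 p.2.2).1 x| ≤ 2 * √(S * L / R.count k h p ω)
  family : ∀ k h p i, R.count k h p ω ≠ 0 →
    |∑ x, R.empTrans k h p ω x * F i h x - G.expNext h p (F i h)| ≤ 2 * √(L' / R.count k h p ω)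
  ret : ∀ k h p, R.count k h p ω ≠ 0 →
    ‖G.ret h p.1 p.2.1 p.2.2 - R.empRet k h p ω‖ ≤ 3 * √(L / R.count k h p ω)
  next : ∀ h : Fin H,
    |∑ k, W k (R.past k ω) h ((R.episode k ω).state h.succ) -
      ∑ k, G.expNext h (R.triple k h ω) (W k (R.past k ω) h)| ≤
      1 / (2 * H) * ∑ k, G.expNext h (R.triple k h ω) (W k (R.past k ω) h) + 2 * H * L
  norm_ret_le : ∀ k h, ‖R.ret k h ω‖ ≤ 1

omit [IsProbabilityMeasure P] in
theorem measure_not_forall_triple_le {Q : Fin K → Fin H → 𝒮 × 𝒜 × ℬ → Ω → Prop} {c : ℝ}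
    (hQ : ∀ k h p, P {ω | ¬ Q k h p ω} ≤ ENNReal.ofReal c) :
    P {ω | ¬ ∀ k h p, Q k h p ω} ≤ ENNReal.ofReal
      (K * H * (Fintype.card 𝒮 * Fintype.card 𝒜 * Fintype.card ℬ) * c) := by
  have hunion := measure_setOf_not_forall_le P
    fun q : Fin K × Fin H × (𝒮 × 𝒜 × ℬ) => hQ q.1 q.2.1 q.2.2
  simp only [Prod.forall, Fintype.card_prod, Fintype.card_fin] at hunion ⊢
  refine hunion.trans_eq (congrArg _ ?_)
  push_cast
  ring

omit [IsProbabilityMeasure P] in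
theorem empTrans_mem_stdSimplex {k : Fin K} {h : Fin H} {p : 𝒮 × 𝒜 × ℬ} {ω : Ω}
    (h0 : R.count k h p ω ≠ 0) : R.empTrans k h p ω ∈ stdSimplex ℝ 𝒮 :=
  VIZero.empTrans_mem_stdSimplex h0

theorem measure_not_trans_le (L : ℝ) :
    P {ω | ¬ ∀ k h p x, R.count k h p ω ≠ 0 →
      |R.empTrans k h p ω x - (G.trans h p.1 p.2.1 p.2.2).1 x| ≤
        1 / (2 * H) * (G.trans h p.1 p.2.1 p.2.2).1 x + 2 * H * L / R.count k h p ω} ≤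
    ENNReal.ofReal (K * H * (Fintype.card 𝒮 * Fintype.card 𝒜 * Fintype.card ℬ) *
      (Fintype.card 𝒮 * (2 * Real.exp (-L)))) := by
  classical
  refine measure_not_forall_triple_le fun k h p => measure_setOf_not_forall_le P fun x => ?_
  have hH : (1 : ℝ) ≤ H := Nat.one_le_cast.2 h.pos
  refine (measure_mono fun ω hω => ?_).trans (R.measure_abs_empTrans_sub_gt_le k h p
    (f := Pi.single x 1) (fun y => ?_) (η := 1 / (2 * H)) (by positivity)
    ((div_le_one (by positivity)).2 (by linarith)) L)
  · refine fun hdev => hω fun h0 => ?_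
    have hdev := hdev h0
    simp only [VMG.expNext, Pi.single_apply, mul_ite, mul_one, mul_zero, Finset.sum_ite_eq',
      Finset.mem_univ, if_true] at hdev
    refine hdev.trans_eq ?_
    field_simp
  · rw [Pi.single_apply]
    split_ifs <;> simp

theorem measure_not_trans_l1_le {S : ℕ} (hS : 0 < S) (hcard : Fintype.card 𝒮 ≤ S) {L : ℝ}
    (hL : 0 < L) :
    P {ω | ¬ ∀ k h p, R.count k h p ω ≠ 0 →
      ∑ x, |R.empTrans k h p ω x - (G.trans h p.1 p.2.1 p.2.2).1 x| ≤
        2 * √(S * L / R.count k h p ω)} ≤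
    ENNReal.ofReal (K * H * (Fintype.card 𝒮 * Fintype.card 𝒜 * Fintype.card ℬ) *
      (Fintype.card 𝒮 * (K * (2 * Real.exp (-L))))) := by
  classical
  refine measure_not_forall_triple_le fun k h p => ?_
  have hS' : (0 : ℝ) < S := Nat.cast_pos.2 hS
  refine (measure_mono fun ω hω => ?_).trans (measure_setOf_not_forall_le P fun x : 𝒮 =>
    R.measure_abs_empTrans_sub_gt_sqrt_le k h p (f := Pi.single x 1) (fun y => ?_)
      (M := S * L) (by positivity) L)
  · refine fun hdev => hω fun h0 => ?_
    set n : ℝ := Nat.cast (R.count k h p ω)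
    have hn : 0 < n := by positivity
    simp only [VMG.expNext, Pi.single_apply, mul_ite, mul_one, mul_zero, Finset.sum_ite_eq',
      Finset.mem_univ, if_true] at hdev
    rcases le_or_gt (S * L) n with hle | hlt
    · have hfrac : (Fintype.card 𝒮 : ℝ) * (L / (S * L)) ≤ 1 := by
        rw [div_mul_cancel_right₀ hL.ne', ← div_eq_mul_inv, div_le_one hS']
        exact_mod_cast hcard
      calc ∑ x, |R.empTrans k h p ω x - (G.trans h p.1 p.2.1 p.2.2).1 x|
          ≤ ∑ x, √(S * L / n) * ((G.trans h p.1 p.2.1 p.2.2).1 x + L / (S * L)) :=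
            Finset.sum_le_sum fun x _ => hdev x h0 hle
        _ = √(S * L / n) * (1 + Fintype.card 𝒮 * (L / (S * L))) := by
            rw [← Finset.mul_sum, Finset.sum_add_distrib, (G.trans h p.1 p.2.1 p.2.2).2.2,
              Finset.sum_const, Finset.card_univ, nsmul_eq_mul]
        _ ≤ √(S * L / n) * (1 + 1) := by gcongr
        _ = 2 * √(S * L / n) := by ring
    · have hone : 1 ≤ √(S * L / n) := Real.one_le_sqrt.2 ((one_le_div hn).2 hlt.le)
      exact (sum_abs_sub_le_two_of_mem_stdSimplex (R.empTrans_mem_stdSimplex h0)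
        (G.trans h p.1 p.2.1 p.2.2).2).trans (by linarith)
  · rw [Pi.single_apply]
    split_ifs <;> simp

theorem measure_not_family_le {ι : Type*} [Fintype ι] {F : ι → Fin H → 𝒮 → ℝ}
    (hF : ∀ i h x, F i h x ∈ Set.Icc 0 1) {L : ℝ} (hL : 0 < L) :
    P {ω | ¬ ∀ k h p i, R.count k h p ω ≠ 0 →
      |∑ x, R.empTrans k h p ω x * F i h x - G.expNext h p (F i h)| ≤
        2 * √(L / R.count k h p ω)} ≤
    ENNReal.ofReal (K * H * (Fintype.card 𝒮 * Fintype.card 𝒜 * Fintype.card ℬ) *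
      (Fintype.card ι * (K * (2 * Real.exp (-L))))) := by
  refine measure_not_forall_triple_le fun k h p => measure_setOf_not_forall_le P fun i => ?_
  refine (measure_mono fun ω hω => ?_).trans
    (R.measure_abs_empTrans_sub_gt_sqrt_le k h p (hF i h) hL L)
  refine fun hdev => hω fun h0 => ?_
  set n : ℝ := Nat.cast (R.count k h p ω)
  have hn : 0 < n := by positivity
  have hmem : ∀ q : stdSimplex ℝ 𝒮, 0 ≤ ∑ x, q.1 x * F i h x ∧ ∑ x, q.1 x * F i h x ≤ 1 :=
    fun q => ⟨le_stdSimplex_sum_mul q fun x => (hF i h x).1,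
      stdSimplex_sum_mul_le q fun x => (hF i h x).2⟩
  have htrue := hmem (G.trans h p.1 p.2.1 p.2.2)
  rcases le_or_gt L n with hle | hlt
  · have hE : G.expNext h p (F i h) + L / L ≤ 2 := by
      rw [div_self hL.ne', VMG.expNext]
      linarith
    exact (hdev h0 hle).trans ((mul_le_mul_of_nonneg_left hE (Real.sqrt_nonneg _)).trans_eq
      (mul_comm _ _))
  · have hone : 1 ≤ √(L / n) := Real.one_le_sqrt.2 ((one_le_div hn).2 hlt.le)
    have hemp := hmem ⟨R.empTrans k h p ω, R.empTrans_mem_stdSimplex h0⟩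
    rw [VMG.expNext, abs_le]
    constructor <;> linarith

theorem measure_not_next_le {W : ∀ k : Fin K, (Fin k → Episode H 𝒮 𝒜 ℬ) → Fin H → 𝒮 → ℝ}
    (hW : ∀ k D h x, W k D h x ∈ Set.Icc 0 1) (L : ℝ) :
    P {ω | ¬ ∀ h : Fin H,
      |∑ k, W k (R.past k ω) h ((R.episode k ω).state h.succ) -
        ∑ k, G.expNext h (R.triple k h ω) (W k (R.past k ω) h)| ≤
        1 / (2 * H) * ∑ k, G.expNext h (R.triple k h ω) (W k (R.past k ω) h) + 2 * H * L} ≤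
    ENNReal.ofReal (H * (2 * Real.exp (-L))) := by
  have hunion := measure_setOf_not_forall_le P fun h : Fin H => by
    have hH : (1 : ℝ) ≤ H := Nat.one_le_cast.2 h.pos
    exact R.measure_abs_sum_next_sub_sum_expNext_gt_le h
      (g := fun k q x => W k q.1 h x) (fun k q x => hW k q.1 h x)
      (X := fun k ω => W k (R.past k ω) h ((R.episode k ω).state h.succ))
      (Y := fun k ω => G.expNext h (R.triple k h ω) (W k (R.past k ω) h))
      (fun _ _ => rfl) (fun _ _ => rfl) (η := 1 / (2 * H)) (by positivity)
      ((div_le_one (by positivity)).2 (by linarith)) L le_rfl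
  rw [Fintype.card_fin] at hunion
  refine (measure_mono fun ω hω => ?_).trans hunion
  refine fun hdev => hω fun h => (hdev h).trans_eq ?_
  simp only [div_div_eq_mul_div, div_one, Fin.castLE_rfl, id]
  ring

theorem measure_not_good_le {ι : Type*} [Fintype ι] {F : ι → Fin H → 𝒮 → ℝ}
    (hF : ∀ i h x, F i h x ∈ Set.Icc 0 1) {S : ℕ} (hS : 0 < S) (hcard : Fintype.card 𝒮 ≤ S)
    {L L' : ℝ} (hL : 0 < L) (hL' : 0 < L')
    {W : ∀ k : Fin K, (Fin k → Episode H 𝒮 𝒜 ℬ) → Fin H → 𝒮 → ℝ}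
    (hW : ∀ k D h x, W k D h x ∈ Set.Icc 0 1) :
    P {ω | ¬ R.Good F S L L' W ω} ≤ ENNReal.ofReal
      (2 * (K * H * (Fintype.card 𝒮 * Fintype.card 𝒜 * Fintype.card ℬ) *
        (Fintype.card 𝒮 + Fintype.card 𝒮 * K + K) + H) * Real.exp (-L) +
       2 * (K * H * (Fintype.card 𝒮 * Fintype.card 𝒜 * Fintype.card ℬ) * (Fintype.card ι * K)) *
        Real.exp (-L')) := by
  have hret := measure_not_forall_triple_le fun k h p =>
    R.measure_norm_ret_sub_empRet_gt_sqrt_le k h p hL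
  have hnorm : P {ω | ¬ ∀ k h, ‖R.ret k h ω‖ ≤ 1} = 0 :=
    ae_iff.1 (ae_all_iff.2 fun k => ae_all_iff.2 fun h => R.norm_ret_le k h)
  have hunion : ∀ {A B : Set Ω} {a b : ENNReal}, P A ≤ a → P B ≤ b → P (A ∪ B) ≤ a + b :=
    fun hA hB => (measure_union_le _ _).trans (add_le_add hA hB)
  refine (measure_mono fun ω hω => ?_).trans
    ((hunion (R.measure_not_trans_le L) (hunion (R.measure_not_trans_l1_le hS hcard hL)
      (hunion (R.measure_not_family_le hF hL') (hunion hret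
        (hunion (R.measure_not_next_le hW L) hnorm.le))))).trans ?_)
  · by_contra hcon
    simp only [Set.mem_union, Set.mem_ofPred_eq, not_or, not_not] at hcon
    obtain ⟨htrans, htrans_l1, hfamily, hret, hnext, hnorm⟩ := hcon
    exact hω ⟨htrans, htrans_l1, hfamily, hret, hnext, hnorm⟩
  · rw [add_zero, ← ENNReal.ofReal_add (by positivity) (by positivity),
      ← ENNReal.ofReal_add (by positivity) (by positivity),
      ← ENNReal.ofReal_add (by positivity) (by positivity),
      ← ENNReal.ofReal_add (by positivity) (by positivity)]
    exact ENNReal.ofReal_le_ofReal (le_of_eq (by ring))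

end ExplorationRun

namespace VIZero

variable {k d H : ℕ} {𝒮 𝒜 ℬ : Type*}

theorem norm_empRet_le {D : Fin k → Episode H 𝒮 𝒜 ℬ} {r : Fin k → Fin H → EuclideanSpace ℝ (Fin d)}
    (hr : ∀ i h, ‖r i h‖ ≤ 1) (h : Fin H) (s : 𝒮) (a : 𝒜) (b : ℬ) :
    ‖empRet D r h s a b‖ ≤ 1 := by
  have hsum : ‖∑ i ∈ visitSet D h s a b, r i h‖ ≤ visits D h s a b :=
    (norm_sum_le_of_le _ fun i _ => hr i h).trans_eq (by simp [visits])
  rw [empRet, norm_smul, norm_inv, Real.norm_natCast]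
  exact (mul_le_mul_of_nonneg_left hsum (by positivity)).trans inv_mul_le_one

variable [Fintype 𝒮]

theorem exists_isEmpiricalGame [Nonempty 𝒮] (D : Fin k → Episode H 𝒮 𝒜 ℬ)
    {r : Fin k → Fin H → EuclideanSpace ℝ (Fin d)} (hr : ∀ i h, ‖r i h‖ ≤ 1) :
    ∃ Ghat : VMG d H 𝒮 𝒜 ℬ, IsEmpiricalGame D r Ghat := by
  classical
  refine ⟨⟨fun h s a b => if hN : visits D h s a b ≠ 0 then
    ⟨empTrans D h s a b, empTrans_mem_stdSimplex hN⟩ else Classical.arbitrary _,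
    empRet D r, norm_empRet_le hr⟩, fun h s a b hN => ⟨?_, rfl⟩⟩
  simp [hN]

theorem qUpdate_mem_Icc {β : ℕ → ℝ} (hβ : ∀ t, 0 ≤ β t) (D : Fin k → Episode H 𝒮 𝒜 ℬ) (h : Fin H)
    {V : 𝒮 → ℝ} (hV : ∀ x, 0 ≤ V x) (s : 𝒮) (p : 𝒜 × ℬ) :
    qUpdate β D h V s p ∈ Set.Icc 0 (H : ℝ) := by
  rw [qUpdate]
  split_ifs
  · simp
  · have htrans : ∀ x, 0 ≤ empTrans D h s p.1 p.2 x := fun x =>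
      div_nonneg (Nat.cast_nonneg _) (Nat.cast_nonneg _)
    exact ⟨le_min (add_nonneg (Finset.sum_nonneg fun x _ => mul_nonneg (htrans x) (hV x)) (hβ _))
      (Nat.cast_nonneg _), min_le_right _ _⟩

variable [Fintype 𝒜] [Fintype ℬ] [Nonempty 𝒜] [Nonempty ℬ] (β : ℕ → ℝ)
  (D : Fin k → Episode H 𝒮 𝒜 ℬ)

@[simp]
theorem vTilde_last (s : 𝒮) : vTilde β D (Fin.last H) s = 0 := by
  simp [vTilde]

theorem vTilde_castSucc (h : Fin H) (s : 𝒮) :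
    vTilde β D h.castSucc s = Finset.univ.sup' Finset.univ_nonempty (qTilde β D h s) := by
  unfold qTilde
  simp [vTilde]

theorem qTilde_le_vTilde (h : Fin H) (s : 𝒮) (p : 𝒜 × ℬ) :
    qTilde β D h s p ≤ vTilde β D h.castSucc s := by
  rw [vTilde_castSucc]
  exact Finset.le_sup' _ (Finset.mem_univ p)

variable {β}

theorem vTilde_mem_Icc (hβ : ∀ t, 0 ≤ β t) (h : Fin (H + 1)) (s : 𝒮) :
    vTilde β D h s ∈ Set.Icc 0 (H : ℝ) := by
  induction h using Fin.reverseInduction generalizing s with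
  | last => simp
  | cast h ih =>
    rw [vTilde_castSucc]
    obtain ⟨p, -, hp⟩ := Finset.exists_mem_eq_sup' Finset.univ_nonempty (qTilde β D h s)
    rw [hp]
    exact qUpdate_mem_Icc hβ D h (fun x => (ih x).1) s p

end VIZero

section Grid

/-- The points of the grid with mesh `1 / m` in the cube `[-1, 1]ᵈ`, by which the union bound over
all `θ` in the unit ball is reduced to finitely many. -/
noncomputable def gridPoint {d : ℕ} (m : ℕ) (j : Fin d → Fin (2 * m + 1)) :
    EuclideanSpace ℝ (Fin d) :=
  WithLp.toLp 2 fun i => ((j i : ℕ) : ℝ) / m - 1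

theorem exists_abs_sub_le_inv {m : ℕ} (hm : 0 < m) {t : ℝ} (ht : |t| ≤ 1) :
    ∃ j : Fin (2 * m + 1), |t - ((j : ℕ) / m - 1)| ≤ 1 / m := by
  have hm : (0 : ℝ) < m := by exact_mod_cast hm
  obtain ⟨hlower, hupper⟩ := abs_le.1 ht
  have hfloor : ⌊(t + 1) * m⌋₊ < 2 * m + 1 := by
    rw [Nat.lt_succ_iff]
    refine Nat.floor_le_of_le ?_
    push_cast
    exact mul_le_mul_of_nonneg_right (by linarith) hm.le
  refine ⟨⟨_, hfloor⟩, ?_⟩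
  have hle := Nat.floor_le (a := (t + 1) * m) (mul_nonneg (by linarith) hm.le)
  have hlt := Nat.lt_floor_add_one ((t + 1) * m)
  have hfrac : t - ((⌊(t + 1) * m⌋₊ : ℝ) / m - 1) = ((t + 1) * m - ⌊(t + 1) * m⌋₊) / m := by
    field_simp
    ring
  rw [hfrac, abs_div, abs_of_pos hm]
  exact div_le_div_of_nonneg_right (abs_le.2 ⟨by linarith, by linarith⟩) hm.le

theorem euclideanSpace_norm_le_sum_abs {ι : Type*} [Fintype ι] (x : EuclideanSpace ℝ ι) :
    ‖x‖ ≤ ∑ i, |x i| := by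
  rw [EuclideanSpace.norm_eq]
  exact Real.sqrt_le_iff.2 ⟨Finset.sum_nonneg fun _ _ => abs_nonneg _,
    Finset.sum_sq_le_sq_sum_of_nonneg fun _ _ => abs_nonneg _⟩

theorem exists_norm_sub_gridPoint_le {d m : ℕ} (hm : 0 < m) {θ : EuclideanSpace ℝ (Fin d)}
    (hθ : ‖θ‖ ≤ 1) : ∃ j : Fin d → Fin (2 * m + 1), ‖θ - gridPoint m j‖ ≤ d / m := by
  choose j hj using fun i => exists_abs_sub_le_inv hm ((PiLp.norm_apply_le θ i).trans hθ)
  refine ⟨j, (euclideanSpace_norm_le_sum_abs _).trans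
    ((Finset.sum_le_sum fun i _ => hj i).trans_eq ?_)⟩
  simp [div_eq_mul_inv]

end Grid

section WeightedSums

variable {α : Type*} [Fintype α] {p q f : α → ℝ}

theorem abs_sum_sub_mul_le_mul {c : ℝ} (hf : ∀ x, |f x| ≤ c) :
    |∑ x, (p x - q x) * f x| ≤ (∑ x, |q x - p x|) * c := by
  rw [Finset.sum_mul]
  refine (Finset.abs_sum_le_sum_abs _ _).trans (Finset.sum_le_sum fun x _ => ?_)
  rw [abs_mul, abs_sub_comm]
  exact mul_le_mul_of_nonneg_left (hf x) (abs_nonneg _)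

theorem sum_sub_mul_affine (hp : p ∈ stdSimplex ℝ α) (hq : q ∈ stdSimplex ℝ α) (a b : ℝ) :
    ∑ x, (p x - q x) * (a * f x + b) = a * (∑ x, p x * f x - ∑ x, q x * f x) := by
  have hconst : ∑ x, (p x - q x) * b = 0 := by
    rw [← Finset.sum_mul, Finset.sum_sub_distrib, hp.2, hq.2, sub_self, zero_mul]
  simp only [mul_add, Finset.sum_add_distrib, hconst, add_zero]
  rw [← Finset.sum_sub_distrib, Finset.mul_sum]
  exact Finset.sum_congr rfl fun x _ => by ring

end WeightedSums

namespace VMG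

variable {d H : ℕ} {𝒮 𝒜 ℬ : Type*} [Fintype 𝒮] [Fintype 𝒜] [Fintype ℬ] [Nonempty 𝒜] [Nonempty ℬ]
  (G : VMG d H 𝒮 𝒜 ℬ)

theorem abs_nashValue_sub_le (θ θ' : EuclideanSpace ℝ (Fin d)) (h : Fin (H + 1)) (x : 𝒮) :
    |G.nashValue θ h x - G.nashValue θ' h x| ≤ H * ‖θ - θ'‖ :=
  (G.abs_dynProg_sub_le θ θ' (fun _ _ => isTopical_matrixValue) h x).trans
    (mul_le_mul_of_nonneg_right (sub_le_self _ (Nat.cast_nonneg _)) (norm_nonneg _))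

theorem abs_nashValue_le (θ : EuclideanSpace ℝ (Fin d)) (h : Fin (H + 1)) (x : 𝒮) :
    |G.nashValue θ h x| ≤ H * ‖θ‖ :=
  (G.abs_dynProg_le θ (fun _ _ => isTopical_matrixValue) h x).trans
    (mul_le_mul_of_nonneg_right (sub_le_self _ (Nat.cast_nonneg _)) (norm_nonneg _))

/-- The Nash values at the next step for the `θ` on the grid, scaled to the unit interval. -/
noncomputable def gridFamily (m : ℕ) (j : {j : Fin d → Fin (2 * m + 1) // ‖gridPoint m j‖ ≤ 2})
    (h : Fin H) (x : 𝒮) : ℝ :=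
  (G.nashValue (gridPoint m j.1) h.succ x + 2 * H) / (4 * H)

theorem gridFamily_mem_Icc (m : ℕ) (j : {j : Fin d → Fin (2 * m + 1) // ‖gridPoint m j‖ ≤ 2})
    (h : Fin H) (x : 𝒮) : G.gridFamily m j h x ∈ Set.Icc 0 1 := by
  have hH : (0 : ℝ) < H := by exact_mod_cast h.pos
  obtain ⟨hlower, hupper⟩ := abs_le.1 ((G.abs_nashValue_le (gridPoint m j.1) h.succ x).trans
    (mul_le_mul_of_nonneg_left j.2 hH.le))
  rw [gridFamily, Set.mem_Icc, div_le_one (by positivity)]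
  exact ⟨div_nonneg (by linarith) (by positivity), by linarith⟩

end VMG

namespace ExplorationRun

variable {K d H : ℕ} {𝒮 𝒜 ℬ : Type*} [Fintype 𝒮] [Fintype 𝒜] [Fintype ℬ]
  {alg : ExplorePlan K d H 𝒮 𝒜 ℬ} {G : VMG d H 𝒮 𝒜 ℬ} {s₁ : 𝒮}
  {Ω : Type*} {mΩ : MeasurableSpace Ω} {P : Measure Ω} {R : ExplorationRun alg G s₁ P}
  {S : ℕ} {L L' : ℝ} {W : ∀ k : Fin K, (Fin k → Episode H 𝒮 𝒜 ℬ) → Fin H → 𝒮 → ℝ} {ω : Ω}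
  {ι : Type*} {F : ι → Fin H → 𝒮 → ℝ} {k : Fin K} {h : Fin H} {p : 𝒮 × 𝒜 × ℬ}

theorem Good.abs_trans_sub_le (hg : R.Good F S L L' W ω) (hN : R.count k h p ω ≠ 0) (x : 𝒮) :
    |(G.trans h p.1 p.2.1 p.2.2).1 x - R.empTrans k h p ω x| ≤
      1 / H * R.empTrans k h p ω x + 4 * H * L / R.count k h p ω := by
  have hH : (1 : ℝ) ≤ H := by exact_mod_cast h.pos
  have hdev := hg.trans k h p x hN
  rw [abs_sub_comm]
  set e := R.empTrans k h p ω x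
  set q := (G.trans h p.1 p.2.1 p.2.2).1 x
  set η : ℝ := 1 / (2 * H) with hη
  have hη0 : 0 ≤ η := by positivity
  have hη1 : η ≤ 1 / 2 := one_div_le_one_div_of_le two_pos (by linarith)
  have hηH : 1 / (H : ℝ) = 2 * η := by
    rw [hη]
    field_simp
  have hq : η * q ≤ η * e + 1 / 2 * |e - q| := by
    have hle : q ≤ e + |e - q| := by linarith [neg_abs_le (e - q)]
    have hhalf := mul_le_mul_of_nonneg_right hη1 (abs_nonneg (e - q))
    linarith [mul_le_mul_of_nonneg_left hle hη0]
  have hconst : 4 * H * L / R.count k h p ω = 2 * (2 * H * L / R.count k h p ω) := by ring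
  rw [hηH, hconst]
  linarith

theorem Good.abs_sum_le (hg : R.Good F S L L' W ω) (hN : R.count k h p ω ≠ 0) {f : 𝒮 → ℝ} {c : ℝ}
    (hc : 0 ≤ c) (hf : ∀ x, |f x| ≤ c) :
    |∑ x, ((G.trans h p.1 p.2.1 p.2.2).1 x - R.empTrans k h p ω x) * f x| ≤
      2 * c * √(S * L / R.count k h p ω) :=
  (abs_sum_sub_mul_le_mul hf).trans
    ((mul_le_mul_of_nonneg_right (hg.trans_l1 k h p hN) hc).trans_eq (by ring))

variable [Nonempty 𝒜] [Nonempty ℬ]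

variable (R) in
theorem qTilde_past (β : ℕ → ℝ) (k : Fin K) (h : Fin H) (p : 𝒮 × 𝒜 × ℬ) (ω : Ω) :
    VIZero.qTilde β (R.past k ω) h p.1 p.2 = if R.count k h p ω = 0 then (H : ℝ) else
      min (∑ x, R.empTrans k h p ω x * VIZero.vTilde β (R.past k ω) h.succ x +
        β (R.count k h p ω)) H :=
  rfl

theorem Good.abs_sum_nashValue_gridPoint_le {m : ℕ} (hg : R.Good (G.gridFamily m) S L L' W ω)
    (hN : R.count k h p ω ≠ 0) (j : {j : Fin d → Fin (2 * m + 1) // ‖gridPoint m j‖ ≤ 2}) :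
    |∑ x, ((G.trans h p.1 p.2.1 p.2.2).1 x - R.empTrans k h p ω x) *
      G.nashValue (gridPoint m j.1) h.succ x| ≤ 8 * H * √(L' / R.count k h p ω) := by
  have hH : (0 : ℝ) < H := by exact_mod_cast h.pos
  have haffine : ∀ x, G.nashValue (gridPoint m j.1) h.succ x =
      4 * H * G.gridFamily m j h x + -(2 * H) := fun x => by
    rw [VMG.gridFamily]
    field_simp
    ring
  simp only [haffine]
  rw [sum_sub_mul_affine (G.trans h _ _ _).2 (R.empTrans_mem_stdSimplex hN), abs_mul,
    abs_sub_comm, abs_of_pos (by positivity)]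
  exact (mul_le_mul_of_nonneg_left (hg.family k h p j hN) (by positivity)).trans_eq (by ring)

theorem Good.abs_sum_nashValue_le (hg : R.Good (G.gridFamily (d * K)) S L L' W ω) (hd : 0 < d)
    {θ : EuclideanSpace ℝ (Fin d)} (hθ : ‖θ‖ ≤ 1) (hN : R.count k h p ω ≠ 0) :
    |∑ x, ((G.trans h p.1 p.2.1 p.2.2).1 x - R.empTrans k h p ω x) * G.nashValue θ h.succ x| ≤
      8 * H * √(L' / R.count k h p ω) + 2 * H / K := by
  have hK : (1 : ℝ) ≤ K := by exact_mod_cast k.pos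
  obtain ⟨j, hj⟩ : ∃ j, ‖θ - gridPoint (d * K) j‖ ≤ 1 / K := by
    have hmesh : (d : ℝ) / (d * K : ℕ) = 1 / K := by
      push_cast
      field_simp
    exact hmesh ▸ exists_norm_sub_gridPoint_le (Nat.mul_pos hd k.pos) hθ
  have hj2 : ‖gridPoint (d * K) j‖ ≤ 2 := by
    have htri := norm_le_norm_add_norm_sub θ (gridPoint (d * K) j)
    linarith [(div_le_one (by linarith)).2 hK]
  have hgrid := hg.abs_sum_nashValue_gridPoint_le hN ⟨j, hj2⟩
  have hdiff : ∀ x, |G.nashValue θ h.succ x - G.nashValue (gridPoint (d * K) j) h.succ x| ≤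
      H / K := fun x => (G.abs_nashValue_sub_le _ _ _ _).trans
    ((mul_le_mul_of_nonneg_left hj (Nat.cast_nonneg _)).trans_eq (mul_one_div _ _))
  have happrox := (abs_sum_sub_mul_le_mul (p := (G.trans h p.1 p.2.1 p.2.2).1)
    (q := R.empTrans k h p ω) hdiff).trans (mul_le_mul_of_nonneg_right
      (sum_abs_sub_le_two_of_mem_stdSimplex (R.empTrans_mem_stdSimplex hN) (G.trans h _ _ _).2)
      (by positivity))
  rw [← mul_div_assoc] at happrox
  refine le_of_eq_of_le (congrArg _ ?_) ((abs_add_le _ _).trans (add_le_add hgrid happrox))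
  rw [← Finset.sum_add_distrib]
  exact Finset.sum_congr rfl fun _ _ => by ring

theorem Good.isErrorBound (hg : R.Good (G.gridFamily (d * K)) S L L' W ω) (hL : 0 ≤ L) (hd : 0 < d)
    (hS : Fintype.card 𝒮 ≤ S) {θ : EuclideanSpace ℝ (Fin d)} (hθ : ‖θ‖ ≤ 1) {β : ℕ → ℝ}
    (hβ : ∀ n : ℕ, n ≠ 0 → n < K → 3 * √(L / n) +
      min (8 * H * √(L' / n) + 2 * H / K) (2 * H * √(S * L / n)) + S * (4 * H * L / n) * (2 * H) ≤
      β n)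
    {Ghat : VMG d H 𝒮 𝒜 ℬ}
    (hG : VIZero.IsEmpiricalGame (R.past k ω)
      (fun i h => R.ret (Fin.castLE k.isLt.le i) h ω) Ghat) :
    VMG.IsErrorBound G Ghat (G.nashValue θ) (VIZero.vTilde β (R.past k ω)) := by
  intro h s a b
  have hle := VIZero.qTilde_le_vTilde β (R.past k ω) h s (a, b)
  rw [R.qTilde_past β k h (s, a, b) ω] at hle
  rcases eq_or_ne (R.count k h (s, a, b) ω) 0 with hN | hN
  · exact .inl (by rwa [if_pos hN] at hle)
  rw [if_neg hN] at hle
  obtain ⟨htrans, hret⟩ := hG h s a b hN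
  rw [htrans, hret]
  have hnash : ∀ x, |G.nashValue θ h.succ x| ≤ H := fun x =>
    (G.abs_nashValue_le θ _ x).trans (mul_le_of_le_one_right (Nat.cast_nonneg _) hθ)
  refine .inr ⟨_, _, 4 * H * L / R.count k h (s, a, b) ω, by positivity,
    hg.ret k h (s, a, b) hN,
    le_min (hg.abs_sum_nashValue_le hd hθ hN) (hg.abs_sum_le hN (Nat.cast_nonneg _) hnash),
    hg.abs_trans_sub_le hN, hle.trans' (min_le_min (add_le_add le_rfl ?_) le_rfl)⟩
  refine (hβ _ hN (R.count_lt k h _ ω)).trans' ?_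
  have hS : (Fintype.card 𝒮 : ℝ) ≤ S := by exact_mod_cast hS
  gcongr

end ExplorationRun

section Pigeonhole

theorem sum_card_filter_lt {α M : Type*} [LinearOrder α] [AddCommMonoid M] (s : Finset α)
    (b : ℕ → M) : ∑ k ∈ s, b {i ∈ s | i < k}.card = ∑ j ∈ Finset.range s.card, b j := by
  induction s using Finset.induction_on_max with
  | empty => simp
  | insert a s ha ih =>
    have ha_notMem : a ∉ s := fun h => (ha a h).false
    have hlast : {i ∈ insert a s | i < a} = s := by
      rw [Finset.filter_insert, if_neg (lt_irrefl a), Finset.filter_true_of_mem ha]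
    have hrest : ∀ k ∈ s, {i ∈ insert a s | i < k} = {i ∈ s | i < k} := fun k hk => by
      rw [Finset.filter_insert, if_neg (ha k hk).not_gt]
    rw [Finset.sum_insert ha_notMem, Finset.card_insert_of_notMem ha_notMem,
      Finset.sum_range_succ, ← ih, hlast, add_comm]
    exact congrArg (· + _) (Finset.sum_congr rfl fun k hk => by rw [hrest k hk])

theorem sum_card_filter_lt_and_eq {κ α M : Type*} [Fintype κ] [LinearOrder κ] [Fintype α]
    [DecidableEq α] [AddCommMonoid M] (x : κ → α) (b : ℕ → M) :
    ∑ k, b (Finset.card {i | i < k ∧ x i = x k}) =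
      ∑ p, ∑ j ∈ Finset.range (Finset.card {i | x i = p}), b j := by
  rw [← Finset.sum_fiberwise _ x]
  refine Finset.sum_congr rfl fun p _ => ?_
  rw [← sum_card_filter_lt]
  refine Finset.sum_congr rfl fun k hk => ?_
  rw [(Finset.mem_filter.1 hk).2, Finset.filter_filter]
  simp only [and_comm]

theorem sum_range_inv_sqrt_le (n : ℕ) : ∑ j ∈ Finset.range n, 1 / √((j : ℝ) + 1) ≤ 2 * √n := by
  induction n with
  | zero => simp
  | succ n ih =>
    have hpos : 0 < √((n : ℝ) + 1) := Real.sqrt_pos.2 (by positivity)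
    have hsq : √((n : ℝ) + 1) ^ 2 = √(n : ℝ) ^ 2 + 1 := by
      rw [Real.sq_sqrt (by positivity), Real.sq_sqrt (by positivity)]
    have hincrement : 1 / √((n : ℝ) + 1) ≤ 2 * √((n : ℝ) + 1) - 2 * √n := by
      rw [div_le_iff₀ hpos]
      nlinarith [sq_nonneg (√((n : ℝ) + 1) - √n)]
    rw [Finset.sum_range_succ, Nat.cast_succ]
    linarith

theorem sum_range_inv_le_one_add_log (n : ℕ) :
    ∑ j ∈ Finset.range n, 1 / ((j : ℝ) + 1) ≤ 1 + Real.log n := by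
  simpa [harmonic, one_div] using harmonic_le_one_add_log n

variable {b : ℕ → ℝ} {a c : ℝ}

theorem sum_range_le_of_le_div_sqrt_add_div (ha : 0 ≤ a) (hc : 0 ≤ c) (h0 : 0 ≤ b 0)
    (hb : ∀ n, n ≠ 0 → b n ≤ a / √n + c / n) (n : ℕ) :
    ∑ j ∈ Finset.range n, b j ≤ b 0 + 2 * a * √n + c * (1 + Real.log n) := by
  have hmajorant : ∑ j ∈ Finset.range n, (a / √((j : ℝ) + 1) + c / ((j : ℝ) + 1)) ≤
      2 * a * √n + c * (1 + Real.log n) := by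
    simp only [← mul_one_div a, ← mul_one_div c, Finset.sum_add_distrib, ← Finset.mul_sum]
    linarith [mul_le_mul_of_nonneg_left (sum_range_inv_sqrt_le n) ha,
      mul_le_mul_of_nonneg_left (sum_range_inv_le_one_add_log n) hc]
  suffices ∑ j ∈ Finset.range n, b j ≤
      b 0 + ∑ j ∈ Finset.range n, (a / √((j : ℝ) + 1) + c / ((j : ℝ) + 1)) by linarith
  rcases n with _ | n
  · simpa using h0
  rw [Finset.sum_range_succ', Finset.sum_range_succ, add_comm (b 0)]
  refine add_le_add (le_add_of_le_of_nonneg (Finset.sum_le_sum fun j _ => ?_) (by positivity))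
    le_rfl
  exact_mod_cast hb (j + 1) j.succ_ne_zero

theorem sum_card_lt_bonus_le {K : ℕ} {α : Type*} [Fintype α] [DecidableEq α] (x : Fin K → α)
    (ha : 0 ≤ a) (hc : 0 ≤ c) (h0 : 0 ≤ b 0) (hb : ∀ n, n ≠ 0 → b n ≤ a / √n + c / n) :
    ∑ k, b (Finset.card {i | i < k ∧ x i = x k}) ≤
      Fintype.card α * (b 0 + c * (1 + Real.log K)) + 2 * a * √(Fintype.card α * K) := by
  set n : α → ℕ := fun p => Finset.card {i | x i = p}
  have hfiber : ∀ p, ∑ j ∈ Finset.range (n p), b j ≤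
      (b 0 + c * (1 + Real.log K)) + 2 * a * √(n p) := fun p => by
    have hlog : Real.log (n p) ≤ Real.log K := by
      rcases Nat.eq_zero_or_pos (n p) with hp | hp
      · simpa [hp] using Real.log_natCast_nonneg K
      · exact Real.log_le_log (by exact_mod_cast hp)
          (by exact_mod_cast (Finset.card_le_univ _).trans_eq (Fintype.card_fin K))
    linarith [sum_range_le_of_le_div_sqrt_add_div ha hc h0 hb (n p),
      mul_le_mul_of_nonneg_left hlog hc]
  have htotal : ∑ p, n p = K := by
    rw [← Finset.card_eq_sum_card_fiberwise fun _ _ => Finset.mem_coe.2 (Finset.mem_univ _),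
      Finset.card_univ, Fintype.card_fin]
  have hcauchy : ∑ p, √(n p : ℝ) ≤ √(Fintype.card α * K) := by
    refine Real.le_sqrt_of_sq_le (sq_sum_le_card_mul_sum_sq.trans_eq ?_)
    simp only [Real.sq_sqrt (Nat.cast_nonneg _), ← Nat.cast_sum, htotal, Finset.card_univ]
  rw [sum_card_filter_lt_and_eq]
  refine (Finset.sum_le_sum fun p _ => hfiber p).trans ?_
  rw [Finset.sum_add_distrib, Finset.sum_const, Finset.card_univ, nsmul_eq_mul, ← Finset.mul_sum]
  exact add_le_add le_rfl (mul_le_mul_of_nonneg_left hcauchy (by positivity))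

end Pigeonhole

theorem le_of_backward_recursion {H : ℕ} {v : Fin (H + 1) → ℝ} {y B : ℝ} (hy : 1 ≤ y) (hB : 0 ≤ B)
    (hlast : v (Fin.last H) ≤ 0) (hstep : ∀ h : Fin H, v h.castSucc ≤ y * v h.succ + B)
    (h : Fin (H + 1)) : v h ≤ (H - (h : ℕ) : ℕ) * (y ^ (H - (h : ℕ)) * B) := by
  induction h using Fin.reverseInduction with
  | last => simpa using hlast
  | cast h ih =>
    have hsub : H - (h.castSucc : ℕ) = (H - (h.succ : ℕ)) + 1 := by
      have := h.isLt
      simp only [Fin.val_succ, Fin.val_castSucc]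
      omega
    rw [hsub]
    set n := H - (h.succ : ℕ)
    calc v h.castSucc ≤ y * v h.succ + B := hstep h
      _ ≤ y * (n * (y ^ n * B)) + y ^ (n + 1) * B :=
        add_le_add (mul_le_mul_of_nonneg_left ih (by linarith))
          (le_mul_of_one_le_left hB (one_le_pow₀ hy))
      _ = _ := by push_cast; ring

theorem le_one_add_two_mul_of_le_add_mul {C v η : ℝ} (hC : 0 ≤ C) (hη0 : 0 ≤ η) (hη1 : η ≤ 1 / 2)
    (h : C ≤ v + η * C) : C ≤ (1 + 2 * η) * v := by
  have hmul : (1 + 2 * η) * (C - η * C) ≤ (1 + 2 * η) * v :=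
    mul_le_mul_of_nonneg_left (by linarith) (by linarith)
  nlinarith [mul_nonneg (mul_nonneg hη0 hC) (show 0 ≤ 1 - 2 * η by linarith)]

namespace VIZero

variable {k H : ℕ} {𝒮 𝒜 ℬ : Type*} [Fintype 𝒮] [Fintype 𝒜] [Fintype ℬ] [Nonempty 𝒜] [Nonempty ℬ]

/-- The uncertainty at the next state, scaled to the unit interval. -/
noncomputable def scaledUncertainty (β : ℕ → ℝ) (D : Fin k → Episode H 𝒮 𝒜 ℬ) (h : Fin H)
    (x : 𝒮) : ℝ :=
  vTilde β D h.succ x / H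

theorem scaledUncertainty_mem_Icc {β : ℕ → ℝ} (hβ : ∀ t, 0 ≤ β t) (D : Fin k → Episode H 𝒮 𝒜 ℬ)
    (h : Fin H) (x : 𝒮) : scaledUncertainty β D h x ∈ Set.Icc 0 1 := by
  have hH : (0 : ℝ) < H := by exact_mod_cast h.pos
  obtain ⟨hlower, hupper⟩ := vTilde_mem_Icc D hβ h.succ x
  exact ⟨div_nonneg hlower hH.le, (div_le_one hH).2 hupper⟩

end VIZero

namespace ExplorationRun

variable {K d H : ℕ} {𝒮 𝒜 ℬ : Type*} [Fintype 𝒮] [Fintype 𝒜] [Fintype ℬ]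
  {G : VMG d H 𝒮 𝒜 ℬ} {s₁ : 𝒮} {Ω : Type*} {mΩ : MeasurableSpace Ω} {P : Measure Ω}

section

variable {alg : ExplorePlan K d H 𝒮 𝒜 ℬ} (R : ExplorationRun alg G s₁ P)

open Classical in
theorem count_eq_card_lt (k : Fin K) (h : Fin H) (p : 𝒮 × 𝒜 × ℬ) (ω : Ω) :
    R.count k h p ω = Finset.card {i : Fin K | i < k ∧ R.triple i h ω = p} := by
  change (R.visitSet k h p ω).card = _
  refine Finset.card_bij (fun i _ => Fin.castLE k.isLt.le i) (fun i hi => ?_)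
    (fun i _ j _ hij => Fin.castLE_injective _ hij) fun i hi => ?_
  · exact Finset.mem_filter.2 ⟨Finset.mem_univ _, i.isLt, R.mem_visitSet.1 hi⟩
  · obtain ⟨hik, hip⟩ := (Finset.mem_filter.1 hi).2
    exact ⟨⟨i, hik⟩, R.mem_visitSet.2 hip, rfl⟩

theorem sum_bonus_le {b : ℕ → ℝ} {a c M : ℝ} (ha : 0 ≤ a) (hc : 0 ≤ c) (h0 : 0 ≤ b 0)
    (hb : ∀ n, n ≠ 0 → b n ≤ a / √n + c / n) (hM : Fintype.card (𝒮 × 𝒜 × ℬ) ≤ M) (h : Fin H)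
    (ω : Ω) :
    ∑ k, b (R.count k h (R.triple k h ω) ω) ≤
      M * (b 0 + c * (1 + Real.log K)) + 2 * a * √(M * K) := by
  classical
  have hfactor : 0 ≤ b 0 + c * (1 + Real.log K) :=
    add_nonneg h0 (mul_nonneg hc (add_nonneg zero_le_one (Real.log_natCast_nonneg K)))
  simp only [count_eq_card_lt]
  refine (sum_card_lt_bonus_le (fun k => R.triple k h ω) ha hc h0 hb).trans ?_
  exact add_le_add (mul_le_mul_of_nonneg_right hM hfactor) (by gcongr)

variable {R} {S : ℕ} {L L' : ℝ} {ω : Ω} {ι : Type*} {F : ι → Fin H → 𝒮 → ℝ}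
  {W : ∀ k : Fin K, (Fin k → Episode H 𝒮 𝒜 ℬ) → Fin H → 𝒮 → ℝ}

theorem Good.sum_empTrans_mul_le (hg : R.Good F S L L' W ω) (hL : 0 ≤ L) {k : Fin K} {h : Fin H}
    {p : 𝒮 × 𝒜 × ℬ} (hN : R.count k h p ω ≠ 0) {f : 𝒮 → ℝ} {c : ℝ}
    (hf : ∀ x, f x ∈ Set.Icc 0 c) :
    ∑ x, R.empTrans k h p ω x * f x ≤
      (1 + 1 / (2 * H)) * G.expNext h p f +
        Fintype.card 𝒮 * (2 * H * L / R.count k h p ω) * c := by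
  calc ∑ x, R.empTrans k h p ω x * f x
    _ ≤ ∑ x, ((1 + 1 / (2 * H)) * ((G.trans h p.1 p.2.1 p.2.2).1 x * f x) +
        2 * H * L / R.count k h p ω * c) := Finset.sum_le_sum fun x _ => by
      have hdev := (abs_le.1 (hg.trans k h p x hN)).2
      have hmul := mul_le_mul_of_nonneg_right (sub_le_iff_le_add.1 hdev) (hf x).1
      have hcap : 2 * H * L / R.count k h p ω * f x ≤ 2 * H * L / R.count k h p ω * c :=
        mul_le_mul_of_nonneg_left (hf x).2 (by positivity)
      linarith
    _ = _ := by
      rw [Finset.sum_add_distrib, ← Finset.mul_sum, Finset.sum_const, Finset.card_univ,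
        nsmul_eq_mul, ← mul_assoc, VMG.expNext]

end

variable [Nonempty 𝒜] [Nonempty ℬ] {β : ℕ → ℝ} {sel : ℕ → Fin H → 𝒮 → (𝒜 × ℬ → ℝ) → 𝒜 × ℬ}

theorem vTilde_state_le_qTilde (R : ExplorationRun (VIZero.algorithm K β s₁ sel) G s₁ P)
    (hsel : ∀ k h s (f : 𝒜 × ℬ → ℝ) p, f p ≤ f (sel k h s f)) (k : Fin K) (h : Fin H) (ω : Ω) :
    VIZero.vTilde β (R.past k ω) h.castSucc ((R.episode k ω).state h.castSucc) ≤
      VIZero.qTilde β (R.past k ω) h (R.triple k h ω).1 (R.triple k h ω).2 := by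
  have hact : (R.triple k h ω).2 =
      sel k h (R.triple k h ω).1 (VIZero.qTilde β (R.past k ω) h (R.triple k h ω).1) :=
    R.act_eq k h ω
  rw [VIZero.vTilde_castSucc, hact]
  exact Finset.sup'_le _ _ fun q _ => hsel k h _ _ q

/-- The sum over the episodes of the uncertainty at the state visited in step `h`. -/
noncomputable def totalUncertainty {alg : ExplorePlan K d H 𝒮 𝒜 ℬ} (R : ExplorationRun alg G s₁ P)
    (β : ℕ → ℝ) (ω : Ω) (h : Fin (H + 1)) : ℝ :=
  ∑ k, VIZero.vTilde β (R.past k ω) h ((R.episode k ω).state h)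

section

variable {S : ℕ} {L L' : ℝ} {ω : Ω} {ι : Type*} {F : ι → Fin H → 𝒮 → ℝ}

theorem Good.sum_expNext_vTilde_le {alg : ExplorePlan K d H 𝒮 𝒜 ℬ} {R : ExplorationRun alg G s₁ P}
    (hg : R.Good F S L L' (fun _ => VIZero.scaledUncertainty β) ω) (hβ0 : ∀ t, 0 ≤ β t)
    (h : Fin H) :
    ∑ k, G.expNext h (R.triple k h ω) (VIZero.vTilde β (R.past k ω) h.succ) ≤
      (1 + 1 / (H : ℝ)) * (R.totalUncertainty β ω h.succ + 2 * H ^ 2 * L) := by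
  have hH : (1 : ℝ) ≤ H := by exact_mod_cast h.pos
  set C : ℝ := ∑ k, G.expNext h (R.triple k h ω) (VIZero.vTilde β (R.past k ω) h.succ) with hC
  have hC0 : 0 ≤ C := Finset.sum_nonneg fun k _ => Finset.sum_nonneg fun x _ =>
    mul_nonneg ((G.trans h _ _ _).2.1 x) (VIZero.vTilde_mem_Icc _ hβ0 _ _).1
  have hscaled : ∑ k, VIZero.scaledUncertainty β (R.past k ω) h ((R.episode k ω).state h.succ) =
      R.totalUncertainty β ω h.succ / H := by
    simp only [VIZero.scaledUncertainty, totalUncertainty, Finset.sum_div]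
  have hscaledC : ∑ k, G.expNext h (R.triple k h ω)
      (VIZero.scaledUncertainty β (R.past k ω) h) = C / H := by
    simp only [hC, VMG.expNext, VIZero.scaledUncertainty, Finset.sum_div, mul_div_assoc]
  have hdev := (abs_le.1 (hg.next h)).1
  rw [hscaled, hscaledC] at hdev
  have hself : C ≤ R.totalUncertainty β ω h.succ + 2 * H ^ 2 * L + 1 / (2 * H) * C := by
    have hmul := mul_le_mul_of_nonneg_left hdev (zero_le_one.trans hH)
    field_simp at hmul ⊢
    linarith
  have hη : 1 / (2 * (H : ℝ)) ≤ 1 / 2 := one_div_le_one_div_of_le two_pos (by linarith)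
  refine (le_one_add_two_mul_of_le_add_mul hC0 (by positivity) hη hself).trans_eq ?_
  field_simp

variable {R : ExplorationRun (VIZero.algorithm K β s₁ sel) G s₁ P}

theorem Good.vTilde_le {W : ∀ k : Fin K, (Fin k → Episode H 𝒮 𝒜 ℬ) → Fin H → 𝒮 → ℝ}
    (hg : R.Good F S L L' W ω) (hsel : ∀ k h s (f : 𝒜 × ℬ → ℝ) p, f p ≤ f (sel k h s f))
    (hL : 0 ≤ L) (hS : Fintype.card 𝒮 ≤ S) (hβ0 : ∀ t, 0 ≤ β t)
    (hβ : ∀ n : ℕ, n ≠ 0 → n < K → S * (2 * H * L / n) * H ≤ β n) (k : Fin K) (h : Fin H) :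
    VIZero.vTilde β (R.past k ω) h.castSucc ((R.episode k ω).state h.castSucc) ≤
      (1 + 1 / (2 * H)) * G.expNext h (R.triple k h ω) (VIZero.vTilde β (R.past k ω) h.succ) +
      if R.count k h (R.triple k h ω) ω = 0 then (H : ℝ)
        else 2 * β (R.count k h (R.triple k h ω) ω) := by
  refine (R.vTilde_state_le_qTilde hsel k h ω).trans ?_
  rw [R.qTilde_past]
  have hw := VIZero.vTilde_mem_Icc (R.past k ω) hβ0 h.succ
  have hE0 : 0 ≤ G.expNext h (R.triple k h ω) (VIZero.vTilde β (R.past k ω) h.succ) :=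
    Finset.sum_nonneg fun x _ => mul_nonneg ((G.trans h _ _ _).2.1 x) (hw x).1
  split_ifs with hN
  · exact le_add_of_nonneg_left (by positivity)
  refine (min_le_left _ _).trans ?_
  have hbonus : Fintype.card 𝒮 * (2 * H * L / R.count k h (R.triple k h ω) ω) * H ≤
      β (R.count k h (R.triple k h ω) ω) := by
    have hS : (Fintype.card 𝒮 : ℝ) ≤ S := by exact_mod_cast hS
    refine (hβ _ hN (R.count_lt k h _ ω)).trans' ?_
    gcongr
  linarith [hg.sum_empTrans_mul_le hL hN hw]

variable (hg : R.Good F S L L' (fun _ => VIZero.scaledUncertainty β) ω)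
  (hsel : ∀ k h s (f : 𝒜 × ℬ → ℝ) p, f p ≤ f (sel k h s f)) (hL : 0 ≤ L)
  (hS : Fintype.card 𝒮 ≤ S) (hβ0 : ∀ t, 0 ≤ β t)
  (hβ : ∀ n : ℕ, n ≠ 0 → n < K → S * (2 * H * L / n) * H ≤ β n)
  {a c M : ℝ} (ha : 0 ≤ a) (hc : 0 ≤ c) (hβac : ∀ n : ℕ, n ≠ 0 → β n ≤ a / √n + c / n)
  (hM : Fintype.card (𝒮 × 𝒜 × ℬ) ≤ M)

include hg hsel hL hS hβ0 hβ ha hc hβac hM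

theorem Good.totalUncertainty_castSucc_le (h : Fin H) :
    R.totalUncertainty β ω h.castSucc ≤
      (1 + 1 / (H : ℝ)) ^ 2 * R.totalUncertainty β ω h.succ +
        (M * (H + 2 * c * (1 + Real.log K)) + 4 * a * √(M * K) + 8 * H ^ 2 * L) := by
  have hH : (1 : ℝ) ≤ H := by exact_mod_cast h.pos
  set C : ℝ := ∑ k, G.expNext h (R.triple k h ω) (VIZero.vTilde β (R.past k ω) h.succ)
  have hone_step : R.totalUncertainty β ω h.castSucc ≤ (1 + 1 / (2 * H)) * C +
      ∑ k, if R.count k h (R.triple k h ω) ω = 0 then (H : ℝ)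
        else 2 * β (R.count k h (R.triple k h ω) ω) := by
    rw [Finset.mul_sum, ← Finset.sum_add_distrib]
    exact Finset.sum_le_sum fun k _ => hg.vTilde_le hsel hL hS hβ0 hβ k h
  have hbonus := R.sum_bonus_le (b := fun n => if n = 0 then (H : ℝ) else 2 * β n)
    (a := 2 * a) (c := 2 * c) (by positivity) (by positivity) (by simp)
    (fun n hn => by
      rw [if_neg hn, mul_div_assoc, mul_div_assoc, ← mul_add]
      exact mul_le_mul_of_nonneg_left (hβac n hn) zero_le_two) hM h ω
  rw [if_pos rfl] at hbonus
  have htransition : (1 + 1 / (2 * H)) * C ≤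
      (1 + 1 / (H : ℝ)) ^ 2 * (R.totalUncertainty β ω h.succ + 2 * H ^ 2 * L) := by
    have hC0 : 0 ≤ C := Finset.sum_nonneg fun k _ => Finset.sum_nonneg fun x _ =>
      mul_nonneg ((G.trans h _ _ _).2.1 x) (VIZero.vTilde_mem_Icc _ hβ0 _ _).1
    have hη : 1 / (2 * (H : ℝ)) ≤ 1 / H := one_div_le_one_div_of_le (by positivity) (by linarith)
    rw [sq, mul_assoc]
    gcongr
    exact hg.sum_expNext_vTilde_le hβ0 h
  have hsq : (1 + 1 / (H : ℝ)) ^ 2 * (2 * H ^ 2 * L) ≤ 2 ^ 2 * (2 * H ^ 2 * L) := by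
    have hη : 1 + 1 / (H : ℝ) ≤ 2 := by linarith [(div_le_one (zero_lt_one.trans_le hH)).2 hH]
    gcongr
  linarith

theorem Good.sum_vTilde_le :
    ∑ k, VIZero.vTilde β (R.past k ω) 0 s₁ ≤
      8 * H * (M * (H + 2 * c * (1 + Real.log K)) + 4 * a * √(M * K) + 8 * H ^ 2 * L) := by
  set B := M * (H + 2 * c * (1 + Real.log K)) + 4 * a * √(M * K) + 8 * (H : ℝ) ^ 2 * L
  have hB : 0 ≤ B := by
    have hM0 : 0 ≤ M := (Nat.cast_nonneg _).trans hM
    have hlog : 0 ≤ 1 + Real.log K := add_nonneg zero_le_one (Real.log_natCast_nonneg K)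
    have hbonus := mul_nonneg hM0
      (add_nonneg H.cast_nonneg (mul_nonneg (mul_nonneg zero_le_two hc) hlog))
    exact add_nonneg (add_nonneg hbonus (by positivity)) (by positivity)
  have hlast : R.totalUncertainty β ω (Fin.last H) ≤ 0 := by simp [totalUncertainty]
  have hrec := le_of_backward_recursion (one_le_pow₀ (le_add_of_nonneg_right (by positivity)))
    hB hlast (hg.totalUncertainty_castSucc_le hsel hL hS hβ0 hβ ha hc hβac hM) 0
  simp only [totalUncertainty, R.state_zero, Fin.val_zero, Nat.sub_zero] at hrec
  have hpow : ((1 + 1 / (H : ℝ)) ^ 2) ^ H ≤ 8 := by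
    rw [pow_right_comm]
    have hexp := (VMG.one_add_inv_pow_le_exp H).trans Real.exp_one_lt_d9.le
    nlinarith [show 0 ≤ (1 + 1 / (H : ℝ)) ^ H by positivity]
  calc _ ≤ H * (((1 + 1 / (H : ℝ)) ^ 2) ^ H * B) := hrec
    _ ≤ H * (8 * B) :=
      mul_le_mul_of_nonneg_left (mul_le_mul_of_nonneg_right hpow hB) H.cast_nonneg
    _ = 8 * H * B := by ring

end

end ExplorationRun

section Numerics

theorem two_mul_mul_exp_neg_log_le {N X : ℝ} (hX : 2 ≤ X) (hN : N ≤ 4 * X ^ 2) :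
    2 * N * Real.exp (-(10 * Real.log X)) ≤ 1 / (2 * X) := by
  have hX0 : 0 < X := by linarith
  have hexp : Real.exp (-(10 * Real.log X)) = 1 / X ^ 10 := by
    rw [Real.exp_neg, one_div, mul_comm, ← Real.rpow_def_of_pos hX0]
    exact_mod_cast rfl
  have hX7 : 2 ^ 7 ≤ X ^ 7 := pow_le_pow_left₀ zero_le_two hX 7
  calc 2 * N * Real.exp (-(10 * Real.log X)) ≤ 2 * (4 * X ^ 2) * (1 / X ^ 10) := by
        rw [hexp]; gcongr
    _ = 8 / X ^ 7 * (1 / X) := by field_simp; norm_num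
    _ ≤ 1 / 2 * (1 / X) := mul_le_mul_of_nonneg_right
        ((div_le_iff₀ (by positivity)).2 (by linarith)) (by positivity)
    _ = 1 / (2 * X) := by field_simp

theorem two_mul_mul_exp_neg_mul_log_le {d : ℕ} {N X : ℝ} (hd : d ≠ 0) (hX : 2 ≤ X)
    (hN : N ≤ X ^ 2 * (3 * X) ^ d) :
    2 * N * Real.exp (-(10 * (d * Real.log X))) ≤ 1 / (2 * X) := by
  have hX0 : 0 < X := by linarith
  have hexp : Real.exp (-(10 * (d * Real.log X))) = 1 / (X ^ 10) ^ d := by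
    rw [Real.exp_neg, one_div, ← pow_mul, show 10 * (d * Real.log X) =
      Real.log X * (10 * d : ℕ) by push_cast; ring, ← Real.rpow_def_of_pos hX0, Real.rpow_natCast]
  have hX2 : 2 ^ 2 ≤ X ^ 2 := pow_le_pow_left₀ zero_le_two hX 2
  have hX4 : 2 ^ 4 ≤ X ^ 4 := pow_le_pow_left₀ zero_le_two hX 4
  have hcube : 3 * X ≤ X ^ 3 := by nlinarith
  have hX7 : X ^ 7 ≤ (X ^ 7) ^ d := le_self_pow₀ (one_le_pow₀ (by linarith)) hd
  calc 2 * N * Real.exp (-(10 * (d * Real.log X)))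
      ≤ 2 * (X ^ 2 * (X ^ 3) ^ d) * (1 / (X ^ 10) ^ d) := by
        rw [hexp]
        gcongr
        exact hN.trans (by gcongr)
    _ = 2 * X ^ 2 / (X ^ 7) ^ d := by
        rw [show X ^ 10 = X ^ 3 * X ^ 7 by ring, mul_pow]
        field_simp
    _ ≤ 2 * X ^ 2 / X ^ 7 := by gcongr
    _ = 2 / X ^ 4 * (1 / X) := by field_simp
    _ ≤ 1 / 2 * (1 / X) := mul_le_mul_of_nonneg_right
        ((div_le_iff₀ (by positivity)).2 (by linarith)) (by positivity)
    _ = 1 / (2 * X) := by field_simp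

theorem sqrt_ten_mul_div_le {u q ι n : ℝ} (hn : 0 < n) (hι : 0 ≤ ι) (hu : 0 ≤ u) (h : u ≤ q) :
    √(u * (10 * ι) / n) ≤ 4 * √(q * ι / n) := by
  have hq : 0 ≤ q := hu.trans h
  refine Real.sqrt_le_iff.2 ⟨by positivity, ?_⟩
  rw [mul_pow, Real.sq_sqrt (by positivity), mul_div_assoc', div_le_div_iff_of_pos_right hn]
  nlinarith [mul_le_mul_of_nonneg_right h hι, mul_nonneg hu hι]

section EstimationError

variable {d H S K n : ℕ} {ι : ℝ} (hd : 1 ≤ d) (hH : 1 ≤ H) (hS : 1 ≤ S) (hι : 2 / 3 ≤ ι)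
  (hn : n ≠ 0) (hnK : n < K)

include hd hH hS hι hn hnK

theorem min_deviation_le :
    min (8 * H * √(10 * (d * ι) / n) + 2 * H / K) (2 * H * √(S * (10 * ι) / n)) ≤
      32 * √(min (d : ℝ) S * (H : ℝ) ^ 2 * ι / n) + 3 * ((H : ℝ) ^ 2 * S * ι / n) := by
  have hH1 : (1 : ℝ) ≤ H := by exact_mod_cast hH
  have hS1 : (1 : ℝ) ≤ S := by exact_mod_cast hS
  have hn0 : (0 : ℝ) < n := by exact_mod_cast Nat.pos_of_ne_zero hn
  have hι0 : 0 ≤ ι := by linarith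
  have hdeviation : ∀ u : ℝ, 0 ≤ u → u ≤ min (d : ℝ) S →
      H * √(u * (10 * ι) / n) ≤ 4 * √(min (d : ℝ) S * (H : ℝ) ^ 2 * ι / n) := fun u hu hum => by
    have h := sqrt_ten_mul_div_le (u := u * (H : ℝ) ^ 2) (q := min (d : ℝ) S * (H : ℝ) ^ 2) hn0 hι0
      (by positivity) (by gcongr)
    rwa [show u * (H : ℝ) ^ 2 * (10 * ι) / n = (H : ℝ) ^ 2 * (u * (10 * ι) / n) by ring,
      Real.sqrt_mul (by positivity), Real.sqrt_sq (by positivity)] at h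
  rcases le_total (d : ℝ) S with hdS | hSd
  · refine (min_le_left _ _).trans ?_
    have hgrid : 2 * (H : ℝ) / K ≤ 3 * ((H : ℝ) ^ 2 * S * ι / n) := by
      have hHSι : 2 / 3 ≤ H * S * ι := by nlinarith [one_le_mul_of_one_le_of_one_le hH1 hS1]
      calc 2 * (H : ℝ) / K ≤ 2 * H / n := by gcongr
        _ ≤ 3 * H * (H * S * ι) / n := by
          refine div_le_div_of_nonneg_right ?_ hn0.le
          linarith [mul_le_mul_of_nonneg_left hHSι (zero_le_one.trans hH1)]
        _ = _ := by ring
    have hmain := hdeviation d (by positivity) (le_min le_rfl hdS)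
    rw [show (d : ℝ) * (10 * ι) = 10 * (d * ι) by ring] at hmain
    linarith
  · have hmain := hdeviation S (by positivity) (le_min hSd le_rfl)
    have hlower : 0 ≤ (H : ℝ) ^ 2 * S * ι / n := by positivity
    linarith [min_le_right (8 * H * √(10 * (d * ι) / n) + 2 * H / K) (2 * H * √(S * (10 * ι) / n)),
      Real.sqrt_nonneg (min (d : ℝ) S * (H : ℝ) ^ 2 * ι / n)]

theorem estimation_error_le :
    3 * √(10 * ι / n) + min (8 * H * √(10 * (d * ι) / n) + 2 * H / K)
        (2 * H * √(S * (10 * ι) / n)) + S * (4 * H * (10 * ι) / n) * (2 * H) ≤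
      100 * (√(min (d : ℝ) S * (H : ℝ) ^ 2 * ι / n) + (H : ℝ) ^ 2 * S * ι / n) := by
  have hn0 : (0 : ℝ) < n := by exact_mod_cast Nat.pos_of_ne_zero hn
  have hι0 : 0 ≤ ι := by linarith
  have hmH : 1 ≤ min (d : ℝ) S * (H : ℝ) ^ 2 :=
    one_le_mul_of_one_le_of_one_le (le_min (by exact_mod_cast hd) (by exact_mod_cast hS))
      (one_le_pow₀ (by exact_mod_cast hH))
  have hreturn := sqrt_ten_mul_div_le hn0 hι0 zero_le_one hmH
  rw [one_mul] at hreturn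
  have hlower : S * (4 * H * (10 * ι) / n) * (2 * H) = 80 * ((H : ℝ) ^ 2 * S * ι / n) := by ring
  linarith [min_deviation_le hd hH hS hι hn hnK, show 0 ≤ (H : ℝ) ^ 2 * S * ι / n by positivity,
    Real.sqrt_nonneg (min (d : ℝ) S * (H : ℝ) ^ 2 * ι / n)]

end EstimationError

theorem two_thirds_le_log {X : ℝ} (hX : 2 ≤ X) : 2 / 3 ≤ Real.log X := by
  linarith [Real.log_le_log two_pos hX, Real.log_two_gt_d9]

theorem mul_log_add_mul_log_sq_le {Z a₁ a₂ : ℝ} (hZ : 2 ≤ Z) (h₁ : a₁ ≤ Z ^ 4) (h₂ : a₂ ≤ Z ^ 4) :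
    a₁ * Real.log Z + a₂ * Real.log Z ^ 2 ≤ Z ^ 7 := by
  have hlog0 : 0 ≤ Real.log Z := Real.log_nonneg (by linarith)
  have hlogZ : Real.log Z ≤ Z := Real.log_le_self (by linarith)
  calc a₁ * Real.log Z + a₂ * Real.log Z ^ 2 ≤ Z ^ 4 * Z + Z ^ 4 * Z ^ 2 := by gcongr
    _ = (Z + Z ^ 2) * Z ^ 4 := by ring
    _ ≤ Z ^ 3 * Z ^ 4 := by
        gcongr
        nlinarith
    _ = Z ^ 7 := by ring

/- `K` appears in its own logarithm. Writing `K = 2 ^ 42 * ρ * r`, the logarithm grows at most like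
`√r`, so it is absorbed by the slack `r` even when squared. -/
theorem log_add_log_le_mul_sqrt {Z ρ K : ℝ} (hZ : 2 ≤ Z) (hρ : 0 < ρ) (hρZ : ρ ≤ Z ^ 7)
    (hK : 2 ^ 42 * ρ ≤ K) :
    Real.log Z + Real.log K ≤ 53 * (Real.log Z * √(K / (2 ^ 42 * ρ))) := by
  set r := K / (2 ^ 42 * ρ) with hr
  have hr1 : 1 ≤ r := (one_le_div (by positivity)).2 hK
  have hr0 : 0 < r := by linarith
  have hsqrt : 1 ≤ √r := Real.one_le_sqrt.2 hr1
  have hlogr : Real.log r ≤ 2 * √r := by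
    have h := Real.log_le_self (Real.sqrt_nonneg r)
    rw [Real.log_sqrt hr0.le] at h
    linarith
  have hlogρ : Real.log ρ ≤ 7 * Real.log Z := by
    have h := Real.log_le_log hρ hρZ
    rwa [Real.log_pow] at h
  have hlogK : Real.log K = 42 * Real.log 2 + Real.log ρ + Real.log r := by
    rw [show K = 2 ^ 42 * ρ * r by rw [hr]; field_simp, Real.log_mul (by positivity) hr0.ne',
      Real.log_mul (by positivity) hρ.ne', Real.log_pow]
    norm_num
  have hlog2 : Real.log 2 ≤ Real.log Z := Real.log_le_log two_pos hZ
  have hlogZ := two_thirds_le_log hZ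
  have habsorb : Real.log Z ≤ Real.log Z * √r := le_mul_of_one_le_right (by linarith) hsqrt
  have hsqrtZ : 2 / 3 * √r ≤ Real.log Z * √r := by gcongr
  linarith

theorem rate_log_le {Z a₁ a₂ K ι : ℝ} (hZ : 2 ≤ Z) (ha₁ : 0 < a₁) (ha₂ : 0 ≤ a₂)
    (h₁ : a₁ ≤ Z ^ 4) (h₂ : a₂ ≤ Z ^ 4) (hK : 2 ^ 42 * (a₁ * Real.log Z + a₂ * Real.log Z ^ 2) ≤ K)
    (hι0 : 0 ≤ ι) (hι : ι ≤ Real.log Z + Real.log K) :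
    a₁ * ι ≤ 53 * (K / 2 ^ 42) ∧ a₂ * ι ^ 2 ≤ 2809 * (K / 2 ^ 42) := by
  have hlogZ : 0 < Real.log Z := Real.log_pos (by linarith)
  set ρ := a₁ * Real.log Z + a₂ * Real.log Z ^ 2
  have hρ0 : 0 < ρ := by positivity
  set r := K / (2 ^ 42 * ρ) with hr
  have hr1 : 1 ≤ r := (one_le_div (by positivity)).2 hK
  have hKρ : K / 2 ^ 42 = ρ * r := by rw [hr]; field_simp
  have hιr : ι ≤ 53 * (Real.log Z * √r) :=
    hι.trans (log_add_log_le_mul_sqrt hZ hρ0 (mul_log_add_mul_log_sq_le hZ h₁ h₂) hK)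
  have hfirst : a₁ * Real.log Z ≤ ρ := le_add_of_nonneg_right (by positivity)
  have hsecond : a₂ * Real.log Z ^ 2 ≤ ρ := le_add_of_nonneg_left (by positivity)
  rw [hKρ]
  constructor
  · calc a₁ * ι ≤ a₁ * (53 * (Real.log Z * √r)) := by gcongr
      _ = 53 * (a₁ * Real.log Z * √r) := by ring
      _ ≤ 53 * (ρ * r) := by
        have hsqrt : √r ≤ r := Real.sqrt_le_iff.2 ⟨by linarith, le_self_pow₀ hr1 two_ne_zero⟩
        gcongr
  · calc a₂ * ι ^ 2 ≤ a₂ * (53 * (Real.log Z * √r)) ^ 2 := by gcongr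
      _ = 2809 * (a₂ * Real.log Z ^ 2 * √r ^ 2) := by ring
      _ ≤ 2809 * (ρ * r) := by
        rw [Real.sq_sqrt (by linarith)]
        gcongr

theorem exploration_bound_le {m H S M ι K ε : ℝ} (hm : 0 ≤ m) (hH : 1 ≤ H) (hS : 1 ≤ S)
    (hM : 1 ≤ M) (hι : 2 / 3 ≤ ι) (hK : 0 < K) (hε : 0 < ε) (hlog : Real.log K ≤ ι)
    (h₁ : 115200 ^ 2 * (m * H ^ 4 * M * ι) ≤ K * ε ^ 2)
    (h₂ : 230400 * (H ^ 3 * S * M * ι ^ 2) ≤ K * ε) :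
    18 * (8 * H * (M * (H + 2 * (100 * (H ^ 2 * S * ι)) * (1 + Real.log K)) +
      4 * (100 * √(m * H ^ 2 * ι)) * √(M * K) + 8 * H ^ 2 * (10 * ι))) ≤ K * ε := by
  set T := H ^ 3 * S * M * ι ^ 2 with hT
  have hmain : 115200 * H * (√(m * H ^ 2 * ι) * √(M * K)) ≤ K * ε := by
    refine le_of_abs_le (abs_le_of_sq_le_sq ?_ (by positivity))
    rw [mul_pow, mul_pow √_, Real.sq_sqrt (by positivity), Real.sq_sqrt (by positivity)]
    calc _ = 115200 ^ 2 * (m * H ^ 4 * M * ι) * K := by ring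
      _ ≤ K * ε ^ 2 * K := by gcongr
      _ = _ := by ring
  have hι2 : 4 / 9 ≤ ι ^ 2 := by nlinarith
  have hunvisited : H * (M * H) * (4 / 9) ≤ T := by
    calc H * (M * H) * (4 / 9) = H ^ 2 * 1 * M * (4 / 9) := by ring
      _ ≤ H ^ 3 * S * M * ι ^ 2 := by
        gcongr
        norm_num
  have hharmonic : H * (M * (H ^ 2 * S * ι * (1 + Real.log K))) ≤ 3 * T := by
    calc H * (M * (H ^ 2 * S * ι * (1 + Real.log K)))
      _ ≤ H * (M * (H ^ 2 * S * ι * (3 * ι))) := by gcongr; linarith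
      _ = 3 * T := by rw [hT]; ring
  have hmartingale : H * (H ^ 2 * ι) * (2 / 3) ≤ T := by
    calc H * (H ^ 2 * ι) * (2 / 3) = H ^ 3 * 1 * 1 * (ι * (2 / 3)) := by ring
      _ ≤ H ^ 3 * S * M * (ι * ι) := by gcongr
      _ = T := by rw [hT]; ring
  have hT0 : 0 ≤ T := by positivity
  calc _ = 144 * (H * (M * H)) + 28800 * (H * (M * (H ^ 2 * S * ι * (1 + Real.log K)))) +
        115200 * H * (√(m * H ^ 2 * ι) * √(M * K)) / 2 + 11520 * (H * (H ^ 2 * ι)) := by ring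
    _ ≤ K * ε := by linarith

end Numerics

theorem VMG.dualityGap_eq_zero {d H : ℕ} {𝒮 𝒜 ℬ : Type*} [Fintype 𝒮] [Fintype 𝒜] [Fintype ℬ]
    [Subsingleton 𝒜] [Subsingleton ℬ] (G : VMG d H 𝒮 𝒜 ℬ) (s₁ : 𝒮)
    (θ : EuclideanSpace ℝ (Fin d)) (μ : Policy H 𝒮 𝒜) (ν : Policy H 𝒮 ℬ) :
    G.dualityGap s₁ θ μ ν = 0 := by
  rw [dualityGap, valueVsBestMax, valueVsBestMin, ciSup_subsingleton ν, ciInf_subsingleton μ,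
    sub_self]

theorem VIZero.plan_nonempty {K d H : ℕ} {𝒮 𝒜 ℬ : Type*} [Fintype 𝒮] [Fintype 𝒜] [Fintype ℬ]
    [Nonempty 𝒜] [Nonempty ℬ] (hK : 0 < K) (β : ℕ → ℝ) (s₁ : 𝒮)
    (sel : ℕ → Fin H → 𝒮 → (𝒜 × ℬ → ℝ) → 𝒜 × ℬ) (D : Fin K → Episode H 𝒮 𝒜 ℬ)
    {r : Fin K → Fin H → EuclideanSpace ℝ (Fin d)} (hr : ∀ i h, ‖r i h‖ ≤ 1)
    (θ : EuclideanSpace ℝ (Fin d)) : ((algorithm K β s₁ sel).plan D r θ).Nonempty := by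
  have : Nonempty (Fin K) := ⟨⟨0, hK⟩⟩
  have : Nonempty 𝒮 := ⟨s₁⟩
  obtain ⟨k, hk⟩ := Finite.exists_min
    fun k : Fin K => vTilde β (fun i : Fin k => D (Fin.castLE k.isLt.le i)) 0 s₁
  obtain ⟨Ghat, hG⟩ := exists_isEmpiricalGame (fun i : Fin k => D (Fin.castLE k.isLt.le i))
    (r := fun i : Fin k => r (Fin.castLE k.isLt.le i)) fun i h => hr _ h
  obtain ⟨μ, ν, hN⟩ := Ghat.exists_isNashVIOutput θ
  exact ⟨(μ, ν), k, hk, Ghat, hG, Or.inl hN⟩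

theorem ExplorationRun.Good.dualityGap_le {K d H : ℕ} {𝒮 𝒜 ℬ : Type*} [Fintype 𝒮] [Fintype 𝒜]
    [Fintype ℬ] [Nonempty 𝒜] [Nonempty ℬ] {β : ℕ → ℝ} {s₁ : 𝒮}
    {sel : ℕ → Fin H → 𝒮 → (𝒜 × ℬ → ℝ) → 𝒜 × ℬ} {G : VMG d H 𝒮 𝒜 ℬ} {Ω : Type*}
    [MeasurableSpace Ω] {P : Measure Ω} {R : ExplorationRun (VIZero.algorithm K β s₁ sel) G s₁ P}
    {S : ℕ} {L L' ε : ℝ} {ω : Ω} {W : ∀ k : Fin K, (Fin k → Episode H 𝒮 𝒜 ℬ) → Fin H → 𝒮 → ℝ}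
    (hg : R.Good (G.gridFamily (d * K)) S L L' W ω) (hL : 0 ≤ L) (hd : 0 < d)
    (hS : Fintype.card 𝒮 ≤ S) (hβ0 : ∀ t, 0 ≤ β t)
    (hβ : ∀ n : ℕ, n ≠ 0 → n < K → 3 * √(L / n) + min (8 * H * √(L' / n) + 2 * H / K)
      (2 * H * √(S * L / n)) + S * (4 * H * L / n) * (2 * H) ≤ β n)
    (hsum : 18 * ∑ k, VIZero.vTilde β (R.past k ω) 0 s₁ ≤ K * ε)
    {θ : EuclideanSpace ℝ (Fin d)} (hθ : ‖θ‖ ≤ 1) {μ : Policy H 𝒮 𝒜} {ν : Policy H 𝒮 ℬ}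
    (hπ : (μ, ν) ∈ (VIZero.algorithm K β s₁ sel).plan (fun k => R.episode k ω)
      (fun k h => R.ret k h ω) θ) :
    G.dualityGap s₁ θ μ ν ≤ ε := by
  obtain ⟨out, hout, Ghat, hG, hN⟩ := hπ
  have hNashVI : Ghat.IsNashVIOutput θ μ ν := hN.elim id fun h => h.isNashVIOutput
  refine (VMG.dualityGap_le_of_isNashVIOutput hNashVI hθ (hg.isErrorBound hL hd hS hθ hβ hG)
    fun h s => (VIZero.vTilde_mem_Icc _ hβ0 h s).1).trans ?_
  have haverage : K * VIZero.vTilde β (R.past out ω) 0 s₁ ≤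
      ∑ k, VIZero.vTilde β (R.past k ω) 0 s₁ := by
    calc _ = ∑ _k : Fin K, VIZero.vTilde β (R.past out ω) 0 s₁ := by simp
      _ ≤ _ := Finset.sum_le_sum fun k _ => hout k
  have hK : (0 : ℝ) < K := by exact_mod_cast out.pos
  refine le_of_mul_le_mul_left ?_ hK
  linarith

theorem natCast_le_natCast_div_of_dvd {n N : ℕ} {e : ℝ} (hn : n ∣ N) (hN : 0 < N) (he : 0 < e)
    (he1 : e ≤ 1) : (n : ℝ) ≤ N / e :=
  (Nat.cast_le.2 (Nat.le_of_dvd hN hn)).trans (le_div_self N.cast_nonneg he he1)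

namespace VIZero

/-- The argument of the logarithm in the bonus of VI-Zero. -/
noncomputable def logArg (d H S A B K : ℕ) (δ : ℝ) : ℝ :=
  d * S * A * B * K * H / δ

section Bonus

variable {c δ : ℝ} {d H S A B K : ℕ} (hlog : 0 ≤ Real.log (logArg d H S A B K δ))

include hlog

theorem bonus_nonneg (hc : 0 ≤ c) (t : ℕ) : 0 ≤ bonus c d H S A B K δ t := by
  unfold logArg at hlog
  unfold bonus
  positivity

theorem mul_mul_le_bonus (t : ℕ) :
    S * (2 * H * (10 * Real.log (logArg d H S A B K δ)) / t) * H ≤ bonus 100 d H S A B K δ t := by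
  change _ ≤ 100 * (√(min (d : ℝ) S * H ^ 2 * Real.log (logArg d H S A B K δ) / t) +
    H ^ 2 * S * Real.log (logArg d H S A B K δ) / t)
  have hlower : 0 ≤ H ^ 2 * S * Real.log (logArg d H S A B K δ) / t := by positivity
  calc _ = 20 * (H ^ 2 * S * Real.log (logArg d H S A B K δ) / t) := by ring
    _ ≤ _ := by linarith [Real.sqrt_nonneg (min (d : ℝ) S * H ^ 2 *
        Real.log (logArg d H S A B K δ) / t)]

theorem bonus_eq_div_sqrt_add_div (t : ℕ) :
    bonus c d H S A B K δ t =
      c * √(min (d : ℝ) S * H ^ 2 * Real.log (logArg d H S A B K δ)) / √t +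
        c * (H ^ 2 * S * Real.log (logArg d H S A B K δ)) / t := by
  change c * (√(min (d : ℝ) S * H ^ 2 * Real.log (logArg d H S A B K δ) / t) +
    H ^ 2 * S * Real.log (logArg d H S A B K δ) / t) = _
  rw [Real.sqrt_div (by positivity)]
  ring

end Bonus

section Rate

variable {d H S A B : ℕ} {ε δ : ℝ} (hN : 0 < d * S * A * B * H) (hε : 0 < ε) (hδ : 0 < δ)

include hN hε

theorem rate_pos (hlog : 0 < logFactor d H S A B ε δ) : 0 < rate d H S A B ε δ := by
  simp only [Nat.pos_iff_ne_zero, mul_ne_zero_iff] at hN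
  obtain ⟨⟨⟨⟨hd, hS⟩, hA⟩, hB⟩, hH⟩ := hN
  unfold rate
  have : 0 < min (d : ℝ) S := lt_min (by positivity) (by positivity)
  positivity

include hδ

theorem pos_of_rate_le {c : ℝ} {K : ℕ} (hc : 0 < c) (hδ1 : δ < 1)
    (hrate : c * rate d H S A B ε δ ≤ K) : 0 < K := by
  have he0 : 0 < min ε 1 * δ := mul_pos (lt_min hε one_pos) hδ
  have he1 : min ε 1 * δ < 1 :=
    (mul_le_of_le_one_left hδ.le (min_le_right _ _)).trans_lt hδ1
  have hlog : 0 < logFactor d H S A B ε δ := by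
    have hN1 : (1 : ℝ) ≤ (d * S * A * B * H : ℕ) := by exact_mod_cast hN
    push_cast at hN1
    exact Real.log_pos ((one_lt_div he0).2 (he1.trans_le hN1))
  exact_mod_cast (mul_pos hc (rate_pos hN hε hlog)).trans_le hrate

theorem rate_coefficients_le (hδ1 : δ ≤ 1) :
    min (d : ℝ) S * H ^ 4 * S * A * B / ε ^ 2 ≤ (d * S * A * B * H / (min ε 1 * δ)) ^ 4 ∧
      H ^ 3 * S ^ 2 * A * B / ε ≤ ((d * S * A * B * H / (min ε 1 * δ)) ^ 4 : ℝ) := by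
  have he0 : 0 < min ε 1 * δ := mul_pos (lt_min hε one_pos) hδ
  have he1 : min ε 1 * δ ≤ 1 := mul_le_one₀ (min_le_right _ _) hδ.le hδ1
  have heε : min ε 1 * δ ≤ ε :=
    (mul_le_of_le_one_right (lt_min hε one_pos).le hδ1).trans (min_le_left _ _)
  have hdvd : ∀ n : ℕ, n ∣ (d * S * A * B * H) ^ 4 → (n : ℝ) ≤ (d * S * A * B * H) ^ 4 :=
    fun n hn => by exact_mod_cast Nat.le_of_dvd (pow_pos hN 4) hn
  rw [div_pow]
  refine ⟨div_le_div₀ (by positivity) ?_ (by positivity) ?_,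
    div_le_div₀ (by positivity) ?_ (by positivity) ?_⟩
  · refine le_trans ?_ (hdvd (d * H ^ 4 * S * A * B) ⟨d ^ 3 * S ^ 3 * A ^ 3 * B ^ 3, by ring⟩)
    push_cast
    gcongr
    exact min_le_left _ _
  · exact (pow_le_pow_of_le_one he0.le he1 (by norm_num)).trans (pow_le_pow_left₀ he0.le heε 2)
  · exact_mod_cast hdvd (H ^ 3 * S ^ 2 * A * B) ⟨d ^ 4 * S ^ 2 * A ^ 3 * B ^ 3 * H, by ring⟩
  · exact (pow_le_of_le_one he0.le he1 (by norm_num)).trans heε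

end Rate

section TwoActions

variable {d H S A B K : ℕ} {δ : ℝ} (hN : 0 < d * S * A * B * H) (hK : 0 < K) (hAB : 2 ≤ A * B)
  (hδ : 0 < δ) (hδ1 : δ ≤ 1)

include hN hK hδ

theorem one_div_logArg_le : 1 / logArg d H S A B K δ ≤ δ := by
  rw [logArg, one_div_div]
  refine div_le_self hδ.le ?_
  have hNK : 1 ≤ d * S * A * B * K * H := by
    rw [mul_right_comm]
    exact Nat.mul_pos hN hK
  exact_mod_cast hNK

include hδ1

theorem natCast_le_logArg {n : ℕ} (hn : n ∣ d * S * A * B * K * H) :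
    (n : ℝ) ≤ logArg d H S A B K δ := by
  have hNK : 0 < d * S * A * B * K * H := by
    rw [mul_right_comm]
    exact Nat.mul_pos hN hK
  simpa [logArg] using natCast_le_natCast_div_of_dvd hn hNK hδ hδ1

theorem tests_le_four_mul_logArg_sq {s m : ℕ} (hs : s ≤ S) (hm : m ≤ S * A * B) :
    (K * H * m * (s + s * K + K) + H : ℝ) ≤ 4 * logArg d H S A B K δ ^ 2 := by
  have hdvd := fun n => natCast_le_logArg hN hK hδ hδ1 (n := n)
  have hS : 0 < S := Nat.pos_of_ne_zero (by rintro rfl; simp at hN)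
  have htests : s + s * K + K ≤ 3 * (S * K) := by
    linarith [Nat.mul_le_mul_right K hs, Nat.le_mul_of_pos_right S hK, Nat.le_mul_of_pos_left K hS]
  calc (K * H * m * (s + s * K + K) + H : ℝ)
    _ ≤ (K * H * (S * A * B) : ℕ) * (3 * (S * K : ℕ)) + H := by
      gcongr
      exacts [by exact_mod_cast Nat.mul_le_mul_left _ hm, by exact_mod_cast htests]
    _ ≤ logArg d H S A B K δ * (3 * logArg d H S A B K δ) +
        logArg d H S A B K δ * logArg d H S A B K δ := by
      have hone : 1 ≤ logArg d H S A B K δ := by exact_mod_cast hdvd 1 (one_dvd _)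
      have hH := (hdvd H ⟨d * S * A * B * K, by ring⟩).trans
        (le_mul_of_one_le_left (zero_le_one.trans hone) hone)
      have := zero_le_one.trans hone
      gcongr
      exacts [hdvd _ ⟨d, by ring⟩, hdvd _ ⟨d * A * B * H, by ring⟩]
    _ = _ := by ring

theorem grid_tests_le_logArg_sq_mul {g m : ℕ} (hg : g ≤ (3 * (d * K)) ^ d) (hm : m ≤ S * A * B) :
    (K * H * m * (g * K) : ℝ) ≤
      logArg d H S A B K δ ^ 2 * (3 * logArg d H S A B K δ) ^ d := by
  have hdvd := fun n => natCast_le_logArg hN hK hδ hδ1 (n := n)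
  calc (K * H * m * (g * K) : ℝ)
    _ ≤ (K * H * (S * A * B) : ℕ) * ((3 * (d * K : ℕ)) ^ d * K) := by
      gcongr
      exacts [by exact_mod_cast Nat.mul_le_mul_left _ hm, by exact_mod_cast hg]
    _ ≤ logArg d H S A B K δ * ((3 * logArg d H S A B K δ) ^ d * logArg d H S A B K δ) := by
      have hX0 : 0 ≤ logArg d H S A B K δ := (Nat.cast_nonneg 1).trans (hdvd 1 (one_dvd _))
      gcongr
      exacts [hdvd _ ⟨d, by ring⟩, hdvd _ ⟨S * A * B * H, by ring⟩,
        hdvd _ ⟨d * S * A * B * H, by ring⟩]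
    _ = _ := by ring

include hAB

theorem two_le_logArg : 2 ≤ logArg d H S A B K δ :=
  le_trans (by exact_mod_cast hAB)
    (natCast_le_logArg hN hK hδ hδ1 (n := A * B) ⟨d * S * K * H, by ring⟩)

theorem averaged_uncertainty_le {ε : ℝ} (hε : 0 < ε) (hrate : 2 ^ 42 * rate d H S A B ε δ ≤ K) :
    18 * (8 * H * ((S * A * B) *
      (H + 2 * (100 * (H ^ 2 * S * Real.log (logArg d H S A B K δ))) * (1 + Real.log K)) +
      4 * (100 * √(min (d : ℝ) S * H ^ 2 * Real.log (logArg d H S A B K δ))) * √((S * A * B) * K) +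
      8 * H ^ 2 * (10 * Real.log (logArg d H S A B K δ)))) ≤ (K * ε : ℝ) := by
  have hKX := natCast_le_logArg hN hK hδ hδ1 (n := K) ⟨d * S * A * B * H, by ring⟩
  have hX := two_le_logArg hN hK hAB hδ hδ1
  have he0 : 0 < min ε 1 * δ := mul_pos (lt_min hε one_pos) hδ
  have he1 : min ε 1 * δ ≤ 1 := mul_le_one₀ (min_le_right _ _) hδ.le hδ1
  have hZ : (2 : ℝ) ≤ d * S * A * B * H / (min ε 1 * δ) := by
    refine le_trans (b := ((A * B : ℕ) : ℝ)) (by exact_mod_cast hAB) ?_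
    exact_mod_cast natCast_le_natCast_div_of_dvd ⟨d * S * H, by ring⟩ hN he0 he1
  have hlogXZ : Real.log (logArg d H S A B K δ) ≤
      Real.log (d * S * A * B * H / (min ε 1 * δ)) + Real.log K := by
    rw [← Real.log_mul (by positivity) (by positivity)]
    refine Real.log_le_log (by linarith) ?_
    rw [logArg, div_mul_eq_mul_div, mul_right_comm _ (K : ℝ)]
    gcongr
    exact mul_le_of_le_one_left hδ.le (min_le_right _ _)
  obtain ⟨hfirst, hsecond⟩ := rate_coefficients_le hN hε hδ hδ1
  simp only [Nat.pos_iff_ne_zero, mul_ne_zero_iff] at hN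
  obtain ⟨⟨⟨⟨hd, hS⟩, hA⟩, hB⟩, hH⟩ := hN
  have hm : 0 < min (d : ℝ) S := lt_min (by positivity) (by positivity)
  have hlogX := two_thirds_le_log hX
  have hcard : 1 ≤ S * A * B := Nat.one_le_iff_ne_zero.2 (by positivity)
  obtain ⟨hleading, hlower⟩ := rate_log_le (K := K) hZ (by positivity) (by positivity) hfirst
    hsecond (le_trans (le_of_eq (by unfold rate logFactor; ring)) hrate) (by linarith) hlogXZ
  refine exploration_bound_le hm.le (Nat.one_le_cast.2 (Nat.pos_of_ne_zero hH))
    (Nat.one_le_cast.2 (Nat.pos_of_ne_zero hS)) (by exact_mod_cast hcard) hlogX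
    (by positivity) hε (Real.log_le_log (by positivity) hKX) ?_ ?_
  · calc _ = 115200 ^ 2 * (min (d : ℝ) S * H ^ 4 * S * A * B / ε ^ 2 *
          Real.log (logArg d H S A B K δ)) * ε ^ 2 := by field_simp
      _ ≤ K * ε ^ 2 := by gcongr; linarith
  · calc _ = 230400 * (H ^ 3 * S ^ 2 * A * B / ε *
          Real.log (logArg d H S A B K δ) ^ 2) * ε := by field_simp
      _ ≤ K * ε := by gcongr; linarith

end TwoActions

end VIZero

theorem card_gridPoint_le {d K : ℕ} (hd : 0 < d) (hK : 0 < K) :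
    Fintype.card {j : Fin d → Fin (2 * (d * K) + 1) // ‖gridPoint (d * K) j‖ ≤ 2} ≤
      (3 * (d * K)) ^ d := by
  calc _ ≤ (2 * (d * K) + 1) ^ d := (Fintype.card_subtype_le _).trans_eq <| by
        rw [Fintype.card_fun, Fintype.card_fin, Fintype.card_fin]
    _ ≤ (3 * (d * K)) ^ d := Nat.pow_le_pow_left (by linarith [Nat.mul_pos hd hK]) d

theorem ExplorationRun.measure_not_good_gridFamily_le {K d H S A B : ℕ} {𝒮 𝒜 ℬ : Type*}
    [Fintype 𝒮] [Fintype 𝒜] [Fintype ℬ] [Nonempty 𝒜] [Nonempty ℬ] {s₁ : 𝒮} {G : VMG d H 𝒮 𝒜 ℬ}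
    {Ω : Type*} [MeasurableSpace Ω] {P : Measure Ω} [IsProbabilityMeasure P]
    {alg : ExplorePlan K d H 𝒮 𝒜 ℬ} (R : ExplorationRun alg G s₁ P)
    (hS : Fintype.card 𝒮 ≤ S) (hA : Fintype.card 𝒜 ≤ A) (hB : Fintype.card ℬ ≤ B)
    (hN : 0 < d * S * A * B * H) (hK : 0 < K) (hAB : 2 ≤ A * B) {δ : ℝ} (hδ : 0 < δ) (hδ1 : δ ≤ 1)
    {W : ∀ k : Fin K, (Fin k → Episode H 𝒮 𝒜 ℬ) → Fin H → 𝒮 → ℝ}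
    (hW : ∀ k D h x, W k D h x ∈ Set.Icc 0 1) :
    P {ω | ¬ R.Good (G.gridFamily (d * K)) S (10 * Real.log (VIZero.logArg d H S A B K δ))
      (10 * (d * Real.log (VIZero.logArg d H S A B K δ))) W ω} ≤ ENNReal.ofReal δ := by
  have hX := VIZero.two_le_logArg hN hK hAB hδ hδ1
  have hlog : 0 < Real.log (VIZero.logArg d H S A B K δ) := Real.log_pos (by linarith)
  have hcard : Fintype.card 𝒮 * Fintype.card 𝒜 * Fintype.card ℬ ≤ S * A * B := by gcongr
  have hd : d ≠ 0 := by rintro rfl; simp at hN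
  have hS0 : 0 < S := Nat.pos_of_ne_zero (by rintro rfl; simp at hN)
  refine (R.measure_not_good_le (G.gridFamily_mem_Icc (d * K)) hS0 hS (by positivity)
    (by positivity) hW).trans (ENNReal.ofReal_le_ofReal ?_)
  have htests := VIZero.tests_le_four_mul_logArg_sq hN hK hδ hδ1 hS hcard
  have hgrid := VIZero.grid_tests_le_logArg_sq_mul hN hK hδ hδ1
    (card_gridPoint_le (Nat.pos_of_ne_zero hd) hK) hcard
  push_cast at htests hgrid
  calc _ ≤ 1 / (2 * VIZero.logArg d H S A B K δ) + 1 / (2 * VIZero.logArg d H S A B K δ) :=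
        add_le_add (two_mul_mul_exp_neg_log_le hX htests)
          (two_mul_mul_exp_neg_mul_log_le hd hX hgrid)
    _ = 1 / VIZero.logArg d H S A B K δ := by ring
    _ ≤ δ := VIZero.one_div_logArg_le hN hK hδ

namespace VIZero

section

variable {K d H S A B : ℕ} {𝒮 𝒜 ℬ : Type*} [Fintype 𝒮] [Fintype 𝒜] [Fintype ℬ] [Nonempty 𝒜]
  [Nonempty ℬ] {s₁ : 𝒮} {sel : ℕ → Fin H → 𝒮 → (𝒜 × ℬ → ℝ) → 𝒜 × ℬ}

theorem algorithm_isRewardFree_of_subsingleton [Subsingleton 𝒜] [Subsingleton ℬ] (hK : 0 < K)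
    (β : ℕ → ℝ) {ε : ℝ} (hε : 0 ≤ ε) (δ : ℝ) :
    (algorithm (d := d) K β s₁ sel).IsRewardFree s₁ ε δ := by
  intro G Ω _ P _ R
  have hnull : P {ω | ¬ ∀ k h, ‖R.ret k h ω‖ ≤ 1} = 0 :=
    ae_iff.1 (ae_all_iff.2 fun k => ae_all_iff.2 fun h => R.norm_ret_le k h)
  refine (measure_mono fun ω hω => ?_).trans (hnull.trans_le zero_le)
  refine fun hret => hω fun θ _ => ⟨plan_nonempty hK _ _ _ _ hret θ, fun μ ν _ => ?_⟩
  rwa [VMG.dualityGap_eq_zero]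

theorem algorithm_isRewardFree (hS : Fintype.card 𝒮 ≤ S) (hA : Fintype.card 𝒜 ≤ A)
    (hB : Fintype.card ℬ ≤ B) (hsel : ∀ k h s (f : 𝒜 × ℬ → ℝ) p, f p ≤ f (sel k h s f))
    (hN : 0 < d * S * A * B * H) (hK : 0 < K) (hAB : 2 ≤ A * B) {ε δ : ℝ} (hε : 0 < ε)
    (hδ : 0 < δ) (hδ1 : δ ≤ 1) (hrate : 2 ^ 42 * rate d H S A B ε δ ≤ K) :
    (algorithm (d := d) K (bonus 100 d H S A B K δ) s₁ sel).IsRewardFree s₁ ε δ := by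
  intro G Ω _ P _ R
  have hX := two_le_logArg hN hK hAB hδ hδ1
  have hlog := two_thirds_le_log hX
  have hlog0 : 0 ≤ Real.log (logArg d H S A B K δ) := by linarith
  have hL : 0 ≤ 10 * Real.log (logArg d H S A B K δ) := by positivity
  have hβ0 : ∀ t, 0 ≤ bonus 100 d H S A B K δ t := bonus_nonneg hlog0 (by norm_num)
  have hM : (Fintype.card (𝒮 × 𝒜 × ℬ) : ℝ) ≤ S * A * B := by
    rw [Fintype.card_prod, Fintype.card_prod, ← mul_assoc]
    exact_mod_cast (by gcongr : Fintype.card 𝒮 * Fintype.card 𝒜 * Fintype.card ℬ ≤ S * A * B)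
  have hpos := hN
  simp only [Nat.pos_iff_ne_zero, mul_ne_zero_iff, ← Nat.one_le_iff_ne_zero] at hpos
  obtain ⟨⟨⟨⟨hd, hS0⟩, -⟩, -⟩, hH⟩ := hpos
  have hestimation := fun (n : ℕ) (hn : n ≠ 0) (hnK : n < K) =>
    estimation_error_le hd hH hS0 hlog hn hnK
  refine (measure_mono fun ω hω => ?_).trans (R.measure_not_good_gridFamily_le hS hA hB hN hK hAB
    hδ hδ1 fun k => scaledUncertainty_mem_Icc hβ0)
  intro hg
  refine hω fun θ hθ => ⟨plan_nonempty hK _ _ _ _ hg.norm_ret_le θ, fun μ ν hπ => ?_⟩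
  refine hg.dualityGap_le hL hd hS hβ0 hestimation ?_ hθ hπ
  refine (mul_le_mul_of_nonneg_left (hg.sum_vTilde_le hsel hL hS hβ0
    (fun n _ _ => mul_mul_le_bonus hlog0 n) (by positivity) (by positivity)
    (fun n _ => (bonus_eq_div_sqrt_add_div hlog0 n).le) hM) (by norm_num)).trans
    (averaged_uncertainty_le hN hK hAB hδ hδ1 hε hrate)

end

theorem succeeds_of_rate_le {d H S A B K : ℕ} {ε δ : ℝ} (hd : 1 ≤ d) (hS : 1 ≤ S) (hA : 1 ≤ A)
    (hB : 1 ≤ B) (hε : 0 < ε) (hεH : ε ≤ H) (hδ : 0 < δ) (hδ1 : δ ≤ 1)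
    (hrate : 2 ^ 42 * rate d H S A B ε δ ≤ K) :
    Succeeds.{u, v, w, z} 100 d H S A B K ε δ := by
  intro 𝒮 𝒜 ℬ _ _ _ _ _ h𝒮 h𝒜 hℬ s₁ sel hsel
  rcases hδ1.eq_or_lt with rfl | hδ1'
  · intro G Ω _ P _ R
    simpa using prob_le_one
  have hH : 0 < H := by exact_mod_cast hε.trans_le hεH
  have hN : 0 < d * S * A * B * H := by positivity
  have hK : 0 < K := pos_of_rate_le hN hε hδ (by norm_num) hδ1' hrate
  rcases Nat.lt_or_ge (A * B) 2 with hAB | hAB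
  · have hA1 : A ≤ 1 := by nlinarith
    have hB1 : B ≤ 1 := by nlinarith
    have : Subsingleton 𝒜 := Fintype.card_le_one_iff_subsingleton.1 (h𝒜.trans hA1)
    have : Subsingleton ℬ := Fintype.card_le_one_iff_subsingleton.1 (hℬ.trans hB1)
    exact algorithm_isRewardFree_of_subsingleton hK _ hε.le δ
  · exact algorithm_isRewardFree h𝒮 h𝒜 hℬ hsel hN hK hAB hε hδ hδ1 hrate

end VIZero

theorem mainTheorem6 :
    ∃ cβ cK : ℝ, 0 < cβ ∧ 0 < cK ∧
      ∀ (d H S A B : ℕ) (ε δ : ℝ), 1 ≤ d → 1 ≤ S → 1 ≤ A → 1 ≤ B →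
        0 < ε → ε ≤ H → 0 < δ → δ ≤ 1 →
        (∀ K : ℕ, cK * VIZero.rate d H S A B ε δ ≤ K →
          VIZero.Succeeds.{u, v, w, z} cβ d H S A B K ε δ) ∧
        ∃ mRFE : ℕ, mRFE ≤ ⌈cK * VIZero.rate d H S A B ε δ⌉₊ ∧
          VIZero.Succeeds.{u, v, w, z} cβ d H S A B mRFE ε δ := by
  refine ⟨100, 2 ^ 42, by norm_num, by positivity, ?_⟩
  intro d H S A B ε δ hd hS hA hB hε hεH hδ hδ1
  have key : ∀ K : ℕ, 2 ^ 42 * VIZero.rate d H S A B ε δ ≤ K →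
      VIZero.Succeeds.{u, v, w, z} 100 d H S A B K ε δ := fun K hK =>
    VIZero.succeeds_of_rate_le hd hS hA hB hε hεH hδ hδ1 hK
  exact ⟨key, _, le_rfl, key _ (Nat.le_ceil _)⟩
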